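/- **Theorem (upper bound).** *Setting.* Let $D\ge 1$. Let $(V_j)_{j\in\mathbb Z}$ be an $r$-regular multiresolution approximation of $L^2(\mathbb R^D)$ with father wavelet $\phi$ and mother wavelets $\psi_\epsilon$, $\epsilon\in E=\{0,1\}^D\setminus\{0\}$, all of class $C^r$, supported in $[-A,A]^D$ and bounded by $B$ in absolute value. Write $\phi_k(x)=\phi(x-k)$ and, for $\lambda=2^{-j}k+2^{-j-1}\epsilon\in\Lambda_j$ ($k\in\mathbb Z^D$, $\epsilon\in E$), $\psi_\lambda(x)=2^{Dj/2}\psi_\epsilon(2^jx-k)$. For a locally integrable $f$ put $\alpha_k=\int f\phi_k$, $\beta_\lambda=\int f\psi_\lambda$ and $$\|f\|_{B^\sigma_{p,q}}=\|(\alpha_k)_k\|_{\ell^p}+\Big\|\big(2^{j(\sigma+D(1/2-1/p))}\|(\beta_\lambda)_{\lambda\in\Lambda_j}\|_{\ell^p}\big)_{j\ge 0}\Big\|_{\ell^q}.$$ Let $\mathcal F_d=\{f\in L^1_{\mathrm{loc}}:\|f\|_{B^{\sigma_d}_{p_d,q_d}}\le L_d\}$ and let $\mathcal F_g$ be the set of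 probability densities $p$ supported in $[-T,T]^D$ with $\|p\|_{B^{\sigma_g}_{p_g,q_g}}\le L_g$, where $p_d,q_d,p_g,q_g\in[1,\infty]$, $A,B,T,L_d,L_g>0$. Let $d_{\mathcal F_d}(p,q)=\sup_{f\in\mathcal F_d}\left|\int fp-\int fq\right|$, and let $$M(\mathcal F_d,\mathcal F_g)=\inf_{\hat p}\ \sup_{p\in\mathcal F_g}\ \mathbb E\, d_{\mathcal F_d}(p,\hat p(X_1,\dots,X_n)),\qquad X_1,\dots,X_n\ \text{IID with density } p,$$ the infimum being over all (jointly measurable, integrable, possibly signed) density estimators. Let $p_d'$ be the Hölder conjugate of $p_d$. For $K>0$ the wavelet-thresholding estimator is $$\hat p_n=\sum_{k}\hat\alpha_k\phi_k+\sum_{0\le j\le j_0}\sum_{\lambda\in\Lambda_j}\hat\beta_\lambda\psi_\lambda+\sum_{j_0<j\le j_1}\sum_{\lambda\in\Lambda_j}\hat\beta_\lambda\mathbf 1_{\{|\hat\beta_\lambda|>K\sqrt{j/n}\}}\psi_\lambda,$$ with $\hat\alpha_k=\frac1n\sum_i\phi_k(X_i)$, $\hat\beta_\lambda=\frac1n\sum_i\psi_\lambda(X_i)$,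 $2^{j_0}=n^{1/(2\sigma_g+D)}$ and $2^{j_1}=n^{1/(2\sigma_g+D-2D/p_g)}$. *Claim.* Suppose $r>\sigma_g>D/p_g$, $0\le\sigma_d<r$ and $p_d'>p_g$. Then there are constants $K,C>0$, depending only on $D,\sigma_g,\sigma_d,p_g,q_g,p_d',L_g,L_d,T,A$ and $B$, such that for every $n\ge 1$ $$M(\mathcal F_d,\mathcal F_g)\ \le\ \sup_{p\in\mathcal F_g}\mathbb E\,d_{\mathcal F_d}(p,\hat p_n)\ \le\ C\left(\ell_n\sqrt{\log n}\left(n^{-\frac{\sigma_g+\sigma_d}{2\sigma_g+D}}+n^{-\frac{\sigma_g+\sigma_d-D/p_g+D/p_d'}{2\sigma_g+D-2D/p_g}}\right)+n^{-1/2}\right),$$ where $\ell_n=1$, except on the boundary between two regimes, that is, if $\sigma_d=D/2$ or $(2\sigma_g+D)/p_d'=(D-2\sigma_d)/p_g$, where $\ell_n=(\log n)^{1-1/q_d}$. -/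

import Mathlib

open MeasureTheory
open scoped ENNReal

noncomputable section

namespace BesovIPM

/-- `ℝ^D` with the Euclidean norm and Lebesgue measure. -/
abbrev Space (D : ℕ) : Type := EuclideanSpace ℝ (Fin D)

/-- `L²(ℝ^D)`, real valued. -/
abbrev L2 (D : ℕ) : Type := Lp ℝ 2 (volume : Measure (Space D))

/-- The point `k ∈ ℤ^D` of `ℝ^D`. -/
def latticePoint {D : ℕ} (k : Fin D → ℤ) : Space D := WithLp.toLp 2 fun i => (k i : ℝ)

/-- The index set `E = {0,1}^D ∖ {0}` of the mother wavelets. -/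
abbrev MotherIndex (D : ℕ) : Type := {ε : Fin D → Bool // ε ≠ fun _ => false}

/-- `x ↦ 2^{Dj/2} g(2^j x - k)`. -/
def dilate {D : ℕ} (g : Space D → ℝ) (j : ℤ) (k : Fin D → ℤ) (x : Space D) : ℝ :=
  (2 : ℝ) ^ ((D : ℝ) * (j : ℝ) / 2) * g ((2 : ℝ) ^ j • x - latticePoint k)

/-- The class of the function `f` belongs to the subspace `W` of `L²`. -/
def MemSubspace {D : ℕ} (W : Submodule ℝ (L2 D)) (f : Space D → ℝ) : Prop :=
  ∃ h : MemLp f 2 (volume : Measure (Space D)), h.toLp f ∈ W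

/-- The functions `g i` form an orthonormal (Hilbert) basis of the subspace `W` of `L²`. -/
def IsOrthonormalBasisOf {D : ℕ} {ι : Type} (g : ι → Space D → ℝ)
    (W : Submodule ℝ (L2 D)) : Prop :=
  ∃ h : ∀ i, MemLp (g i) 2 (volume : Measure (Space D)),
    Orthonormal ℝ (fun i => (h i).toLp (g i)) ∧
      (Submodule.span ℝ (Set.range fun i => (h i).toLp (g i))).topologicalClosure = W

/-- `(V_j)` is a multiresolution approximation of `L²(ℝ^D)` with father wavelet `φ`. -/
structure IsMRA {D : ℕ} (V : ℤ → Submodule ℝ (L2 D)) (φ : Space D → ℝ) : Prop where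
  mono : Monotone V
  closed : ∀ j, IsClosed (V j : Set (L2 D))
  inter : ⨅ j, V j = ⊥
  dense : (⨆ j, V j).topologicalClosure = ⊤
  shift : ∀ (f : Space D → ℝ) (k : Fin D → ℤ),
    MemSubspace (V 0) f ↔ MemSubspace (V 0) fun x => f (x - latticePoint k)
  scale : ∀ (f : Space D → ℝ) (j : ℤ),
    MemSubspace (V j) f ↔ MemSubspace (V (j + 1)) fun x => f ((2 : ℝ) • x)
  father : IsOrthonormalBasisOf (fun (k : Fin D → ℤ) x => φ (x - latticePoint k)) (V 0)

/-- All derivatives of order at most `r` exist, are continuous, and decay faster than every power.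
The norm of the `i`-th derivative at a point is equivalent to the maximum of the mixed partial
derivatives of order `i` there. -/
def IsRegular {D : ℕ} (r : ℕ) (g : Space D → ℝ) : Prop :=
  ContDiff ℝ r g ∧
    ∀ i ≤ r, ∀ m : ℕ, ∃ c : ℝ, ∀ x, ‖iteratedFDeriv ℝ i g x‖ ≤ c / (1 + ‖x‖) ^ m

/-- `g` vanishes outside the cube `[-A, A]^D`. -/
def SupportedInCube {D : ℕ} (A : ℝ) (g : Space D → ℝ) : Prop :=
  ∀ x : Space D, (∃ i, A < |x i|) → g x = 0

/-- An `r`-regular multiresolution approximation with father wavelet `φ` and mother wavelets `ψ_ε`,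
all supported in `[-A, A]^D`: for every level `j`, the functions `2^{Dj/2} φ(2^j x - k)` and
`2^{Dj/2} ψ_ε(2^j x - k)` together form an orthonormal basis of `V_{j+1}`. -/
structure IsWaveletSystem {D : ℕ} (r : ℕ) (A : ℝ) (V : ℤ → Submodule ℝ (L2 D))
    (φ : Space D → ℝ) (ψ : MotherIndex D → Space D → ℝ) : Prop where
  mra : IsMRA V φ
  mothers : ∀ j : ℤ, IsOrthonormalBasisOf
    (Sum.elim (fun k : Fin D → ℤ => dilate φ j k)
      (fun l : MotherIndex D × (Fin D → ℤ) => dilate (ψ l.1) j l.2)) (V (j + 1))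
  regular_father : IsRegular r φ
  regular_mother : ∀ ε, IsRegular r (ψ ε)
  support_father : SupportedInCube A φ
  support_mother : ∀ ε, SupportedInCube A (ψ ε)

/-- The `ℓ^p` norm, `p ∈ [1, ∞]`, of a family of elements of `[0, ∞]`. -/
def seqNorm {ι : Type} (p : ℝ≥0∞) (a : ι → ℝ≥0∞) : ℝ≥0∞ :=
  if p = ∞ then ⨆ i, a i else (∑' i, a i ^ p.toReal) ^ (1 / p.toReal)

/-- `α_k = ∫ f(x) φ(x - k) dx`. -/
def fatherCoeff {D : ℕ} (φ f : Space D → ℝ) (k : Fin D → ℤ) : ℝ :=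
  ∫ x, f x * φ (x - latticePoint k)

/-- `β_λ = ∫ f ψ_λ`, where `λ = 2^{-j} k + 2^{-j-1} ε ∈ Λ_j` is represented by `j` and the pair
`(ε, k)`, which it determines. -/
def motherCoeff {D : ℕ} (ψ : MotherIndex D → Space D → ℝ) (f : Space D → ℝ) (j : ℕ)
    (l : MotherIndex D × (Fin D → ℤ)) : ℝ :=
  ∫ x, f x * dilate (ψ l.1) j l.2 x

/-- The Besov norm of `B^σ_{p,q}(ℝ^D)`, with values in `[0, ∞]`. -/
def besovNorm {D : ℕ} (φ : Space D → ℝ) (ψ : MotherIndex D → Space D → ℝ)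
    (σ : ℝ) (p q : ℝ≥0∞) (f : Space D → ℝ) : ℝ≥0∞ :=
  seqNorm p (fun k : Fin D → ℤ => ‖fatherCoeff φ f k‖ₑ) +
    seqNorm q (fun j : ℕ =>
      ENNReal.ofReal ((2 : ℝ) ^ ((j : ℝ) * (σ + D * (1 / 2 - p⁻¹.toReal)))) *
        seqNorm p (fun l : MotherIndex D × (Fin D → ℤ) => ‖motherCoeff ψ f j l‖ₑ))

/-- The closed Besov ball `B^σ_{p,q}(L)`; local integrability is what makes the wavelet
coefficients (integrals against bounded functions of compact support) meaningful. -/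
def besovBall {D : ℕ} (φ : Space D → ℝ) (ψ : MotherIndex D → Space D → ℝ)
    (σ : ℝ) (p q : ℝ≥0∞) (L : ℝ) : Set (Space D → ℝ) :=
  {f | LocallyIntegrable f volume ∧ besovNorm φ ψ σ p q f ≤ ENNReal.ofReal L}

/-- The probability densities supported in `[-T, T]^D` that lie in the Besov ball. -/
def densityClass {D : ℕ} (φ : Space D → ℝ) (ψ : MotherIndex D → Space D → ℝ)
    (σ : ℝ) (p q : ℝ≥0∞) (L T : ℝ) : Set (Space D → ℝ) :=
  {g | g ∈ besovBall φ ψ σ p q L ∧ Measurable g ∧ (∀ x, 0 ≤ g x) ∧ (∫ x, g x) = 1 ∧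
    SupportedInCube T g}

open Classical in
/-- The integral probability metric `sup_{f ∈ F} |∫ f p - ∫ f q|` between (possibly signed)
densities; it is `∞` if one of these integrals does not exist. -/
def ipm {D : ℕ} (F : Set (Space D → ℝ)) (p q : Space D → ℝ) : ℝ≥0∞ :=
  ⨆ f ∈ F, if Integrable (fun x => f x * p x) volume ∧ Integrable (fun x => f x * q x) volume
    then ENNReal.ofReal |(∫ x, f x * p x) - ∫ x, f x * q x| else ∞

/-- The (outer) expectation of a nonnegative function: the usual one if `g` is measurable. -/
def outerExpectation {Ω : Type} [MeasurableSpace Ω] (μ : Measure Ω) (g : Ω → ℝ≥0∞) : ℝ≥0∞ :=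
  ⨅ (h : Ω → ℝ≥0∞) (_ : Measurable h) (_ : ∀ ω, g ω ≤ h ω), ∫⁻ ω, h ω ∂μ

/-- The law of `n` IID observations with density `p`. -/
def sampleLaw {D : ℕ} (p : Space D → ℝ) (n : ℕ) : Measure (Fin n → Space D) :=
  Measure.pi fun _ => (volume : Measure (Space D)).withDensity fun x => ENNReal.ofReal (p x)

/-- The risk `E d_F(p, p̂(X_1, …, X_n))` for IID observations with density `p`. -/
def risk {D : ℕ} (F : Set (Space D → ℝ)) (n : ℕ) (est : (Fin n → Space D) → Space D → ℝ)
    (p : Space D → ℝ) : ℝ≥0∞ :=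
  outerExpectation (sampleLaw p n) fun X => ipm F p (est X)

/-- Estimators: jointly measurable, with integrable (possibly signed) values. -/
def IsEstimator {D n : ℕ} (est : (Fin n → Space D) → Space D → ℝ) : Prop :=
  Measurable (fun z : (Fin n → Space D) × Space D => est z.1 z.2) ∧
    ∀ X, Integrable (est X) volume

/-- The minimax risk over the density class `G` in the loss `d_F`, from `n` observations. -/
def minimaxRisk {D : ℕ} (F G : Set (Space D → ℝ)) (n : ℕ) : ℝ≥0∞ :=
  ⨅ (est : (Fin n → Space D) → Space D → ℝ) (_ : IsEstimator est), ⨆ p ∈ G, risk F n est p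

/-- The empirical mean `(1/n) ∑ g(X_i)`. -/
def empiricalMean {D n : ℕ} (X : Fin n → Space D) (g : Space D → ℝ) : ℝ :=
  (n : ℝ)⁻¹ * ∑ i, g (X i)

/-- `j₀ = log₂ n / (2σ + D)`. -/
def lowLevel (D : ℕ) (σ : ℝ) (n : ℕ) : ℝ := Real.logb 2 n / (2 * σ + D)

/-- `j₁ = log₂ n / (2σ + D - 2D/p)`. -/
def highLevel (D : ℕ) (σ : ℝ) (p : ℝ≥0∞) (n : ℕ) : ℝ :=
  Real.logb 2 n / (2 * σ + D - 2 * D * p⁻¹.toReal)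

/-- The wavelet-thresholding estimator: empirical wavelet coefficients are kept at the levels
`0 ≤ j ≤ j₀`, and at the levels `j₀ < j ≤ j₁` only if their absolute value exceeds `K √(j/n)`. -/
def thresholdEstimator {D : ℕ} (φ : Space D → ℝ) (ψ : MotherIndex D → Space D → ℝ)
    (σ : ℝ) (p : ℝ≥0∞) (K : ℝ) (n : ℕ) (X : Fin n → Space D) (x : Space D) : ℝ :=
  (∑' k : Fin D → ℤ,
      empiricalMean X (fun y => φ (y - latticePoint k)) * φ (x - latticePoint k)) +
    ∑ j ∈ Finset.range (⌊highLevel D σ p n⌋₊ + 1),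
      ∑' l : MotherIndex D × (Fin D → ℤ),
        (if (j : ℝ) ≤ lowLevel D σ n ∨
            K * √((j : ℝ) / n) < |empiricalMean X (dilate (ψ l.1) j l.2)|
          then empiricalMean X (dilate (ψ l.1) j l.2) else 0) * dilate (ψ l.1) j l.2 x

/-- The parameters lie on the boundary between two regimes of the rate: `σ_d = D/2` (dense and
parametric) or `(2σ_g + D) / p_d' = (D - 2σ_d) / p_g` (dense and sparse). -/
def IsCritical (D : ℕ) (σg σd : ℝ) (pg pd' : ℝ≥0∞) : Prop :=
  σd = (D : ℝ) / 2 ∨ (2 * σg + D) * pd'⁻¹.toReal = (D - 2 * σd) * pg⁻¹.toReal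

open Classical in
/-- The factor `1`, or `(log n)^{1 - 1/q_d}` on the boundary between two regimes. -/
def boundaryFactor (D : ℕ) (σg σd : ℝ) (pg pd' qd : ℝ≥0∞) (n : ℕ) : ℝ :=
  if IsCritical D σg σd pg pd' then Real.log n ^ (1 - qd⁻¹.toReal) else 1

/-- The upper bound (without its constant) on the risk. -/
def upperRate (D : ℕ) (σg σd : ℝ) (pg pd' qd : ℝ≥0∞) (n : ℕ) : ℝ :=
  √(Real.log n) * boundaryFactor D σg σd pg pd' qd n *
      ((n : ℝ) ^ (-((σg + σd) / (2 * σg + D))) +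
        (n : ℝ) ^ (-((σg + σd - D * pg⁻¹.toReal + D * pd'⁻¹.toReal) /
          (2 * σg + D - 2 * D * pg⁻¹.toReal)))) +
    (n : ℝ) ^ (-(1 / 2 : ℝ))

end BesovIPM

end

/-! The loss is controlled through wavelet coefficients. Since `σg > D / pg`, the wavelet series of
a density `p` in the class converges uniformly and equals `p` almost everywhere
(`IsWaveletSystem.density_expansion`, resting on the completeness statement
`IsWaveletSystem.ae_eq_zero`). Hence `p` is bounded, and `∫ f p - ∫ f p̂` is the sum over all
wavelets of a coefficient of `f` times the error of the corresponding coefficient of `p`.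

Each level of this sum is bounded by Hölder's inequality (`sum_abs_mul_le_of_seqNorm_le`). Up to
`j₀` every error is of order `√((j+1)/n)`, and about `2^{jD}` wavelets meet the support, which gives
`2^{j(D/2 - σd)} √((j+1)/n)`. Between `j₀` and `j₁` the thresholded error is at most a multiple of
`√(j/n)` and also at most the coefficient of `p`. As `pg < pd'`, its `ℓ^{pd'}` norm is interpolated
between the threshold and the `ℓ^{pg}` norm of the coefficients. Above `j₁` only the bias is left,
which the embedding of `ℓ^{pg}` in `ℓ^{pd'}` controls.

In all three ranges the bounds are geometric in `j` up to logarithms, so an end of the range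
dominates: level `0` gives `n^{-1/2}`, level `j₀` the dense rate, level `j₁` the sparse rate. On a
boundary between regimes the ratio is `1`; Hölder over the levels with exponent `qd` then costs a
power `1 - 1/qd` of the number of levels (`exists_sum_linear_levels_le`,
`exists_sum_threshold_levels_le`, `exists_sum_bias_levels_le`).

The supremum over `f` stands inside the expectation, so all errors must be controlled at once. This
is done by `Z`, a sum over levels and wavelets of exponentials of shifted normalized deviations; the
Bernstein bound `lintegral_exp_deviation_le` keeps `E Z` bounded. Its part `Z'` over the thresholded
levels satisfies `E Z' ≲ n^{-3}`. If `Z' < 1`, every deviation there is below half the threshold.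
Otherwise a crude bound of order `n²` is multiplied by `Z' ≥ 1`, with expected contribution
`O(1/n)`. `IsWaveletSystem.abs_integral_sub_thresholdEstimator_le` is the resulting deterministic
inequality, affine in `Z` and `Z'`. -/

noncomputable section

namespace BesovIPM

/-! ### Lattice boxes and dilated wavelets -/

/-- The lattice points with all coordinates at most `R` in absolute value. -/
def latticeBox (D : ℕ) (R : ℝ) : Finset (Fin D → ℤ) :=
  Fintype.piFinset fun _ => Finset.Icc (-⌊R⌋) ⌊R⌋

lemma mem_latticeBox {D : ℕ} {R : ℝ} {k : Fin D → ℤ} :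
    k ∈ latticeBox D R ↔ ∀ i, |(k i : ℝ)| ≤ R := by
  simp only [latticeBox, Fintype.mem_piFinset, Finset.mem_Icc]
  refine forall_congr' fun i => ?_
  rw [← abs_le, Int.le_floor, Int.cast_abs]

lemma latticeBox_mono {D : ℕ} {R S : ℝ} (h : R ≤ S) : latticeBox D R ⊆ latticeBox D S :=
  fun _ hk => mem_latticeBox.2 fun i => (mem_latticeBox.1 hk i).trans h

lemma card_latticeBox_le {D : ℕ} {R : ℝ} (hR : 0 ≤ R) :
    ((latticeBox D R).card : ℝ) ≤ (2 * R + 1) ^ D := by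
  have hf : 0 ≤ ⌊R⌋ := Int.floor_nonneg.2 hR
  simp only [latticeBox, Fintype.card_piFinset, Finset.prod_const, Finset.card_univ,
    Fintype.card_fin, Int.card_Icc, Nat.cast_pow]
  gcongr
  have h : (((⌊R⌋ + 1 - -⌊R⌋).toNat : ℤ) : ℝ) = 2 * ⌊R⌋ + 1 := by
    rw [Int.toNat_of_nonneg (by omega)]
    push_cast
    ring
  rw [← Int.cast_natCast, h]
  linarith [Int.floor_le R]

lemma tendsto_latticeBox (D : ℕ) :
    Filter.Tendsto (fun N : ℕ => latticeBox D N) Filter.atTop Filter.atTop := by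
  refine Filter.tendsto_atTop_finset_of_monotone
    (fun _ _ h => latticeBox_mono (by exact_mod_cast h)) fun k => ?_
  refine ⟨∑ i, (k i).natAbs, mem_latticeBox.2 fun i => ?_⟩
  have h : (k i).natAbs ≤ ∑ i, (k i).natAbs :=
    Finset.single_le_sum (f := fun i => (k i).natAbs) (fun _ _ => Nat.zero_le _)
      (Finset.mem_univ i)
  rw [← Int.cast_abs, ← Int.natCast_natAbs, Int.cast_natCast]
  exact_mod_cast h

/-- The lattice points whose coordinates are at distance at most `A` from those of `y`. -/
def nearBox {D : ℕ} (A : ℝ) (y : Space D) : Finset (Fin D → ℤ) :=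
  Fintype.piFinset fun i => Finset.Icc ⌈y i - A⌉ ⌊y i + A⌋

lemma mem_nearBox {D : ℕ} {A : ℝ} {y : Space D} {k : Fin D → ℤ} :
    k ∈ nearBox A y ↔ ∀ i, |y i - k i| ≤ A := by
  simp only [nearBox, Fintype.mem_piFinset, Finset.mem_Icc, Int.ceil_le, Int.le_floor]
  refine forall_congr' fun i => ?_
  rw [abs_le]
  constructor <;> rintro ⟨h1, h2⟩ <;> constructor <;> linarith

lemma card_nearBox_le {D : ℕ} {A : ℝ} (hA : 0 ≤ A) (y : Space D) :
    ((nearBox A y).card : ℝ) ≤ (2 * A + 1) ^ D := by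
  simp only [nearBox, Fintype.card_piFinset, Int.card_Icc, Nat.cast_prod]
  calc ∏ i, (((⌊y i + A⌋ + 1 - ⌈y i - A⌉).toNat : ℕ) : ℝ)
      ≤ ∏ _i : Fin D, (2 * A + 1) := by
        refine Finset.prod_le_prod (fun _ _ => by positivity) fun i _ => ?_
        rcases le_total 0 (⌊y i + A⌋ + 1 - ⌈y i - A⌉) with h | h
        · rw [← Int.cast_natCast, Int.toNat_of_nonneg h]
          push_cast
          linarith [Int.floor_le (y i + A), Int.le_ceil (y i - A)]
        · rw [Int.toNat_of_nonpos h]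
          push_cast
          linarith
    _ = (2 * A + 1) ^ D := by simp

lemma latticePoint_apply {D : ℕ} (k : Fin D → ℤ) (i : Fin D) : latticePoint k i = k i := rfl

lemma dilate_zero {D : ℕ} (g : Space D → ℝ) (k : Fin D → ℤ) :
    dilate g 0 k = fun x => g (x - latticePoint k) := by
  funext x
  simp [dilate]

lemma continuous_dilate {D : ℕ} {g : Space D → ℝ} (hg : Continuous g) (j : ℤ) (k : Fin D → ℤ) :
    Continuous (dilate g j k) := by
  unfold dilate
  fun_prop

lemma abs_dilate_le {D : ℕ} {g : Space D → ℝ} {B : ℝ} (hB : ∀ x, |g x| ≤ B) (j : ℤ)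
    (k : Fin D → ℤ) (x : Space D) :
    |dilate g j k x| ≤ (2 : ℝ) ^ ((D : ℝ) * (j : ℝ) / 2) * B := by
  rw [dilate, abs_mul, abs_of_pos (by positivity)]
  gcongr
  exact hB _

lemma dilate_eq_zero_of_notMem_nearBox {D : ℕ} {g : Space D → ℝ} {A : ℝ}
    (hg : SupportedInCube A g) {j : ℤ} {k : Fin D → ℤ} {x : Space D}
    (hk : k ∉ nearBox A ((2 : ℝ) ^ j • x)) : dilate g j k x = 0 := by
  rw [mem_nearBox] at hk
  push Not at hk
  rw [dilate, hg _ (by simpa [latticePoint_apply] using hk), mul_zero]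

/-- At a given point at most `(2A+1)^D` translates are nonzero, whatever the level, so the whole sum
has the order of a single wavelet. The sup-norm bounds on expansions rest on this. -/
lemma sum_abs_dilate_le {D : ℕ} {g : Space D → ℝ} {A B : ℝ} (hA : 0 ≤ A)
    (hg : SupportedInCube A g) (hB : ∀ x, |g x| ≤ B) (j : ℤ) (F : Finset (Fin D → ℤ))
    (x : Space D) :
    ∑ k ∈ F, |dilate g j k x| ≤ (2 : ℝ) ^ ((D : ℝ) * (j : ℝ) / 2) * B * (2 * A + 1) ^ D := by
  classical
  have hB0 : 0 ≤ B := (abs_nonneg _).trans (hB 0)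
  calc ∑ k ∈ F, |dilate g j k x|
      = ∑ k ∈ F with k ∈ nearBox A ((2 : ℝ) ^ j • x), |dilate g j k x| := by
        refine (Finset.sum_filter_of_ne fun k _ h => ?_).symm
        by_contra hk
        exact h (by rw [dilate_eq_zero_of_notMem_nearBox hg hk, abs_zero])
    _ ≤ ∑ k ∈ nearBox A ((2 : ℝ) ^ j • x), |dilate g j k x| :=
        Finset.sum_le_sum_of_subset_of_nonneg (fun k hk => (Finset.mem_filter.1 hk).2)
          fun _ _ _ => abs_nonneg _
    _ ≤ ∑ _k ∈ nearBox A ((2 : ℝ) ^ j • x), (2 : ℝ) ^ ((D : ℝ) * (j : ℝ) / 2) * B :=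
        Finset.sum_le_sum fun k _ => abs_dilate_le hB j k x
    _ ≤ _ := by
        rw [Finset.sum_const, nsmul_eq_mul, mul_comm]
        gcongr
        exact card_nearBox_le hA _

/-- This makes the expansions of functions supported in the cube finite at each level, with about
`2^{jD}` terms. -/
lemma dilate_eq_zero_of_notMem_latticeBox {D : ℕ} {g : Space D → ℝ} {A T : ℝ}
    (hg : SupportedInCube A g) {j : ℕ} {k : Fin D → ℤ}
    (hk : k ∉ latticeBox D (2 ^ j * T + A)) {x : Space D} (hx : ∀ i, |x i| ≤ T) :
    dilate g j k x = 0 := by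
  refine dilate_eq_zero_of_notMem_nearBox hg fun h => hk (mem_latticeBox.2 fun i => ?_)
  have h1 := mem_nearBox.1 h i
  simp only [PiLp.smul_apply, smul_eq_mul, zpow_natCast] at h1
  have h2 : |(2 : ℝ) ^ j * x i| ≤ 2 ^ j * T := by
    rw [abs_mul, abs_of_pos (by positivity)]
    have := hx i
    gcongr
  rw [abs_le] at h1 h2 ⊢
  constructor <;> linarith [h1.1, h1.2, h2.1, h2.2]

/-- Dividing by `2^j ≥ 1` only shrinks the overhang `2A`, so the retained wavelets of all levels
live in one fixed cube. -/
lemma dilate_eq_zero_of_lt {D : ℕ} {g : Space D → ℝ} {A T : ℝ}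
    (hA : 0 ≤ A) (hg : SupportedInCube A g) {j : ℕ} {k : Fin D → ℤ}
    (hk : k ∈ latticeBox D (2 ^ j * T + A)) {x : Space D} (hx : ∃ i, T + 2 * A < |x i|) :
    dilate g j k x = 0 := by
  obtain ⟨i, hi⟩ := hx
  refine dilate_eq_zero_of_notMem_nearBox hg fun h => ?_
  have h1 := mem_nearBox.1 h i
  simp only [PiLp.smul_apply, smul_eq_mul, zpow_natCast] at h1
  have h2 : |(2 : ℝ) ^ j * x i| ≤ 2 ^ j * T + 2 * A := by
    have h3 := mem_latticeBox.1 hk i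
    rw [abs_le] at h1 h3 ⊢
    constructor <;> linarith [h1.1, h1.2, h3.1, h3.2]
  rw [abs_mul, abs_of_pos (by positivity)] at h2
  have h4 : (1 : ℝ) ≤ 2 ^ j := one_le_pow₀ (by norm_num)
  nlinarith

lemma isCompact_cube (D : ℕ) (R : ℝ) : IsCompact {x : Space D | ∀ i, |x i| ≤ R} := by
  have h : {x : Space D | ∀ i, |x i| ≤ R} =
      (EuclideanSpace.equiv (Fin D) ℝ).symm '' Set.pi Set.univ fun _ => Set.Icc (-R) R := by
    ext x
    simp only [Set.mem_ofPred_eq, Set.mem_image, Set.mem_pi, Set.mem_univ, true_imp_iff,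
      Set.mem_Icc, abs_le]
    refine ⟨fun hx => ⟨EuclideanSpace.equiv (Fin D) ℝ x, hx, by simp⟩, ?_⟩
    rintro ⟨y, hy, rfl⟩
    exact hy
  rw [h]
  exact (isCompact_univ_pi fun _ => isCompact_Icc).image
    (EuclideanSpace.equiv (Fin D) ℝ).symm.continuous

lemma SupportedInCube.hasCompactSupport {D : ℕ} {g : Space D → ℝ} {A : ℝ}
    (hg : SupportedInCube A g) : HasCompactSupport g :=
  HasCompactSupport.intro (isCompact_cube D A) fun x hx => hg x (by simpa using hx)

lemma SupportedInCube.dilate {D : ℕ} {g : Space D → ℝ} {A : ℝ} (hg : SupportedInCube A g)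
    (j : ℤ) (k : Fin D → ℤ) :
    ∃ R, SupportedInCube R (dilate g j k) := by
  refine ⟨((2 : ℝ) ^ j)⁻¹ * (A + ∑ i, |(k i : ℝ)|), fun x ⟨i, hi⟩ => ?_⟩
  refine dilate_eq_zero_of_notMem_nearBox hg fun h => ?_
  have h1 := mem_nearBox.1 h i
  have hp : (0 : ℝ) < 2 ^ j := by positivity
  simp only [PiLp.smul_apply, smul_eq_mul] at h1
  have h2 : |(k i : ℝ)| ≤ ∑ i, |(k i : ℝ)| :=
    Finset.single_le_sum (f := fun i => |(k i : ℝ)|) (fun _ _ => abs_nonneg _) (Finset.mem_univ i)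
  rw [inv_mul_lt_iff₀ hp] at hi
  have h3 : |(2 : ℝ) ^ j * x i| = 2 ^ j * |x i| := by rw [abs_mul, abs_of_pos hp]
  have h4 := abs_add_le ((2 : ℝ) ^ j * x i - k i) (k i)
  rw [sub_add_cancel] at h4
  linarith

lemma hasCompactSupport_dilate {D : ℕ} {g : Space D → ℝ} {A : ℝ} (hg : SupportedInCube A g)
    (j : ℤ) (k : Fin D → ℤ) : HasCompactSupport (dilate g j k) :=
  (hg.dilate j k).choose_spec.hasCompactSupport

/-- The decay `2^{-Dj/2}` of the `L¹` norm compensates the growth `2^{Dj/2}` of the sup norm; this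
is what bounds the projections on `L^∞` uniformly in the level. -/
lemma integral_abs_dilate {D : ℕ} (g : Space D → ℝ) (j : ℤ) (k : Fin D → ℤ) :
    ∫ x, |dilate g j k x| = (2 : ℝ) ^ (-((D : ℝ) * (j : ℝ) / 2)) * ∫ x, |g x| := by
  have h1 : ∀ x, |dilate g j k x| =
      (2 : ℝ) ^ ((D : ℝ) * (j : ℝ) / 2) * |g ((2 : ℝ) ^ j • x - latticePoint k)| := fun x => by
    rw [dilate, abs_mul, abs_of_pos (by positivity)]
  simp_rw [h1]
  rw [integral_const_mul,
    Measure.integral_comp_smul volume (fun y => |g (y - latticePoint k)|) ((2 : ℝ) ^ j),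
    integral_sub_right_eq_self (fun y => |g y|), smul_eq_mul, ← mul_assoc]
  congr 1
  rw [finrank_euclideanSpace_fin, abs_of_pos (by positivity), ← zpow_natCast, ← zpow_mul,
    ← zpow_neg, ← Real.rpow_intCast, ← Real.rpow_add (by norm_num)]
  congr 1
  push_cast
  ring

/-! ### Orthogonality and completeness of the wavelets -/

lemma inner_toLp {D : ℕ} {f g : Space D → ℝ} (hf : MemLp f 2 volume) (hg : MemLp g 2 volume) :
    inner ℝ (hf.toLp f) (hg.toLp g) = ∫ x, f x * g x := by
  rw [L2.inner_def]
  refine integral_congr_ae ?_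
  filter_upwards [hf.coeFn_toLp, hg.coeFn_toLp] with x h1 h2
  simp [h1, h2, mul_comm]

lemma IsOrthonormalBasisOf.memLp {D : ℕ} {ι : Type} {g : ι → Space D → ℝ}
    {W : Submodule ℝ (L2 D)} (h : IsOrthonormalBasisOf g W) (i : ι) : MemLp (g i) 2 volume :=
  h.choose i

lemma IsOrthonormalBasisOf.memSubspace {D : ℕ} {ι : Type} {g : ι → Space D → ℝ}
    {W : Submodule ℝ (L2 D)} (h : IsOrthonormalBasisOf g W) (i : ι) : MemSubspace W (g i) := by
  obtain ⟨hm, -, rfl⟩ := h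
  exact ⟨hm i, Submodule.le_topologicalClosure _ (Submodule.subset_span ⟨i, rfl⟩)⟩

lemma IsOrthonormalBasisOf.integral_mul {D : ℕ} {ι : Type} [DecidableEq ι]
    {g : ι → Space D → ℝ} {W : Submodule ℝ (L2 D)} (h : IsOrthonormalBasisOf g W) (i i' : ι) :
    ∫ x, g i x * g i' x = if i = i' then 1 else 0 := by
  obtain ⟨hm, ho, -⟩ := h
  rw [← inner_toLp (hm i) (hm i')]
  exact orthonormal_iff_ite.1 ho i i'

lemma mem_orthogonal_closure_span {E ι : Type*} [NormedAddCommGroup E] [InnerProductSpace ℝ E]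
    {e : ι → E} {v : E} (hv : ∀ i, inner ℝ (e i) v = 0) :
    v ∈ (Submodule.span ℝ (Set.range e)).topologicalClosureᗮ := by
  rw [Submodule.orthogonal_closure, Submodule.mem_orthogonal]
  intro u hu
  induction hu using Submodule.span_induction with
  | mem x hx => obtain ⟨i, rfl⟩ := hx; exact hv i
  | zero => simp
  | add x y _ _ hx hy => rw [inner_add_left, hx, hy, add_zero]
  | smul a x _ hx => rw [inner_smul_left, hx, mul_zero]

lemma IsOrthonormalBasisOf.integral_mul_eq_zero {D : ℕ} {ι : Type}
    {g : ι → Space D → ℝ} {W : Submodule ℝ (L2 D)} (h : IsOrthonormalBasisOf g W)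
    {u f : Space D → ℝ} (hu : MemLp u 2 volume) (hug : ∀ i, ∫ x, g i x * u x = 0)
    (hf : MemSubspace W f) : ∫ x, f x * u x = 0 := by
  obtain ⟨hm, -, rfl⟩ := h
  obtain ⟨hf2, hfW⟩ := hf
  have h1 : hu.toLp u ∈ (Submodule.span ℝ
      (Set.range fun i => (hm i).toLp (g i))).topologicalClosureᗮ :=
    mem_orthogonal_closure_span fun i => by rw [inner_toLp]; exact hug i
  rw [← inner_toLp hf2 hu]
  exact (Submodule.mem_orthogonal _ _).1 h1 _ hfW

/-- When only finitely many coefficients are nonzero, the finite sum is the orthogonal projection of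
`v` on the closed span, hence the best approximation there, by Pythagoras. -/
lemma norm_sub_sum_le {E ι : Type*} [NormedAddCommGroup E] [InnerProductSpace ℝ E]
    {e : ι → E} (he : Orthonormal ℝ e) {v w : E} {F : Finset ι}
    (hF : ∀ i ∉ F, inner ℝ (e i) v = 0)
    (hw : w ∈ (Submodule.span ℝ (Set.range e)).topologicalClosure) :
    ‖v - ∑ i ∈ F, inner ℝ (e i) v • e i‖ ≤ ‖v - w‖ := by
  classical
  set s := ∑ i ∈ F, inner ℝ (e i) v • e i with hs
  have h1 : v - s ∈ (Submodule.span ℝ (Set.range e)).topologicalClosureᗮ := by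
    refine mem_orthogonal_closure_span fun i => ?_
    rw [inner_sub_right, hs, inner_sum]
    simp_rw [inner_smul_right, orthonormal_iff_ite.1 he]
    by_cases hi : i ∈ F
    · simp [hi]
    · simp [hi, hF i hi]
  have h2 : s - w ∈ (Submodule.span ℝ (Set.range e)).topologicalClosure := by
    refine Submodule.sub_mem _ (Submodule.le_topologicalClosure _ ?_) hw
    exact Submodule.sum_mem _ fun i _ => Submodule.smul_mem _ _ (Submodule.subset_span ⟨i, rfl⟩)
  have h3 : inner ℝ (v - s) (s - w) = 0 := by
    rw [real_inner_comm]
    exact (Submodule.mem_orthogonal _ _).1 h1 _ h2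
  have h4 := norm_add_sq_eq_norm_sq_add_norm_sq_of_inner_eq_zero _ _ h3
  rw [sub_add_sub_cancel] at h4
  nlinarith [norm_nonneg (v - s), norm_nonneg (v - w), norm_nonneg (s - w)]

lemma exists_toLp_sum {D : ℕ} {ι : Type} {g : ι → Space D → ℝ}
    (hm : ∀ i, MemLp (g i) 2 volume) (F : Finset ι) (c : ι → ℝ) :
    ∃ hs : MemLp (fun x => ∑ i ∈ F, c i * g i x) 2 volume,
      hs.toLp _ = ∑ i ∈ F, c i • (hm i).toLp (g i) := by
  classical
  induction F using Finset.induction_on with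
  | empty => exact ⟨by simp, by simp only [Finset.sum_empty]; rfl⟩
  | insert i F hi ih =>
    obtain ⟨hs, h⟩ := ih
    refine ⟨?_, ?_⟩
    · simp_rw [Finset.sum_insert hi]
      exact ((hm i).const_mul (c i)).add hs
    · simp_rw [Finset.sum_insert hi, ← h]
      rfl

lemma IsOrthonormalBasisOf.eLpNorm_sub_sum_le {D : ℕ} {ι : Type}
    {g : ι → Space D → ℝ} {W : Submodule ℝ (L2 D)} (h : IsOrthonormalBasisOf g W)
    {f : Space D → ℝ} (hf : MemLp f 2 volume) {F : Finset ι}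
    (hF : ∀ i ∉ F, ∫ x, f x * g i x = 0) {w : L2 D} (hw : w ∈ W) :
    eLpNorm (fun x => f x - ∑ i ∈ F, (∫ y, f y * g i y) * g i x) 2 volume ≤
      ENNReal.ofReal ‖hf.toLp f - w‖ := by
  obtain ⟨hm, ho, rfl⟩ := h
  have hin : ∀ i, inner ℝ ((hm i).toLp (g i)) (hf.toLp f) = ∫ x, f x * g i x := fun i => by
    rw [inner_toLp]
    simp_rw [mul_comm]
  have h1 := norm_sub_sum_le ho (v := hf.toLp f) (F := F)
    (fun i hi => by rw [hin]; exact hF i hi) hw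
  refine le_trans (le_of_eq ?_) (ENNReal.ofReal_le_ofReal h1)
  obtain ⟨hs, h2⟩ := exists_toLp_sum hm F fun i => ∫ y, f y * g i y
  simp_rw [hin]
  rw [← h2, ← MemLp.toLp_sub, Lp.norm_toLp, ENNReal.ofReal_toReal (hf.sub hs).2.ne]
  rfl

lemma IsOrthonormalBasisOf.ae_eq_sum {D : ℕ} {ι : Type}
    {g : ι → Space D → ℝ} {W : Submodule ℝ (L2 D)} (h : IsOrthonormalBasisOf g W)
    {f : Space D → ℝ} (hf : MemSubspace W f) {F : Finset ι}
    (hF : ∀ i ∉ F, ∫ x, f x * g i x = 0) :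
    f =ᵐ[volume] fun x => ∑ i ∈ F, (∫ y, f y * g i y) * g i x := by
  obtain ⟨hf2, hfW⟩ := hf
  have h1 := h.eLpNorm_sub_sum_le hf2 hF hfW
  rw [sub_self, norm_zero, ENNReal.ofReal_zero, nonpos_iff_eq_zero,
    eLpNorm_eq_zero_iff _ (by norm_num)] at h1
  · filter_upwards [h1] with x hx
    simpa [sub_eq_zero] using hx
  · exact hf2.1.sub (Finset.aestronglyMeasurable_fun_sum _ fun i _ =>
      (h.memLp i).1.const_mul _)

lemma IsMRA.exists_mem_norm_sub_lt {D : ℕ} {V : ℤ → Submodule ℝ (L2 D)} {φ : Space D → ℝ}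
    (hV : IsMRA V φ) (v : L2 D) {ε : ℝ} (hε : 0 < ε) :
    ∃ J : ℕ, ∀ j : ℕ, J ≤ j → ∃ w ∈ V (j + 1), ‖v - w‖ < ε := by
  have h1 : v ∈ closure ((⨆ j, V j : Submodule ℝ (L2 D)) : Set (L2 D)) := by
    have h2 : v ∈ (⨆ j, V j).topologicalClosure := by rw [hV.dense]; trivial
    exact h2
  obtain ⟨w, hw, hvw⟩ := Metric.mem_closure_iff.1 h1 ε hε
  obtain ⟨J, hJ⟩ := (Submodule.mem_iSup_of_directed _ hV.mono.directed_le).1 hw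
  refine ⟨J.toNat, fun j hj => ⟨w, hV.mono ?_ hJ, by rwa [← dist_eq_norm]⟩⟩
  have := Int.self_le_toNat J
  omega

lemma dilate_add_one {D : ℕ} (g : Space D → ℝ) (j : ℤ) (k : Fin D → ℤ) (x : Space D) :
    dilate g (j + 1) k x = (2 : ℝ) ^ ((D : ℝ) / 2) * dilate g j k ((2 : ℝ) • x) := by
  rw [dilate, dilate, ← mul_assoc, ← Real.rpow_add (by norm_num), smul_smul,
    zpow_add_one₀ (by norm_num)]
  congr 2
  push_cast
  ring

lemma memLp_comp_smul {D : ℕ} {f : Space D → ℝ} (hf : MemLp f 2 volume) {c : ℝ} (hc : c ≠ 0) :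
    MemLp (fun x => f (c • x)) 2 volume := by
  have h : Measurable fun x : Space D => c • x := measurable_const_smul c
  have h1 : MemLp f 2 (Measure.map (fun x : Space D => c • x) volume) := by
    rw [Measure.map_addHaar_smul _ hc]
    exact hf.smul_measure ENNReal.ofReal_ne_top
  exact (memLp_map_measure_iff h1.1 h.aemeasurable).1 h1

lemma MemSubspace.const_mul {D : ℕ} {W : Submodule ℝ (L2 D)} {f : Space D → ℝ}
    (hf : MemSubspace W f) (c : ℝ) : MemSubspace W fun x => c * f x := by
  obtain ⟨h, hW⟩ := hf
  exact ⟨h.const_mul c, W.smul_mem c hW⟩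

lemma IsMRA.memSubspace_dilate {D : ℕ} {V : ℤ → Submodule ℝ (L2 D)} {φ : Space D → ℝ}
    (hV : IsMRA V φ) (j : ℕ) (k : Fin D → ℤ) : MemSubspace (V j) (dilate φ j k) := by
  induction j with
  | zero =>
    rw [Nat.cast_zero, dilate_zero]
    exact hV.father.memSubspace k
  | succ j ih =>
    have h := ((hV.scale _ _).1 ih).const_mul ((2 : ℝ) ^ ((D : ℝ) / 2))
    rw [Nat.cast_succ]
    convert h using 2 with x
    exact dilate_add_one φ j k x

/-- The multiresolution axioms provide a basis of father wavelets for `V 0` only. The dilation `x ↦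
x / 2` carries the level `j + 1` to the level `j`, so density of their span in `V j` follows by
induction, expressed through orthogonality. -/
lemma IsMRA.integral_mul_eq_zero {D : ℕ} {V : ℤ → Submodule ℝ (L2 D)} {φ : Space D → ℝ}
    (hV : IsMRA V φ) (j : ℕ) {f u : Space D → ℝ} (hf : MemSubspace (V j) f)
    (hu : MemLp u 2 volume) (h : ∀ k, ∫ x, dilate φ j k x * u x = 0) :
    ∫ x, f x * u x = 0 := by
  induction j generalizing f u with
  | zero =>
    refine hV.father.integral_mul_eq_zero hu (fun k => ?_) (by simpa using hf)
    simpa [dilate_zero] using h k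
  | succ j ih =>
    have h2 : (2 : ℝ)⁻¹ ≠ 0 := by norm_num
    have hf' : MemSubspace (V j) fun x => f ((2 : ℝ)⁻¹ • x) := by
      rw [hV.scale]
      simpa [smul_smul] using hf
    have hint : ∀ g : Space D → ℝ, ∫ x, g ((2 : ℝ)⁻¹ • x) =
        |((2 : ℝ)⁻¹ ^ Module.finrank ℝ (Space D))⁻¹| * ∫ x, g x := fun g => by
      rw [Measure.integral_comp_smul, smul_eq_mul]
    have key := ih hf' (memLp_comp_smul hu h2) fun k => by
      have h3 := h k
      have h4 : ∀ x, dilate φ j k x * u ((2 : ℝ)⁻¹ • x) = (2 : ℝ) ^ (-((D : ℝ) / 2)) *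
          (dilate φ (j + 1 : ℕ) k ((2 : ℝ)⁻¹ • x) * u ((2 : ℝ)⁻¹ • x)) := fun x => by
        rw [Nat.cast_succ, dilate_add_one, smul_smul, mul_inv_cancel₀ two_ne_zero, one_smul,
          ← mul_assoc, ← mul_assoc, ← Real.rpow_add (by norm_num), neg_add_cancel,
          Real.rpow_zero, one_mul]
      simp_rw [h4]
      rw [integral_const_mul, hint fun x => dilate φ (j + 1 : ℕ) k x * u x, h3, mul_zero,
        mul_zero]
    rw [hint fun x => f x * u x] at key
    exact (mul_eq_zero.1 key).resolve_left (by positivity)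

/-- The functions `2^{Dj/2} φ(2^j x - k)` and `2^{Dj/2} ψ_ε(2^j x - k)` of the level `j`. -/
def levelFamily {D : ℕ} (φ : Space D → ℝ) (ψ : MotherIndex D → Space D → ℝ) (j : ℤ) :
    (Fin D → ℤ) ⊕ (MotherIndex D × (Fin D → ℤ)) → Space D → ℝ :=
  Sum.elim (fun k => dilate φ j k) fun l => dilate (ψ l.1) j l.2

/-- The indices whose lattice point has coordinates at most `R` in absolute value. -/
def levelBox (D : ℕ) (R : ℝ) : Finset ((Fin D → ℤ) ⊕ (MotherIndex D × (Fin D → ℤ))) :=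
  (latticeBox D R).disjSum (Finset.univ ×ˢ latticeBox D R)

/-! ### Orthogonality within and across levels, and the two-scale relation. -/

section WaveletSystem

variable {D r : ℕ} {A : ℝ} {V : ℤ → Submodule ℝ (L2 D)} {φ : Space D → ℝ}
  {ψ : MotherIndex D → Space D → ℝ}

lemma IsWaveletSystem.continuous_level (hw : IsWaveletSystem r A V φ ψ) (j : ℤ)
    (i : (Fin D → ℤ) ⊕ (MotherIndex D × (Fin D → ℤ))) : Continuous (levelFamily φ ψ j i) := by
  rcases i with k | l
  · exact continuous_dilate hw.regular_father.1.continuous _ _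
  · exact continuous_dilate (hw.regular_mother l.1).1.continuous _ _

lemma IsWaveletSystem.hasCompactSupport_level (hw : IsWaveletSystem r A V φ ψ) (j : ℤ)
    (i : (Fin D → ℤ) ⊕ (MotherIndex D × (Fin D → ℤ))) :
    HasCompactSupport (levelFamily φ ψ j i) := by
  rcases i with k | l
  · exact hasCompactSupport_dilate hw.support_father _ _
  · exact hasCompactSupport_dilate (hw.support_mother l.1) _ _

lemma IsWaveletSystem.level_eq_zero (hw : IsWaveletSystem r A V φ ψ) {j : ℕ} {T : ℝ}
    {i : (Fin D → ℤ) ⊕ (MotherIndex D × (Fin D → ℤ))} (hi : i ∉ levelBox D (2 ^ j * T + A))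
    {x : Space D} (hx : ∀ i, |x i| ≤ T) : levelFamily φ ψ j i x = 0 := by
  rcases i with k | l
  · exact dilate_eq_zero_of_notMem_latticeBox hw.support_father (by simpa [levelBox] using hi) hx
  · exact dilate_eq_zero_of_notMem_latticeBox (hw.support_mother l.1)
      (by simpa [levelBox] using hi) hx

lemma abs_level_le {B : ℝ} (hφ : ∀ x, |φ x| ≤ B) (hψ : ∀ ε x, |ψ ε x| ≤ B) (j : ℤ)
    (i : (Fin D → ℤ) ⊕ (MotherIndex D × (Fin D → ℤ))) (x : Space D) :
    |levelFamily φ ψ j i x| ≤ (2 : ℝ) ^ ((D : ℝ) * (j : ℝ) / 2) * B := by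
  rcases i with k | l
  · exact abs_dilate_le hφ _ _ _
  · exact abs_dilate_le (hψ l.1) _ _ _

lemma IsWaveletSystem.integrable_mul_level (hw : IsWaveletSystem r A V φ ψ)
    {f : Space D → ℝ} (hf : LocallyIntegrable f volume) (j : ℤ)
    (i : (Fin D → ℤ) ⊕ (MotherIndex D × (Fin D → ℤ))) :
    Integrable (fun x => f x * levelFamily φ ψ j i x) volume := by
  have h := hf.integrable_smul_left_of_hasCompactSupport (hw.continuous_level j i)
    (hw.hasCompactSupport_level j i)
  simpa [smul_eq_mul, mul_comm] using h

lemma IsWaveletSystem.integral_level_sq (hw : IsWaveletSystem r A V φ ψ) (j : ℤ)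
    (i : (Fin D → ℤ) ⊕ (MotherIndex D × (Fin D → ℤ))) :
    ∫ x, levelFamily φ ψ j i x ^ 2 = 1 := by
  classical
  have h := (hw.mothers j).integral_mul i i
  simp_rw [sq]
  rw [if_pos rfl] at h
  exact h

lemma IsWaveletSystem.integral_mother_mul_mother (hw : IsWaveletSystem r A V φ ψ) (j : ℤ)
    (l l' : MotherIndex D × (Fin D → ℤ)) [Decidable (l = l')] :
    ∫ x, dilate (ψ l.1) j l.2 x * dilate (ψ l'.1) j l'.2 x = if l = l' then 1 else 0 := by
  classical
  have h := (hw.mothers j).integral_mul (Sum.inr l) (Sum.inr l')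
  simp only [Sum.elim_inr, Sum.inr.injEq] at h
  rw [h]

lemma IsWaveletSystem.integral_father_mul_father (hw : IsWaveletSystem r A V φ ψ)
    (k k' : Fin D → ℤ) [Decidable (k = k')] :
    ∫ x, φ (x - latticePoint k) * φ (x - latticePoint k') = if k = k' then 1 else 0 := by
  classical
  have h := (hw.mothers 0).integral_mul (Sum.inl k) (Sum.inl k')
  simp only [Sum.elim_inl, Sum.inl.injEq, dilate_zero] at h
  rw [h]

/-- A mother wavelet of level `j` is orthogonal to the father wavelets of that level, since both
belong to one orthonormal basis of `V (j + 1)`; these father wavelets span `V j` densely.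
Orthogonality between levels follows, because all coarser wavelets lie in `V j`. -/
lemma IsWaveletSystem.integral_mul_mother_eq_zero (hw : IsWaveletSystem r A V φ ψ) {j : ℕ}
    {f : Space D → ℝ} (hf : MemSubspace (V j) f) (l : MotherIndex D × (Fin D → ℤ)) :
    ∫ x, f x * dilate (ψ l.1) j l.2 x = 0 := by
  classical
  refine hw.mra.integral_mul_eq_zero j hf ((hw.mothers j).memLp (Sum.inr l)) fun k => ?_
  simpa using (hw.mothers j).integral_mul (Sum.inl k) (Sum.inr l)

lemma MemSubspace.mono {W W' : Submodule ℝ (L2 D)} (h : W ≤ W') {f : Space D → ℝ}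
    (hf : MemSubspace W f) : MemSubspace W' f :=
  ⟨hf.choose, h hf.choose_spec⟩

lemma IsWaveletSystem.integral_mother_mul_mother_of_lt (hw : IsWaveletSystem r A V φ ψ)
    {j j' : ℕ} (h : j < j') (l l' : MotherIndex D × (Fin D → ℤ)) :
    ∫ x, dilate (ψ l.1) j l.2 x * dilate (ψ l'.1) j' l'.2 x = 0 := by
  refine hw.integral_mul_mother_eq_zero (MemSubspace.mono (hw.mra.mono ?_)
    ((hw.mothers j).memSubspace (Sum.inr l))) l'
  omega

lemma IsWaveletSystem.integral_father_mul_mother (hw : IsWaveletSystem r A V φ ψ)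
    (k : Fin D → ℤ) (j : ℕ) (l : MotherIndex D × (Fin D → ℤ)) :
    ∫ x, φ (x - latticePoint k) * dilate (ψ l.1) j l.2 x = 0 :=
  hw.integral_mul_mother_eq_zero (MemSubspace.mono (hw.mra.mono (by omega))
    (hw.mra.father.memSubspace k)) l

/-- The wavelet coefficients at the levels below `J` determine the inner products with the father
wavelets of the level `J`. -/
lemma IsWaveletSystem.integral_mul_father_dilate_eq_zero (hw : IsWaveletSystem r A V φ ψ)
    {u : Space D → ℝ} (hu : LocallyIntegrable u volume)
    (hα : ∀ k, fatherCoeff φ u k = 0) (hβ : ∀ (j : ℕ) l, motherCoeff ψ u j l = 0) (j : ℕ)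
    (k : Fin D → ℤ) : ∫ x, u x * dilate φ j k x = 0 := by
  induction j generalizing k with
  | zero => simpa [dilate_zero, fatherCoeff] using hα k
  | succ j ih =>
    obtain ⟨R, hR⟩ := hw.support_father.dilate (j + 1 : ℕ) k
    -- Two-scale relation: the father wavelet of level `j + 1` lies in `V (j + 1)` and, having
    -- compact support, is a finite combination of father and mother wavelets of level `j`.
    -- Finiteness allows integration against a merely locally integrable `u`.
    have h1 := (hw.mothers j).ae_eq_sum (hw.mra.memSubspace_dilate (j + 1) k)
      (F := levelBox D (2 ^ j * R + A)) fun i hi => by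
        have h2 : ∀ x, dilate φ (j + 1 : ℕ) k x * levelFamily φ ψ j i x = 0 := fun x => by
          by_cases hx : ∀ i, |x i| ≤ R
          · rw [hw.level_eq_zero hi hx, mul_zero]
          · push Not at hx
            rw [hR x hx, zero_mul]
        exact (integral_congr_ae (Filter.Eventually.of_forall h2)).trans (integral_zero _ _)
    have h3 : (fun x => u x * dilate φ (j + 1 : ℕ) k x) =ᵐ[volume] fun x =>
        ∑ i ∈ levelBox D (2 ^ j * R + A), (∫ y, dilate φ (j + 1 : ℕ) k y *
          levelFamily φ ψ j i y) * (u x * levelFamily φ ψ j i x) := by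
      filter_upwards [h1] with x hx
      rw [hx, Finset.mul_sum]
      exact Finset.sum_congr rfl fun i _ => mul_left_comm _ _ _
    rw [integral_congr_ae h3, integral_finsetSum _ fun i _ =>
      (hw.integrable_mul_level hu j i).const_mul _]
    refine Finset.sum_eq_zero fun i _ => ?_
    rw [integral_const_mul]
    rcases i with k' | l
    · exact mul_eq_zero_of_right _ (ih k')
    · exact mul_eq_zero_of_right _ (hβ j l)

end WaveletSystem

/-! ### Completeness: integrable functions of compact support are determined by their coefficients.
-/

section Completeness

variable {D r : ℕ} {A B : ℝ} {V : ℤ → Submodule ℝ (L2 D)} {φ : Space D → ℝ}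
  {ψ : MotherIndex D → Space D → ℝ}

lemma card_motherIndex_le (D : ℕ) : (Fintype.card (MotherIndex D) : ℝ) ≤ 2 ^ D := by
  have h := Fintype.card_subtype_le fun ε : Fin D → Bool => ε ≠ fun _ => false
  simp only [Fintype.card_fun, Fintype.card_bool, Fintype.card_fin] at h
  exact_mod_cast h

lemma card_levelBox_le (D : ℕ) {R : ℝ} (hR : 0 ≤ R) :
    ((levelBox D R).card : ℝ) ≤ (2 ^ D + 1) * (2 * R + 1) ^ D := by
  rw [levelBox, Finset.card_disjSum, Finset.card_product, Finset.card_univ]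
  push_cast
  have h1 := card_latticeBox_le (D := D) hR
  calc ((latticeBox D R).card : ℝ) + Fintype.card (MotherIndex D) * (latticeBox D R).card
      = (Fintype.card (MotherIndex D) + 1) * (latticeBox D R).card := by ring
    _ ≤ _ := by gcongr; exact card_motherIndex_le D

lemma sum_levelBox {D : ℕ} {M : Type*} [AddCommMonoid M] (R : ℝ)
    (f : (Fin D → ℤ) ⊕ (MotherIndex D × (Fin D → ℤ)) → M) :
    ∑ i ∈ levelBox D R, f i = ∑ k ∈ latticeBox D R, f (Sum.inl k) +
      ∑ l ∈ Finset.univ ×ˢ latticeBox D R, f (Sum.inr l) := by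
  rw [levelBox, Finset.sum_disjSum]

lemma IsWaveletSystem.sum_abs_mother_le (hw : IsWaveletSystem r A V φ ψ) (hA : 0 ≤ A)
    (hB : 0 ≤ B) (hψ : ∀ ε x, |ψ ε x| ≤ B) (j : ℤ) (R : ℝ) (x : Space D) :
    ∑ l ∈ (Finset.univ : Finset (MotherIndex D)) ×ˢ latticeBox D R, |dilate (ψ l.1) j l.2 x| ≤
      2 ^ D * ((2 : ℝ) ^ ((D : ℝ) * (j : ℝ) / 2) * B * (2 * A + 1) ^ D) := by
  rw [Finset.sum_product]
  calc ∑ ε : MotherIndex D, ∑ k ∈ latticeBox D R, |dilate (ψ ε) j k x|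
      ≤ ∑ _ε : MotherIndex D, (2 : ℝ) ^ ((D : ℝ) * (j : ℝ) / 2) * B * (2 * A + 1) ^ D :=
        Finset.sum_le_sum fun ε _ =>
          sum_abs_dilate_le hA (hw.support_mother ε) (hψ ε) j _ x
    _ = Fintype.card (MotherIndex D) *
          ((2 : ℝ) ^ ((D : ℝ) * (j : ℝ) / 2) * B * (2 * A + 1) ^ D) := by simp
    _ ≤ _ := by
        gcongr
        exact card_motherIndex_le D

lemma IsWaveletSystem.sum_abs_level_le (hw : IsWaveletSystem r A V φ ψ) (hA : 0 ≤ A)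
    (hB : 0 ≤ B) (hφ : ∀ x, |φ x| ≤ B) (hψ : ∀ ε x, |ψ ε x| ≤ B) (j : ℤ) (R : ℝ)
    (x : Space D) :
    ∑ i ∈ levelBox D R, |levelFamily φ ψ j i x| ≤
      (2 ^ D + 1) * ((2 : ℝ) ^ ((D : ℝ) * (j : ℝ) / 2) * B * (2 * A + 1) ^ D) := by
  rw [sum_levelBox, add_mul, one_mul, add_comm]
  exact add_le_add (hw.sum_abs_mother_le hA hB hψ j R x)
    (sum_abs_dilate_le hA hw.support_father hφ j _ x)

/-- The constant may depend on the wavelets beyond `A` and `B`: it only serves a dominated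
convergence and never enters the risk bound. -/
lemma integral_abs_level_le (φ : Space D → ℝ) (ψ : MotherIndex D → Space D → ℝ) :
    ∃ I : ℝ, 0 ≤ I ∧ ∀ (j : ℤ) i, ∫ x, |levelFamily φ ψ j i x| ≤
      (2 : ℝ) ^ (-((D : ℝ) * (j : ℝ) / 2)) * I := by
  have h0 : ∀ g : Space D → ℝ, 0 ≤ ∫ x, |g x| := fun g => integral_nonneg fun x => abs_nonneg _
  have hs : 0 ≤ ∑ ε, ∫ x, |ψ ε x| := Finset.sum_nonneg fun ε _ => h0 _
  refine ⟨(∫ x, |φ x|) + ∑ ε, ∫ x, |ψ ε x|, add_nonneg (h0 _) hs, ?_⟩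
  rintro j (k | l)
  · change ∫ x, |dilate φ j k x| ≤ _
    rw [integral_abs_dilate]
    gcongr
    linarith
  · change ∫ x, |dilate (ψ l.1) j l.2 x| ≤ _
    rw [integral_abs_dilate]
    gcongr
    have h1 := Finset.single_le_sum (f := fun ε => ∫ x, |ψ ε x|) (fun ε _ => h0 (ψ ε))
      (Finset.mem_univ l.1)
    linarith [h0 φ]

/-- An integrable function of compact support all of whose wavelet coefficients vanish is zero. -/
lemma IsWaveletSystem.ae_eq_zero (hw : IsWaveletSystem r A V φ ψ) (hA : 0 ≤ A)
    (hB : 0 ≤ B) (hφ : ∀ x, |φ x| ≤ B) (hψ : ∀ ε x, |ψ ε x| ≤ B)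
    {u : Space D → ℝ} (hu : Integrable u volume) {T : ℝ} (hT : SupportedInCube T u)
    (hα : ∀ k, fatherCoeff φ u k = 0) (hβ : ∀ (j : ℕ) l, motherCoeff ψ u j l = 0) :
    u =ᵐ[volume] 0 := by
  refine hu.ae_eq_zero_of_forall_setIntegral_eq_zero fun s hs _ => ?_
  -- As `u` vanishes off the cube, `s` may be cut down to `s ∩ Q`, whose indicator is in `L²`
  -- although `u` need not be.
  set Q : Set (Space D) := {x | ∀ i, |x i| ≤ T} with hQ
  have hQc : IsCompact Q := isCompact_cube D T
  have hsQ : MeasurableSet (s ∩ Q) := hs.inter hQc.measurableSet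
  have hfin : volume (s ∩ Q) ≠ ∞ :=
    ((measure_mono Set.inter_subset_right).trans_lt hQc.measure_lt_top).ne
  set g : Space D → ℝ := (s ∩ Q).indicator fun _ => 1 with hg
  have hg2 : MemLp g 2 volume := memLp_indicator_const 2 hsQ 1 (Or.inr hfin)
  have hg1 : ∀ x, |g x| ≤ 1 := fun x => by
    rw [hg]
    by_cases hx : x ∈ s ∩ Q <;> simp [hx]
  have hgi : Integrable g volume := (integrable_indicator_iff hsQ).2 (by simpa using hfin.lt_top)
  have hug : ∫ x in s, u x = ∫ x, u x * g x := by
    rw [← integral_indicator hs]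
    congr 1 with x
    by_cases hx : x ∈ s
    · by_cases hxQ : x ∈ Q
      · simp [hg, hx, hxQ]
      · have : u x = 0 := hT x (by simpa [hQ] using hxQ)
        simp [this]
    · simp [hg, hx]
  rw [hug]
  -- `G J` is the orthogonal projection of `g` on `V (J + 1)`, a finite sum of functions to which
  -- `u` is orthogonal.
  let G : ℕ → Space D → ℝ := fun J x => ∑ i ∈ levelBox D (2 ^ J * T + A),
    (∫ y, g y * levelFamily φ ψ J i y) * levelFamily φ ψ J i x
  have hGmeas : ∀ J, AEStronglyMeasurable (G J) volume := fun J =>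
    Finset.aestronglyMeasurable_fun_sum _ fun i _ =>
      ((hw.continuous_level J i).aestronglyMeasurable).const_mul _
  have hgT : ∀ x, ¬ (∀ i, |x i| ≤ T) → g x = 0 := fun x hx => by
    rw [hg, Set.indicator_of_notMem]
    exact fun h => hx h.2
  have hconv : Filter.Tendsto (fun J => eLpNorm (G J - g) 2 volume) Filter.atTop (nhds 0) := by
    rw [ENNReal.tendsto_atTop_zero]
    intro ε hε
    obtain ⟨δ, hδ, hδε⟩ : ∃ δ : ℝ, 0 < δ ∧ ENNReal.ofReal δ ≤ ε := by
      rcases eq_or_ne ε ∞ with rfl | h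
      · exact ⟨1, one_pos, le_top⟩
      · exact ⟨ε.toReal, ENNReal.toReal_pos hε.ne' h, (ENNReal.ofReal_toReal h).le⟩
    obtain ⟨J, hJ⟩ := hw.mra.exists_mem_norm_sub_lt (hg2.toLp g) hδ
    refine ⟨J, fun j hj => ?_⟩
    obtain ⟨w, hwV, hwn⟩ := hJ j hj
    rw [eLpNorm_sub_comm]
    refine le_trans ((hw.mothers j).eLpNorm_sub_sum_le hg2 (fun i hi => ?_) hwV)
      ((ENNReal.ofReal_le_ofReal hwn.le).trans hδε)
    have h2 : ∀ x, g x * levelFamily φ ψ j i x = 0 := fun x => by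
      by_cases hx : ∀ i, |x i| ≤ T
      · rw [hw.level_eq_zero hi hx, mul_zero]
      · rw [hgT x hx, zero_mul]
    exact (integral_congr_ae (Filter.Eventually.of_forall h2)).trans (integral_zero _ _)
  -- Convergence in `L²` says nothing against an integrable `u`. An almost everywhere convergent
  -- subsequence, together with the uniform bound `hGb`, permits dominated convergence.
  obtain ⟨ns, hns, hae⟩ := (tendstoInMeasure_of_tendsto_eLpNorm two_ne_zero hGmeas hg2.1
    hconv).exists_seq_tendsto_ae
  have hzero : ∀ J, ∫ x, u x * G J x = 0 := fun J => by
    have h3 : ∀ x, u x * G J x = ∑ i ∈ levelBox D (2 ^ J * T + A),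
        (∫ y, g y * levelFamily φ ψ J i y) * (u x * levelFamily φ ψ J i x) := fun x => by
      simp only [G]
      rw [Finset.mul_sum]
      exact Finset.sum_congr rfl fun i _ => mul_left_comm _ _ _
    simp_rw [h3]
    rw [integral_finsetSum _ fun i _ =>
      (hw.integrable_mul_level hu.locallyIntegrable J i).const_mul _]
    refine Finset.sum_eq_zero fun i _ => ?_
    rw [integral_const_mul]
    rcases i with k' | l
    · exact mul_eq_zero_of_right _
        (hw.integral_mul_father_dilate_eq_zero hu.locallyIntegrable hα hβ J k')
    · exact mul_eq_zero_of_right _ (hβ J l)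
  obtain ⟨I, hI0, hI⟩ := integral_abs_level_le φ ψ
  set C : ℝ := I * ((2 ^ D + 1) * (B * (2 * A + 1) ^ D)) with hC
  -- The coefficients of `g` are at most the `L¹` norms of the wavelets, of order `2^{-DJ/2}`, while
  -- the wavelets add up to order `2^{DJ/2}`; the bound is therefore free of `J`.
  have hGb : ∀ J x, |G J x| ≤ C := fun J x => by
    have hcoef : ∀ i, |∫ y, g y * levelFamily φ ψ J i y| ≤
        (2 : ℝ) ^ (-((D : ℝ) * ((J : ℤ) : ℝ) / 2)) * I := fun i => by
      refine le_trans ?_ (hI J i)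
      refine (abs_integral_le_integral_abs).trans (integral_mono_of_nonneg
        (Filter.Eventually.of_forall fun _ => abs_nonneg _) ?_
        (Filter.Eventually.of_forall fun x => ?_))
      · exact ((hw.continuous_level J i).integrable_of_hasCompactSupport
          (hw.hasCompactSupport_level J i)).abs
      · simp only [abs_mul]
        exact mul_le_of_le_one_left (abs_nonneg _) (hg1 x)
    calc |G J x| ≤ ∑ i ∈ levelBox D (2 ^ J * T + A),
          (2 : ℝ) ^ (-((D : ℝ) * ((J : ℤ) : ℝ) / 2)) * I * |levelFamily φ ψ J i x| := by
          refine (Finset.abs_sum_le_sum_abs _ _).trans (Finset.sum_le_sum fun i _ => ?_)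
          rw [abs_mul]
          gcongr
          exact hcoef i
      _ ≤ (2 : ℝ) ^ (-((D : ℝ) * ((J : ℤ) : ℝ) / 2)) * I * ((2 ^ D + 1) *
          ((2 : ℝ) ^ ((D : ℝ) * ((J : ℤ) : ℝ) / 2) * B * (2 * A + 1) ^ D)) := by
          rw [← Finset.mul_sum]
          gcongr
          exact hw.sum_abs_level_le hA hB hφ hψ J _ x
      _ = ((2 : ℝ) ^ (-((D : ℝ) * ((J : ℤ) : ℝ) / 2)) *
          (2 : ℝ) ^ ((D : ℝ) * ((J : ℤ) : ℝ) / 2)) * C := by rw [hC]; ring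
      _ = C := by rw [← Real.rpow_add (by norm_num), neg_add_cancel, Real.rpow_zero, one_mul]
  have hlim : Filter.Tendsto (fun m => ∫ x, u x * G (ns m) x) Filter.atTop
      (nhds (∫ x, u x * g x)) := by
    refine tendsto_integral_of_dominated_convergence (fun x => |u x| * C)
      (fun m => hu.1.mul (hGmeas _)) (hu.abs.mul_const C) (fun m => ?_) ?_
    · refine Filter.Eventually.of_forall fun x => ?_
      rw [Real.norm_eq_abs, abs_mul]
      gcongr
      exact hGb _ x
    · filter_upwards [hae] with x hx
      exact hx.const_mul _
  simp_rw [hzero] at hlim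
  exact (tendsto_nhds_unique hlim tendsto_const_nhds)

end Completeness

/-! ### Sequence norms -/

lemma le_seqNorm {ι : Type} {p : ℝ≥0∞} (hp : 1 ≤ p) (a : ι → ℝ≥0∞) (i : ι) :
    a i ≤ seqNorm p a := by
  unfold seqNorm
  split_ifs with h
  · exact le_iSup a i
  · have hp0 : 0 < p.toReal := ENNReal.toReal_pos (one_pos.trans_le hp).ne' h
    rw [one_div, ENNReal.le_rpow_inv_iff hp0]
    exact ENNReal.le_tsum i

lemma abs_le_of_seqNorm_le {ι : Type} {p : ℝ≥0∞} (hp : 1 ≤ p) {a : ι → ℝ} {M : ℝ} (hM : 0 ≤ M)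
    (h : seqNorm p (fun i => ‖a i‖ₑ) ≤ ENNReal.ofReal M) (i : ι) : |a i| ≤ M := by
  have h1 := (le_seqNorm hp (fun i => ‖a i‖ₑ) i).trans h
  rwa [← ofReal_norm, ENNReal.ofReal_le_ofReal_iff hM] at h1

lemma sum_rpow_le_of_seqNorm_le {ι : Type} {p : ℝ≥0∞} (hp : 1 ≤ p) (hp' : p ≠ ∞) {a : ι → ℝ}
    {M : ℝ} (hM : 0 ≤ M) (h : seqNorm p (fun i => ‖a i‖ₑ) ≤ ENNReal.ofReal M) (s : Finset ι) :
    ∑ i ∈ s, |a i| ^ p.toReal ≤ M ^ p.toReal := by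
  have hp0 : 0 < p.toReal := ENNReal.toReal_pos (one_pos.trans_le hp).ne' hp'
  rw [seqNorm, if_neg hp', one_div, ENNReal.rpow_inv_le_iff hp0,
    ENNReal.ofReal_rpow_of_nonneg hM hp0.le] at h
  have h1 := (ENNReal.sum_le_tsum s).trans h
  have h2 : ∀ i ∈ s, ‖a i‖ₑ ^ p.toReal = ENNReal.ofReal (|a i| ^ p.toReal) := fun i _ => by
    rw [← ofReal_norm, ENNReal.ofReal_rpow_of_nonneg (norm_nonneg _) hp0.le,
      Real.norm_eq_abs]
  rwa [Finset.sum_congr rfl h2, ← ENNReal.ofReal_sum_of_nonneg (fun _ _ => by positivity),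
    ENNReal.ofReal_le_ofReal_iff (by positivity)] at h1

/-- Hölder's inequality against a sequence that is bounded and summable to the power `1 / b`. -/
lemma sum_abs_mul_le_of_seqNorm_le {ι : Type} {p : ℝ≥0∞} (hp : 1 ≤ p) {a e : ι → ℝ} {b M N t : ℝ}
    (hM : 0 ≤ M) (h : seqNorm p (fun i => ‖a i‖ₑ) ≤ ENNReal.ofReal M) (hb0 : 0 < b) (hb1 : b ≤ 1)
    (hpb : 1 - p⁻¹.toReal ≤ b) (s : Finset ι) (he0 : ∀ i ∈ s, 0 ≤ e i) (het : ∀ i ∈ s, e i ≤ t)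
    (ht : 0 ≤ t) (hN : 0 ≤ N) (heN : ∑ i ∈ s, e i ^ b⁻¹ ≤ N ^ b⁻¹) :
    ∑ i ∈ s, |a i| * e i ≤
      M * (t ^ (1 - (1 - p⁻¹.toReal) / b) * N ^ ((1 - p⁻¹.toReal) / b)) := by
  rcases eq_or_ne p ∞ with rfl | hp'
  -- The two endpoints have no finite conjugate pair and are treated directly; `p = ∞` forces `b =
  -- 1`.
  · have hb : b = 1 := le_antisymm hb1 (by simpa using hpb)
    subst hb
    simp only [inv_one, Real.rpow_one] at heN
    simp only [ENNReal.inv_top, ENNReal.toReal_zero, sub_zero, div_one, sub_self, Real.rpow_zero,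
      Real.rpow_one, one_mul]
    calc ∑ i ∈ s, |a i| * e i ≤ ∑ i ∈ s, M * e i := Finset.sum_le_sum fun i hi =>
          mul_le_mul_of_nonneg_right (abs_le_of_seqNorm_le le_top hM h i) (he0 i hi)
      _ ≤ M * N := by rw [← Finset.mul_sum]; gcongr
  have hs := sum_rpow_le_of_seqNorm_le hp hp' hM h s
  rcases eq_or_lt_of_le hp with rfl | hp1
  · simp only [ENNReal.toReal_one, Real.rpow_one] at hs
    simp only [inv_one, ENNReal.toReal_one, sub_self, zero_div, sub_zero, Real.rpow_one,
      Real.rpow_zero, mul_one]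
    calc ∑ i ∈ s, |a i| * e i ≤ ∑ i ∈ s, |a i| * t := Finset.sum_le_sum fun i hi =>
          mul_le_mul_of_nonneg_left (het i hi) (abs_nonneg _)
      _ ≤ M * t := by rw [← Finset.sum_mul]; gcongr
  set P := p.toReal with hP
  have hP1 : 1 < P := by
    rw [hP, ← ENNReal.toReal_one]
    exact (ENNReal.toReal_lt_toReal ENNReal.one_ne_top hp').2 hp1
  have hP0 : 0 < P := one_pos.trans hP1
  rw [ENNReal.toReal_inv, ← hP] at hpb ⊢
  -- `c` is the reciprocal of the conjugate exponent. Since `c ≤ b`, the power `e ^ c⁻¹` splits as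
  -- `e ^ (c⁻¹ - b⁻¹) * e ^ b⁻¹`; the first factor is bounded by means of `t`, the second is summed
  -- by means of `N`.
  set c := 1 - P⁻¹ with hc
  have hc0 : 0 < c := by
    have := inv_lt_one_of_one_lt₀ hP1
    rw [hc]
    linarith
  have hconj : P.HolderConjugate c⁻¹ :=
    Real.holderConjugate_iff.2 ⟨hP1, by rw [inv_inv, hc]; ring⟩
  have h1 := Real.inner_le_Lp_mul_Lq_of_nonneg s hconj (f := fun i => |a i|) (g := e)
    (fun i _ => abs_nonneg _) he0
  refine h1.trans ?_
  have h2 : (∑ i ∈ s, |a i| ^ P) ^ (1 / P) ≤ M := by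
    rw [one_div, Real.rpow_inv_le_iff_of_pos (Finset.sum_nonneg fun i _ => by positivity) hM hP0]
    exact hs
  have hcb : b⁻¹ ≤ c⁻¹ := inv_anti₀ hc0 hpb
  have h3 : ∑ i ∈ s, e i ^ c⁻¹ ≤ t ^ (c⁻¹ - b⁻¹) * N ^ b⁻¹ := by
    calc ∑ i ∈ s, e i ^ c⁻¹ ≤ ∑ i ∈ s, t ^ (c⁻¹ - b⁻¹) * e i ^ b⁻¹ := by
          refine Finset.sum_le_sum fun i hi => ?_
          have h4 : e i ^ c⁻¹ = e i ^ (c⁻¹ - b⁻¹) * e i ^ b⁻¹ := by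
            rw [← Real.rpow_add_of_nonneg (he0 i hi) (by linarith) (by positivity),
              sub_add_cancel]
          rw [h4]
          exact mul_le_mul_of_nonneg_right
            (Real.rpow_le_rpow (he0 i hi) (het i hi) (by linarith))
            (Real.rpow_nonneg (he0 i hi) _)
      _ ≤ _ := by
          rw [← Finset.mul_sum]
          gcongr
  have h5 : (∑ i ∈ s, e i ^ c⁻¹) ^ (1 / c⁻¹) ≤ t ^ (1 - c / b) * N ^ (c / b) := by
    refine (Real.rpow_le_rpow (Finset.sum_nonneg fun i hi => Real.rpow_nonneg (he0 i hi) _) h3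
      (by positivity)).trans (le_of_eq ?_)
    rw [Real.mul_rpow (by positivity) (by positivity), ← Real.rpow_mul ht, ← Real.rpow_mul hN]
    congr 2 <;> field_simp
  exact mul_le_mul h2 h5 (Real.rpow_nonneg (Finset.sum_nonneg fun i hi =>
    Real.rpow_nonneg (he0 i hi) _) _) hM

/-! ### Wavelet coefficients of functions in a Besov ball -/

section BesovBall

variable {D : ℕ} {φ : Space D → ℝ} {ψ : MotherIndex D → Space D → ℝ} {σ L : ℝ} {p q : ℝ≥0∞}
  {f : Space D → ℝ}

lemma seqNorm_fatherCoeff_le (hf : f ∈ besovBall φ ψ σ p q L) :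
    seqNorm p (fun k => ‖fatherCoeff φ f k‖ₑ) ≤ ENNReal.ofReal L :=
  le_self_add.trans hf.2

lemma seqNorm_levels_le (hf : f ∈ besovBall φ ψ σ p q L) :
    seqNorm q (fun j : ℕ =>
      ENNReal.ofReal ((2 : ℝ) ^ ((j : ℝ) * (σ + D * (1 / 2 - p⁻¹.toReal)))) *
        seqNorm p (fun l : MotherIndex D × (Fin D → ℤ) => ‖motherCoeff ψ f j l‖ₑ)) ≤
      ENNReal.ofReal L :=
  le_add_self.trans hf.2

/-- An infinite level norm would be turned into `0` by `toReal` in `levelNorm`; this excludes it. -/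
lemma seqNorm_level_ne_top (hq : 1 ≤ q) (hf : f ∈ besovBall φ ψ σ p q L) (j : ℕ) :
    seqNorm p (fun l : MotherIndex D × (Fin D → ℤ) => ‖motherCoeff ψ f j l‖ₑ) ≠ ∞ := by
  intro h
  have h1 := (le_seqNorm hq _ j).trans (seqNorm_levels_le hf)
  simp only [h] at h1
  rw [ENNReal.mul_top (by positivity)] at h1
  exact ENNReal.ofReal_ne_top (top_le_iff.1 h1)

/-- The weighted `ℓ^p` norm of the mother coefficients at the level `j`. -/
def levelNorm {D : ℕ} (ψ : MotherIndex D → Space D → ℝ) (σ : ℝ) (p : ℝ≥0∞) (f : Space D → ℝ)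
    (j : ℕ) : ℝ :=
  (2 : ℝ) ^ ((j : ℝ) * (σ + D * (1 / 2 - p⁻¹.toReal))) *
    (seqNorm p (fun l : MotherIndex D × (Fin D → ℤ) => ‖motherCoeff ψ f j l‖ₑ)).toReal

lemma levelNorm_nonneg (j : ℕ) : 0 ≤ levelNorm ψ σ p f j := by
  unfold levelNorm
  positivity

lemma seqNorm_levelNorm_le (hq : 1 ≤ q) (hf : f ∈ besovBall φ ψ σ p q L) :
    seqNorm q (fun j => ‖levelNorm ψ σ p f j‖ₑ) ≤ ENNReal.ofReal L := by
  convert seqNorm_levels_le hf using 3 with j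
  rw [← ofReal_norm, Real.norm_of_nonneg (levelNorm_nonneg j), levelNorm,
    ENNReal.ofReal_mul (by positivity), ENNReal.ofReal_toReal (seqNorm_level_ne_top hq hf j)]

lemma levelNorm_le (hq : 1 ≤ q) (hL : 0 ≤ L) (hf : f ∈ besovBall φ ψ σ p q L) (j : ℕ) :
    levelNorm ψ σ p f j ≤ L :=
  (le_abs_self _).trans (abs_le_of_seqNorm_le hq hL (seqNorm_levelNorm_le hq hf) j)

/-- Hölder over the levels against the constant sequence `1`. This is the origin of the factor `(log
n)^{1 - 1/qd}` on the boundary between regimes. -/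
lemma sum_levelNorm_le (hq : 1 ≤ q) (hL : 0 ≤ L) (hf : f ∈ besovBall φ ψ σ p q L)
    (s : Finset ℕ) :
    ∑ j ∈ s, levelNorm ψ σ p f j ≤ L * (s.card : ℝ) ^ (1 - q⁻¹.toReal) := by
  have h := sum_abs_mul_le_of_seqNorm_le hq (e := fun _ => 1) (t := 1) (N := s.card) hL
    (seqNorm_levelNorm_le hq hf) one_pos le_rfl (by simp) s (by simp) (by simp) zero_le_one
    (by positivity) (by simp)
  simpa [abs_of_nonneg (levelNorm_nonneg _)] using h

lemma seqNorm_level_eq (hq : 1 ≤ q) (hf : f ∈ besovBall φ ψ σ p q L) (j : ℕ) :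
    seqNorm p (fun l : MotherIndex D × (Fin D → ℤ) => ‖motherCoeff ψ f j l‖ₑ) =
      ENNReal.ofReal ((2 : ℝ) ^ (-((j : ℝ) * (σ + D * (1 / 2 - p⁻¹.toReal)))) *
        levelNorm ψ σ p f j) := by
  rw [levelNorm, ← mul_assoc, ← Real.rpow_add (by norm_num), neg_add_cancel, Real.rpow_zero,
    one_mul, ENNReal.ofReal_toReal (seqNorm_level_ne_top hq hf j)]

lemma seqNorm_level_le (hq : 1 ≤ q) (hL : 0 ≤ L) (hf : f ∈ besovBall φ ψ σ p q L) (j : ℕ) :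
    seqNorm p (fun l : MotherIndex D × (Fin D → ℤ) => ‖motherCoeff ψ f j l‖ₑ) ≤
      ENNReal.ofReal ((2 : ℝ) ^ (-((j : ℝ) * (σ + D * (1 / 2 - p⁻¹.toReal)))) * L) := by
  rw [seqNorm_level_eq hq hf]
  gcongr
  exact levelNorm_le hq hL hf j

end BesovBall

/-! ### Wavelet expansions -/

section Expansion

variable {D r : ℕ} {A B : ℝ} {V : ℤ → Submodule ℝ (L2 D)} {φ : Space D → ℝ}
  {ψ : MotherIndex D → Space D → ℝ}

/-- The indices of the mother wavelets of the level `j` that meet `[-T, T]^D`. -/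
def motherBox (D : ℕ) (T A : ℝ) (j : ℕ) : Finset (MotherIndex D × (Fin D → ℤ)) :=
  Finset.univ ×ˢ latticeBox D (2 ^ j * T + A)

/-- The part at the level `j` of a wavelet expansion. -/
def levelSum (ψ : MotherIndex D → Space D → ℝ) (T A : ℝ)
    (c : ℕ → MotherIndex D × (Fin D → ℤ) → ℝ) (j : ℕ) (x : Space D) : ℝ :=
  ∑ l ∈ motherBox D T A j, c j l * dilate (ψ l.1) j l.2 x

/-- The part at the coarsest level of a wavelet expansion. -/
def fatherSum (φ : Space D → ℝ) (T A : ℝ) (c₀ : (Fin D → ℤ) → ℝ) (x : Space D) : ℝ :=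
  ∑ k ∈ latticeBox D (T + A), c₀ k * φ (x - latticePoint k)

lemma IsWaveletSystem.integrable_mul_mother (hw : IsWaveletSystem r A V φ ψ)
    {f : Space D → ℝ} (hf : LocallyIntegrable f volume) (j : ℕ)
    (l : MotherIndex D × (Fin D → ℤ)) :
    Integrable (fun x => f x * dilate (ψ l.1) j l.2 x) volume :=
  hw.integrable_mul_level hf j (Sum.inr l)

lemma IsWaveletSystem.integrable_mul_father (hw : IsWaveletSystem r A V φ ψ)
    {f : Space D → ℝ} (hf : LocallyIntegrable f volume) (k : Fin D → ℤ) :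
    Integrable (fun x => f x * φ (x - latticePoint k)) volume := by
  have h := hw.integrable_mul_level hf 0 (Sum.inl k)
  simpa [levelFamily, dilate_zero] using h

lemma IsWaveletSystem.integral_mul_expansion (hw : IsWaveletSystem r A V φ ψ)
    {f : Space D → ℝ} (hf : LocallyIntegrable f volume) (T : ℝ) (c₀ : (Fin D → ℤ) → ℝ)
    (c : ℕ → MotherIndex D × (Fin D → ℤ) → ℝ) (J : ℕ) :
    Integrable (fun x => f x * (fatherSum φ T A c₀ x +
      ∑ j ∈ Finset.range J, levelSum ψ T A c j x)) volume ∧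
    ∫ x, f x * (fatherSum φ T A c₀ x + ∑ j ∈ Finset.range J, levelSum ψ T A c j x) =
      ∑ k ∈ latticeBox D (T + A), c₀ k * fatherCoeff φ f k +
        ∑ j ∈ Finset.range J, ∑ l ∈ motherBox D T A j, c j l * motherCoeff ψ f j l := by
  have h1 : (fun x => f x * (fatherSum φ T A c₀ x +
      ∑ j ∈ Finset.range J, levelSum ψ T A c j x)) = fun x =>
      ∑ k ∈ latticeBox D (T + A), c₀ k * (f x * φ (x - latticePoint k)) +
        ∑ j ∈ Finset.range J, ∑ l ∈ motherBox D T A j,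
          c j l * (f x * dilate (ψ l.1) j l.2 x) := by
    funext x
    simp only [fatherSum, levelSum, mul_add, Finset.mul_sum, mul_left_comm (f x)]
  have h2 : ∀ k ∈ latticeBox D (T + A),
      Integrable (fun x => c₀ k * (f x * φ (x - latticePoint k))) volume :=
    fun k _ => (hw.integrable_mul_father hf k).const_mul _
  have h3 : ∀ (j : ℕ), ∀ l ∈ motherBox D T A j,
      Integrable (fun x => c j l * (f x * dilate (ψ l.1) j l.2 x)) volume :=
    fun j l _ => (hw.integrable_mul_mother hf j l).const_mul _
  have h4 : ∀ j ∈ Finset.range J, Integrable (fun x => ∑ l ∈ motherBox D T A j,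
      c j l * (f x * dilate (ψ l.1) j l.2 x)) volume :=
    fun j _ => integrable_finsetSum _ (h3 j)
  rw [h1]
  refine ⟨(integrable_finsetSum _ h2).add (integrable_finsetSum _ h4), ?_⟩
  rw [integral_add (integrable_finsetSum _ h2) (integrable_finsetSum _ h4),
    integral_finsetSum _ h2, integral_finsetSum _ h4]
  congr 1
  · exact Finset.sum_congr rfl fun k _ => integral_const_mul _ _
  · refine Finset.sum_congr rfl fun j _ => ?_
    rw [integral_finsetSum _ (h3 j)]
    exact Finset.sum_congr rfl fun l _ => integral_const_mul _ _

lemma IsWaveletSystem.abs_fatherSum_le (hw : IsWaveletSystem r A V φ ψ) (hA : 0 ≤ A)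
    (hφ : ∀ x, |φ x| ≤ B) {L : ℝ} (hL : 0 ≤ L) {c₀ : (Fin D → ℤ) → ℝ} (hc : ∀ k, |c₀ k| ≤ L)
    (T : ℝ) (x : Space D) : |fatherSum φ T A c₀ x| ≤ L * (B * (2 * A + 1) ^ D) := by
  refine (Finset.abs_sum_le_sum_abs _ _).trans ?_
  calc ∑ k ∈ latticeBox D (T + A), |c₀ k * φ (x - latticePoint k)|
      ≤ ∑ k ∈ latticeBox D (T + A), L * |φ (x - latticePoint k)| :=
        Finset.sum_le_sum fun k _ => by
          rw [abs_mul]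
          exact mul_le_mul_of_nonneg_right (hc k) (abs_nonneg _)
    _ ≤ _ := by
        rw [← Finset.mul_sum]
        gcongr
        simpa [dilate_zero] using sum_abs_dilate_le hA hw.support_father hφ 0
          (latticeBox D (T + A)) x

/-- The `D / 2` in the coefficient decay pays for the growth of the wavelets; the surplus `δ`
remains as the geometric ratio. -/
lemma IsWaveletSystem.abs_levelSum_le (hw : IsWaveletSystem r A V φ ψ) (hA : 0 ≤ A)
    (hB : 0 ≤ B) (hψ : ∀ ε x, |ψ ε x| ≤ B) {L δ : ℝ} (hL : 0 ≤ L)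
    {c : ℕ → MotherIndex D × (Fin D → ℤ) → ℝ}
    (hc : ∀ j l, |c j l| ≤ (2 : ℝ) ^ (-((j : ℝ) * (δ + D / 2))) * L) (T : ℝ) (j : ℕ)
    (x : Space D) :
    |levelSum ψ T A c j x| ≤ L * (2 ^ D * (B * (2 * A + 1) ^ D)) * ((2 : ℝ) ^ (-δ)) ^ j := by
  refine (Finset.abs_sum_le_sum_abs _ _).trans ?_
  calc ∑ l ∈ motherBox D T A j, |c j l * dilate (ψ l.1) j l.2 x|
      ≤ ∑ l ∈ motherBox D T A j, (2 : ℝ) ^ (-((j : ℝ) * (δ + D / 2))) * L *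
          |dilate (ψ l.1) j l.2 x| :=
        Finset.sum_le_sum fun l _ => by
          rw [abs_mul]
          exact mul_le_mul_of_nonneg_right (hc j l) (abs_nonneg _)
    _ ≤ (2 : ℝ) ^ (-((j : ℝ) * (δ + D / 2))) * L *
          (2 ^ D * ((2 : ℝ) ^ ((D : ℝ) * ((j : ℤ) : ℝ) / 2) * B * (2 * A + 1) ^ D)) := by
        rw [← Finset.mul_sum]
        gcongr
        exact hw.sum_abs_mother_le hA hB hψ j _ x
    _ = L * (2 ^ D * (B * (2 * A + 1) ^ D)) * ((2 : ℝ) ^ (-((j : ℝ) * (δ + D / 2))) *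
          (2 : ℝ) ^ ((D : ℝ) * ((j : ℤ) : ℝ) / 2)) := by ring
    _ = _ := by
        rw [← Real.rpow_add (by norm_num), ← Real.rpow_mul_natCast (by norm_num)]
        congr 2
        push_cast
        ring

/-- The bound for wavelet expansions whose coefficients at the level `j` are at most
`L 2^{-j(δ + D/2)}`. -/
def expansionBound (D : ℕ) (A B L δ : ℝ) : ℝ :=
  L * (B * (2 * A + 1) ^ D) + L * (2 ^ D * (B * (2 * A + 1) ^ D)) * (1 - (2 : ℝ) ^ (-δ))⁻¹

lemma two_rpow_neg_lt_one {δ : ℝ} (hδ : 0 < δ) : (2 : ℝ) ^ (-δ) < 1 :=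
  Real.rpow_lt_one_of_one_lt_of_neg (by norm_num) (by linarith)

/-- Levels decay geometrically in sup norm and share a compact support, so the series converges
uniformly to a bounded `S`. A locally integrable `f` restricted to that support dominates, and
pairing with `f` may be done termwise. -/
lemma IsWaveletSystem.expansion_limit (hw : IsWaveletSystem r A V φ ψ) (hA : 0 ≤ A)
    (hB : 0 ≤ B) (hφ : ∀ x, |φ x| ≤ B) (hψ : ∀ ε x, |ψ ε x| ≤ B) {L δ : ℝ} (hL : 0 ≤ L)
    (hδ : 0 < δ) {c₀ : (Fin D → ℤ) → ℝ} (hc₀ : ∀ k, |c₀ k| ≤ L)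
    {c : ℕ → MotherIndex D × (Fin D → ℤ) → ℝ}
    (hc : ∀ j l, |c j l| ≤ (2 : ℝ) ^ (-((j : ℝ) * (δ + D / 2))) * L) (T : ℝ) :
    ∃ S : Space D → ℝ, Measurable S ∧ SupportedInCube (T + 2 * A) S ∧
      (∀ x, |S x| ≤ expansionBound D A B L δ) ∧
      ∀ f : Space D → ℝ, LocallyIntegrable f volume →
        Integrable (fun x => f x * S x) volume ∧
        Filter.Tendsto (fun J => ∑ k ∈ latticeBox D (T + A), c₀ k * fatherCoeff φ f k +
          ∑ j ∈ Finset.range J, ∑ l ∈ motherBox D T A j, c j l * motherCoeff ψ f j l)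
          Filter.atTop (nhds (∫ x, f x * S x)) := by
  set ρ : ℝ := (2 : ℝ) ^ (-δ) with hρ
  have hρ0 : 0 ≤ ρ := by positivity
  have hρ1 : ρ < 1 := two_rpow_neg_lt_one hδ
  set C : ℝ := L * (2 ^ D * (B * (2 * A + 1) ^ D)) with hC
  have hC0 : 0 ≤ C := by positivity
  have hsum : ∀ x, Summable fun j => levelSum ψ T A c j x := fun x =>
    Summable.of_norm_bounded ((summable_geometric_of_lt_one hρ0 hρ1).mul_left C) fun j =>
      hw.abs_levelSum_le hA hB hψ hL hc T j x
  let P : ℕ → Space D → ℝ := fun J x =>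
    fatherSum φ T A c₀ x + ∑ j ∈ Finset.range J, levelSum ψ T A c j x
  let S : Space D → ℝ := fun x => fatherSum φ T A c₀ x + ∑' j, levelSum ψ T A c j x
  have hlim : ∀ x, Filter.Tendsto (fun J => P J x) Filter.atTop (nhds (S x)) := fun x =>
    (hsum x).hasSum.tendsto_sum_nat.const_add _
  have hPb : ∀ J x, |P J x| ≤ expansionBound D A B L δ := fun J x => by
    refine (abs_add_le _ _).trans (add_le_add (hw.abs_fatherSum_le hA hφ hL hc₀ T x) ?_)
    refine (Finset.abs_sum_le_sum_abs _ _).trans ?_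
    calc ∑ j ∈ Finset.range J, |levelSum ψ T A c j x| ≤ ∑ j ∈ Finset.range J, C * ρ ^ j :=
          Finset.sum_le_sum fun j _ => hw.abs_levelSum_le hA hB hψ hL hc T j x
      _ ≤ C * (1 - ρ)⁻¹ := by
          rw [← Finset.mul_sum, ← tsum_geometric_of_lt_one hρ0 hρ1]
          gcongr
          exact (summable_geometric_of_lt_one hρ0 hρ1).sum_le_tsum _ fun _ _ => by positivity
  have hPs : ∀ J, SupportedInCube (T + 2 * A) (P J) := fun J x hx => by
    have h1 : fatherSum φ T A c₀ x = 0 := Finset.sum_eq_zero fun k hk => by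
      have h2 := dilate_eq_zero_of_lt (j := 0) hA hw.support_father (T := T) (k := k)
        (by simpa using hk) hx
      rw [Nat.cast_zero, dilate_zero] at h2
      exact mul_eq_zero_of_right _ h2
    have h3 : ∀ j, levelSum ψ T A c j x = 0 := fun j => Finset.sum_eq_zero fun l hl => by
      rw [dilate_eq_zero_of_lt hA (hw.support_mother l.1) (T := T)
        (by simpa [motherBox] using hl) hx, mul_zero]
    simp [P, h1, h3]
  have hPc : ∀ J, Continuous (P J) := fun J => by
    have hφc : Continuous φ := hw.regular_father.1.continuous
    refine Continuous.add ?_ ?_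
    · exact continuous_finsetSum _ fun k _ => by fun_prop
    · exact continuous_finsetSum _ fun j _ => continuous_finsetSum _ fun l _ =>
        (continuous_dilate (hw.regular_mother l.1).1.continuous _ _).const_mul _
  have hSm : Measurable S := measurable_of_tendsto_metrizable (fun J => (hPc J).measurable)
    (tendsto_pi_nhds.2 hlim)
  have hSs : SupportedInCube (T + 2 * A) S := fun x hx =>
    tendsto_nhds_unique (hlim x) (by simp only [fun J => hPs J x hx]; exact tendsto_const_nhds)
  have hSb : ∀ x, |S x| ≤ expansionBound D A B L δ := fun x =>
    le_of_tendsto (hlim x).abs (Filter.Eventually.of_forall fun J => hPb J x)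
  refine ⟨S, hSm, hSs, hSb, fun f hf => ?_⟩
  set Q : Set (Space D) := {x | ∀ i, |x i| ≤ T + 2 * A} with hQ
  have hQc : IsCompact Q := isCompact_cube D _
  have hfQ : Integrable (Q.indicator f) volume :=
    (integrable_indicator_iff hQc.measurableSet).2 (hf.integrableOn_isCompact hQc)
  have hbd : ∀ g : Space D → ℝ, SupportedInCube (T + 2 * A) g →
      (∀ x, |g x| ≤ expansionBound D A B L δ) → ∀ x, ‖f x * g x‖ ≤
        |Q.indicator f x| * expansionBound D A B L δ := fun g hg hgb x => by
    rw [Real.norm_eq_abs, abs_mul]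
    by_cases hx : x ∈ Q
    · rw [Set.indicator_of_mem hx]
      gcongr
      exact hgb x
    · rw [hg x (by simpa [hQ] using hx), Set.indicator_of_notMem hx]
      simp
  have hint : Integrable (fun x => |Q.indicator f x| * expansionBound D A B L δ) volume :=
    hfQ.abs.mul_const _
  refine ⟨hint.mono' (hf.aestronglyMeasurable.mul hSm.aestronglyMeasurable)
    (Filter.Eventually.of_forall (hbd S hSs hSb)), ?_⟩
  simp_rw [← (hw.integral_mul_expansion hf T c₀ c _).2]
  refine tendsto_integral_of_dominated_convergence _
    (fun J => hf.aestronglyMeasurable.mul (hPc J).aestronglyMeasurable) hint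
    (fun J => Filter.Eventually.of_forall (hbd (P J) (hPs J) (hPb J)))
    (Filter.Eventually.of_forall fun x => (hlim x).const_mul _)

end Expansion

/-! ### Densities in the Besov ball: boundedness and the wavelet series. -/

section Density

variable {D r : ℕ} {A B T σ L : ℝ} {p q : ℝ≥0∞} {V : ℤ → Submodule ℝ (L2 D)} {φ : Space D → ℝ}
  {ψ : MotherIndex D → Space D → ℝ} {f : Space D → ℝ}

lemma IsWaveletSystem.fatherCoeff_eq_zero (hw : IsWaveletSystem r A V φ ψ)
    (hf : SupportedInCube T f) {k : Fin D → ℤ} (hk : k ∉ latticeBox D (T + A)) :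
    fatherCoeff φ f k = 0 := by
  have h : ∀ x, f x * φ (x - latticePoint k) = 0 := fun x => by
    by_cases hx : ∀ i, |x i| ≤ T
    · have h1 := dilate_eq_zero_of_notMem_latticeBox (j := 0) hw.support_father (T := T) (k := k)
        (by simpa using hk) hx
      rw [Nat.cast_zero, dilate_zero] at h1
      exact mul_eq_zero_of_right _ h1
    · push Not at hx
      rw [hf x hx, zero_mul]
  exact (integral_congr_ae (Filter.Eventually.of_forall h)).trans (integral_zero _ _)

lemma IsWaveletSystem.motherCoeff_eq_zero (hw : IsWaveletSystem r A V φ ψ)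
    (hf : SupportedInCube T f) {j : ℕ} {l : MotherIndex D × (Fin D → ℤ)}
    (hl : l ∉ motherBox D T A j) : motherCoeff ψ f j l = 0 := by
  have h : ∀ x, f x * dilate (ψ l.1) j l.2 x = 0 := fun x => by
    by_cases hx : ∀ i, |x i| ≤ T
    · exact mul_eq_zero_of_right _ (dilate_eq_zero_of_notMem_latticeBox (hw.support_mother l.1)
        (by simpa [motherBox] using hl) hx)
    · push Not at hx
      rw [hf x hx, zero_mul]
  exact (integral_congr_ae (Filter.Eventually.of_forall h)).trans (integral_zero _ _)

lemma abs_fatherCoeff_le (hp : 1 ≤ p) (hL : 0 ≤ L) (hf : f ∈ besovBall φ ψ σ p q L)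
    (k : Fin D → ℤ) : |fatherCoeff φ f k| ≤ L :=
  abs_le_of_seqNorm_le hp hL (seqNorm_fatherCoeff_le hf) k

lemma abs_motherCoeff_le (hp : 1 ≤ p) (hq : 1 ≤ q) (hL : 0 ≤ L)
    (hf : f ∈ besovBall φ ψ σ p q L) (j : ℕ) (l : MotherIndex D × (Fin D → ℤ)) :
    |motherCoeff ψ f j l| ≤ (2 : ℝ) ^ (-((j : ℝ) * (σ + D * (1 / 2 - p⁻¹.toReal)))) * L :=
  abs_le_of_seqNorm_le hp (by positivity) (seqNorm_level_le hq hL hf j) l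

lemma integrable_of_mem_densityClass (hf : f ∈ densityClass φ ψ σ p q L T) :
    Integrable f volume :=
  Integrable.of_integral_ne_zero (by rw [hf.2.2.2.1]; exact one_ne_zero)

/-- Densities in a Besov ball of smoothness larger than `D / p` agree with their wavelet series. -/
lemma IsWaveletSystem.density_expansion (hw : IsWaveletSystem r A V φ ψ) (hA : 0 ≤ A)
    (hB : 0 ≤ B) (hφ : ∀ x, |φ x| ≤ B) (hψ : ∀ ε x, |ψ ε x| ≤ B) (hL : 0 ≤ L) (hp : 1 ≤ p)
    (hq : 1 ≤ q) (hσ : (D : ℝ) * p⁻¹.toReal < σ) (hf : f ∈ densityClass φ ψ σ p q L T) :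
    (∀ᵐ x, f x ≤ expansionBound D A B L (σ - D * p⁻¹.toReal)) ∧
      ∀ g : Space D → ℝ, LocallyIntegrable g volume →
        Integrable (fun x => g x * f x) volume ∧
        Filter.Tendsto (fun J => ∑ k ∈ latticeBox D (T + A), fatherCoeff φ f k * fatherCoeff φ g k +
          ∑ j ∈ Finset.range J, ∑ l ∈ motherBox D T A j, motherCoeff ψ f j l * motherCoeff ψ g j l)
          Filter.atTop (nhds (∫ x, g x * f x)) := by
  classical
  have hfB := hf.1
  have hfT : SupportedInCube T f := hf.2.2.2.2
  have hfi := integrable_of_mem_densityClass hf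
  -- Bounding each coefficient by the `ℓ^p` norm of its level loses `D / p` derivatives, so the
  -- surplus is `δ = σ - D / p > 0`.
  obtain ⟨S, hSm, hSs, hSb, hS⟩ := hw.expansion_limit hA hB hφ hψ hL (sub_pos.2 hσ)
    (abs_fatherCoeff_le hp hL hfB) (c := motherCoeff ψ f) (fun j l => by
      have h := abs_motherCoeff_le hp hq hL hfB j l
      convert h using 4
      ring) T
  have hSi : Integrable S volume := by
    have h := (hS (fun _ => 1) (locallyIntegrable_const 1)).1
    simpa using h
  have hlocf : ∀ k, LocallyIntegrable (fun x => φ (x - latticePoint k)) volume := fun k =>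
    Continuous.locallyIntegrable (by
      have := hw.regular_father.1.continuous
      fun_prop)
  have hlocm : ∀ (j : ℕ) (l : MotherIndex D × (Fin D → ℤ)),
      LocallyIntegrable (dilate (ψ l.1) j l.2) volume := fun j l =>
    (continuous_dilate (hw.regular_mother l.1).1.continuous _ _).locallyIntegrable
  have hSα : ∀ k, ∫ x, φ (x - latticePoint k) * S x = fatherCoeff φ f k := fun k => by
    refine tendsto_nhds_unique (hS _ (hlocf k)).2
      (tendsto_const_nhds.congr fun J => ?_)
    have h1 : ∀ k', fatherCoeff φ (fun x => φ (x - latticePoint k)) k' =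
        if k = k' then 1 else 0 := fun k' => hw.integral_father_mul_father k k'
    have h2 : ∀ (j : ℕ) l, motherCoeff ψ (fun x => φ (x - latticePoint k)) j l = 0 :=
      fun j l => hw.integral_father_mul_mother k j l
    simp only [h1, h2, mul_ite, mul_one, mul_zero, Finset.sum_ite_eq, Finset.sum_const_zero,
      add_zero]
    split_ifs with hk
    · rfl
    · exact hw.fatherCoeff_eq_zero hfT hk
  have hSβ : ∀ (j : ℕ) l, ∫ x, dilate (ψ l.1) j l.2 x * S x = motherCoeff ψ f j l := fun j l => by
    refine tendsto_nhds_unique (hS _ (hlocm j l)).2 ?_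
    -- By orthonormality the partial sums are constant as soon as they include the level `j`.
    refine tendsto_const_nhds.congr' ?_
    filter_upwards [Filter.eventually_gt_atTop j] with J hJ
    have h1 : ∀ k', fatherCoeff φ (dilate (ψ l.1) j l.2) k' = 0 := fun k' => by
      rw [← hw.integral_father_mul_mother k' j l, fatherCoeff]
      simp_rw [mul_comm]
    have h2 : ∀ (j' : ℕ) l', motherCoeff ψ (dilate (ψ l.1) j l.2) j' l' =
        if j = j' then (if l = l' then 1 else 0) else 0 := fun j' l' => by
      split_ifs with h3 h4
      · subst h3
        simpa [h4, motherCoeff] using hw.integral_mother_mul_mother j l l'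
      · subst h3
        simpa [h4, motherCoeff] using hw.integral_mother_mul_mother j l l'
      · rcases lt_or_gt_of_ne h3 with h | h
        · exact hw.integral_mother_mul_mother_of_lt h l l'
        · rw [← hw.integral_mother_mul_mother_of_lt h l' l, motherCoeff]
          simp_rw [mul_comm]
    have h5 : ∀ j' ∈ Finset.range J, ∑ l' ∈ motherBox D T A j', motherCoeff ψ f j' l' *
        (if j = j' then (if l = l' then (1 : ℝ) else 0) else 0) =
        if j = j' then motherCoeff ψ f j l else 0 := fun j' _ => by
      by_cases h3 : j = j'
      · subst h3
        simp only [if_true, mul_ite, mul_one, mul_zero, Finset.sum_ite_eq]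
        split_ifs with hl
        · rfl
        · exact (hw.motherCoeff_eq_zero hfT hl).symm
      · simp [h3]
    simp only [h1, h2, mul_zero, Finset.sum_const_zero, zero_add]
    rw [Finset.sum_congr rfl h5, Finset.sum_ite_eq, if_pos (Finset.mem_range.2 hJ)]
  -- `f` and `S` have the same coefficients, and their difference is integrable with compact
  -- support, so completeness applies.
  have hfS : f =ᵐ[volume] S := by
    have hz : (fun x => f x - S x) =ᵐ[volume] 0 := by
      refine hw.ae_eq_zero hA hB hφ hψ (hfi.sub hSi) (T := T + 2 * A) (fun x hx => ?_)
        (fun k => ?_) fun j l => ?_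
      · obtain ⟨i, hi⟩ := hx
        rw [hSs x ⟨i, hi⟩, hfT x ⟨i, by linarith⟩, sub_zero]
      · unfold fatherCoeff
        simp_rw [sub_mul]
        rw [integral_sub (hw.integrable_mul_father hfi.locallyIntegrable k)
          (hw.integrable_mul_father hSi.locallyIntegrable k), sub_eq_zero]
        simp_rw [mul_comm (S _)]
        exact (hSα k).symm
      · unfold motherCoeff
        simp_rw [sub_mul]
        rw [integral_sub (hw.integrable_mul_mother hfi.locallyIntegrable j l)
          (hw.integrable_mul_mother hSi.locallyIntegrable j l), sub_eq_zero]
        simp_rw [mul_comm (S _)]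
        exact (hSβ j l).symm
    filter_upwards [hz] with x hx
    simpa [sub_eq_zero] using hx
  refine ⟨?_, fun g hg => ?_⟩
  · filter_upwards [hfS] with x hx
    rw [hx]
    exact (le_abs_self _).trans (hSb x)
  · have h1 : (fun x => g x * f x) =ᵐ[volume] fun x => g x * S x := by
      filter_upwards [hfS] with x hx
      rw [hx]
    rw [integral_congr_ae h1, integrable_congr h1]
    exact hS g hg

end Density

/-! ### The thresholding estimator -/

section Estimator

variable {D n r : ℕ} {A B T σ K : ℝ} {p : ℝ≥0∞} {V : ℤ → Submodule ℝ (L2 D)} {φ : Space D → ℝ}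
  {ψ : MotherIndex D → Space D → ℝ}

open Classical in
/-- The thresholded empirical wavelet coefficients, set to zero above the highest level. -/
def thresholdCoeff {D n : ℕ} (ψ : MotherIndex D → Space D → ℝ) (σ K : ℝ)
    (X : Fin n → Space D) (j : ℕ) (l : MotherIndex D × (Fin D → ℤ)) : ℝ :=
  if (j : ℝ) ≤ lowLevel D σ n ∨ K * √((j : ℝ) / n) < |empiricalMean X (dilate (ψ l.1) j l.2)|
    then empiricalMean X (dilate (ψ l.1) j l.2) else 0

lemma thresholdEstimator_eq (X : Fin n → Space D) (x : Space D) :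
    thresholdEstimator φ ψ σ p K n X x =
      (∑' k : Fin D → ℤ,
        empiricalMean X (fun y => φ (y - latticePoint k)) * φ (x - latticePoint k)) +
      ∑ j ∈ Finset.range (⌊highLevel D σ p n⌋₊ + 1),
        ∑' l : MotherIndex D × (Fin D → ℤ),
          thresholdCoeff ψ σ K X j l * dilate (ψ l.1) j l.2 x := by
  unfold thresholdEstimator thresholdCoeff
  congr! 7

lemma empiricalMean_eq_zero {X : Fin n → Space D} {g : Space D → ℝ} (h : ∀ i, g (X i) = 0) :
    empiricalMean X g = 0 := by
  simp [empiricalMean, h]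

lemma abs_empiricalMean_le {X : Fin n → Space D} {g : Space D → ℝ} {M : ℝ} (hM : 0 ≤ M)
    (h : ∀ x, |g x| ≤ M) : |empiricalMean X g| ≤ M := by
  rw [empiricalMean, abs_mul, abs_inv, Nat.abs_cast]
  rcases Nat.eq_zero_or_pos n with rfl | hn
  · simpa
  · rw [inv_mul_le_iff₀ (by exact_mod_cast hn)]
    refine (Finset.abs_sum_le_sum_abs _ _).trans ?_
    calc ∑ i, |g (X i)| ≤ ∑ _i : Fin n, M := Finset.sum_le_sum fun i _ => h _
      _ = n * M := by simp

lemma measurable_empiricalMean {g : Space D → ℝ} (hg : Measurable g) :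
    Measurable fun X : Fin n → Space D => empiricalMean X g := by
  unfold empiricalMean
  fun_prop

lemma thresholdCoeff_eq_zero {X : Fin n → Space D} {j : ℕ} {l : MotherIndex D × (Fin D → ℤ)}
    (h : empiricalMean X (dilate (ψ l.1) j l.2) = 0) : thresholdCoeff ψ σ K X j l = 0 := by
  unfold thresholdCoeff
  split_ifs
  exacts [h, rfl]

lemma IsWaveletSystem.measurable_thresholdCoeff (hw : IsWaveletSystem r A V φ ψ) (j : ℕ)
    (l : MotherIndex D × (Fin D → ℤ)) :
    Measurable fun X : Fin n → Space D => thresholdCoeff ψ σ K X j l := by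
  have h := measurable_empiricalMean (n := n)
    (continuous_dilate (hw.regular_mother l.1).1.continuous j l.2).measurable
  unfold thresholdCoeff
  refine Measurable.ite ?_ h measurable_const
  by_cases hj : (j : ℝ) ≤ lowLevel D σ n
  · simp [hj]
  · simp only [hj, false_or]
    exact measurableSet_lt measurable_const h.abs

/-- For samples in `[-T, T]^D` the estimator is a finite wavelet expansion. -/
lemma IsWaveletSystem.thresholdEstimator_eq_expansion (hw : IsWaveletSystem r A V φ ψ)
    {X : Fin n → Space D} (hX : ∀ i m, |X i m| ≤ T) (x : Space D) :
    thresholdEstimator φ ψ σ p K n X x =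
      fatherSum φ T A (fun k => empiricalMean X (fun y => φ (y - latticePoint k))) x +
        ∑ j ∈ Finset.range (⌊highLevel D σ p n⌋₊ + 1),
          levelSum ψ T A (thresholdCoeff ψ σ K X) j x := by
  rw [thresholdEstimator_eq]
  congr 1
  · refine tsum_eq_sum fun k hk => ?_
    rw [empiricalMean_eq_zero, zero_mul]
    intro i
    have h1 := dilate_eq_zero_of_notMem_latticeBox (j := 0) hw.support_father (T := T) (k := k)
      (by simpa using hk) (hX i)
    rw [Nat.cast_zero, dilate_zero] at h1
    exact h1
  · refine Finset.sum_congr rfl fun j _ => tsum_eq_sum fun l hl => ?_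
    rw [thresholdCoeff_eq_zero, zero_mul]
    exact empiricalMean_eq_zero fun i => dilate_eq_zero_of_notMem_latticeBox
      (hw.support_mother l.1) (by simpa [motherBox] using hl) (hX i)

/-- Finite supports make each series summable, so its value is the limit along one fixed exhausting
sequence of finite index sets, and measurability passes to the limit. -/
lemma measurable_tsum_of_finite_support {α ι : Type*} [MeasurableSpace α] {f : ι → α → ℝ}
    (F : ℕ → Finset ι) (hF : Filter.Tendsto F Filter.atTop Filter.atTop)
    (hf : ∀ i, Measurable (f i)) (hs : ∀ x, (Function.support fun i => f i x).Finite) :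
    Measurable fun x => ∑' i, f i x := by
  refine measurable_of_tendsto_metrizable
    (f := fun N x => ∑ i ∈ F N, f i x)
    (fun N => Finset.measurable_fun_sum _ fun i _ => hf i) ?_
  rw [tendsto_pi_nhds]
  intro x
  exact (summable_of_hasFiniteSupport (hs x)).hasSum.comp hF

lemma finite_support_dilate {g : Space D → ℝ} (hg : SupportedInCube A g) (j : ℤ) (x : Space D) :
    (Function.support fun k => dilate g j k x).Finite :=
  (nearBox A ((2 : ℝ) ^ j • x)).finite_toSet.subset fun k hk => by
    by_contra h
    exact hk (dilate_eq_zero_of_notMem_nearBox hg h)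

lemma tendsto_univ_product_latticeBox (D : ℕ) : Filter.Tendsto
    (fun N : ℕ => (Finset.univ : Finset (MotherIndex D)) ×ˢ latticeBox D N)
    Filter.atTop Filter.atTop := by
  refine Filter.tendsto_atTop_finset_of_monotone
    (fun _ _ h => Finset.product_subset_product_right (latticeBox_mono (by exact_mod_cast h)))
    fun l => ?_
  obtain ⟨N, hN⟩ := ((tendsto_latticeBox D).eventually
    (Filter.eventually_ge_atTop {l.2})).exists
  exact ⟨N, by simpa using hN⟩

lemma IsWaveletSystem.isEstimator_thresholdEstimator (hw : IsWaveletSystem r A V φ ψ) :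
    IsEstimator (thresholdEstimator φ ψ σ p K n) := by
  have hφc : Continuous φ := hw.regular_father.1.continuous
  have hψc : ∀ ε, Continuous (ψ ε) := fun ε => (hw.regular_mother ε).1.continuous
  constructor
  · simp_rw [thresholdEstimator_eq]
    refine Measurable.add ?_ (Finset.measurable_fun_sum _ fun j _ => ?_)
    · refine measurable_tsum_of_finite_support _ (tendsto_latticeBox D) (fun k => ?_) fun z => ?_
      · refine Measurable.mul ((measurable_empiricalMean
          (g := fun y => φ (y - latticePoint k)) ?_).comp measurable_fst) ?_
        · exact Continuous.measurable (by fun_prop)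
        · exact Continuous.measurable (by fun_prop)
      · refine (finite_support_dilate hw.support_father 0 z.2).subset fun k hk => ?_
        simp only [dilate_zero]
        exact right_ne_zero_of_mul hk
    · refine measurable_tsum_of_finite_support _ (tendsto_univ_product_latticeBox D)
        (fun l => ?_) fun z => ?_
      · exact ((hw.measurable_thresholdCoeff j l).comp measurable_fst).mul
          ((continuous_dilate (hψc l.1) _ _).measurable.comp measurable_snd)
      · refine (Set.Finite.prod (Set.finite_univ (α := MotherIndex D))
          (Set.finite_iUnion fun ε => finite_support_dilate (hw.support_mother ε) j z.2)).subset
          fun l hl => ?_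
        exact ⟨trivial, Set.mem_iUnion.2 ⟨l.1, right_ne_zero_of_mul hl⟩⟩
  · intro X
    -- Every finite sample lies in some cube, whose size may depend on `X`; there the estimator is a
    -- finite combination of integrable functions.
    have hX : ∀ i m, |X i m| ≤ ∑ i, ∑ m, |X i m| := fun i m =>
      (Finset.single_le_sum (f := fun m => |X i m|) (fun _ _ => abs_nonneg _)
        (Finset.mem_univ m)).trans (Finset.single_le_sum (f := fun i => ∑ m, |X i m|)
          (fun _ _ => Finset.sum_nonneg fun _ _ => abs_nonneg _) (Finset.mem_univ i))
    have h := (hw.integral_mul_expansion (f := fun _ => 1) (locallyIntegrable_const 1)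
      (∑ i, ∑ m, |X i m|) (fun k => empiricalMean X (fun y => φ (y - latticePoint k)))
      (thresholdCoeff ψ σ K X) (⌊highLevel D σ p n⌋₊ + 1)).1
    simp only [one_mul] at h
    exact h.congr (Filter.Eventually.of_forall fun x =>
      (hw.thresholdEstimator_eq_expansion hX x).symm)

end Estimator

/-! ### Exponential moments of empirical means -/

section ExponentialMoments

variable {D n : ℕ} {p g : Space D → ℝ}

/-- The law of one observation with density `p`. -/
def densityLaw {D : ℕ} (p : Space D → ℝ) : Measure (Space D) :=
  (volume : Measure (Space D)).withDensity fun x => ENNReal.ofReal (p x)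

lemma isProbabilityMeasure_densityLaw (hp0 : ∀ x, 0 ≤ p x) (hp1 : ∫ x, p x = 1) :
    IsProbabilityMeasure (densityLaw p) := by
  constructor
  have hi : Integrable p volume := Integrable.of_integral_ne_zero (by rw [hp1]; exact one_ne_zero)
  rw [densityLaw, withDensity_apply _ MeasurableSet.univ, Measure.restrict_univ,
    ← ofReal_integral_eq_lintegral_ofReal hi (Filter.Eventually.of_forall hp0), hp1,
    ENNReal.ofReal_one]

lemma integral_densityLaw (hpm : Measurable p) (hp0 : ∀ x, 0 ≤ p x) (g : Space D → ℝ) :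
    ∫ x, g x ∂(densityLaw p) = ∫ x, p x * g x := by
  rw [densityLaw, integral_withDensity_eq_integral_toReal_smul hpm.ennreal_ofReal
    (Filter.Eventually.of_forall fun _ => ENNReal.ofReal_lt_top)]
  refine integral_congr_ae (Filter.Eventually.of_forall fun x => ?_)
  simp [ENNReal.toReal_ofReal (hp0 x)]

/-- From `e^h ≤ 1 + h + h²` for `|h| ≤ 1`; the linear term integrates to zero. -/
lemma integral_exp_le {Ω : Type*} [MeasurableSpace Ω] {μ : Measure Ω} [IsProbabilityMeasure μ]
    {h : Ω → ℝ} (hm : Measurable h) (hb : ∀ x, |h x| ≤ 1) (h0 : ∫ x, h x ∂μ = 0) {v : ℝ}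
    (hv : ∫ x, h x ^ 2 ∂μ ≤ v) : ∫ x, Real.exp (h x) ∂μ ≤ Real.exp v := by
  have hi : Integrable h μ := Integrable.of_bound hm.aestronglyMeasurable 1
    (Filter.Eventually.of_forall hb)
  have hi2 : Integrable (fun x => h x ^ 2) μ :=
    Integrable.of_bound (hm.pow_const 2).aestronglyMeasurable 1
      (Filter.Eventually.of_forall fun x => by
        rw [Real.norm_eq_abs, abs_pow]
        exact pow_le_one₀ (abs_nonneg _) (hb x))
  have hie : Integrable (fun x => Real.exp (h x)) μ :=
    Integrable.of_bound (Real.measurable_exp.comp hm).aestronglyMeasurable (Real.exp 1)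
      (Filter.Eventually.of_forall fun x => by
        rw [Real.norm_eq_abs, Real.abs_exp]
        exact Real.exp_le_exp.2 ((le_abs_self _).trans (hb x)))
  have h1i : Integrable (fun _ : Ω => (1 : ℝ)) μ := integrable_const 1
  calc ∫ x, Real.exp (h x) ∂μ ≤ ∫ x, (1 + h x + h x ^ 2) ∂μ := by
        refine integral_mono hie ((h1i.add hi).add hi2) fun x => ?_
        have := (abs_le.1 (Real.abs_exp_sub_one_sub_id_le (hb x))).2
        simp only
        linarith
    _ = 1 + ∫ x, h x ^ 2 ∂μ := by
        rw [integral_add (f := fun x => 1 + h x) (h1i.add hi) hi2, integral_add h1i hi, h0]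
        simp
    _ ≤ 1 + v := by linarith
    _ ≤ Real.exp v := by linarith [Real.add_one_le_exp v]

lemma integral_exp_sum_le {Ω : Type} [MeasurableSpace Ω] {μ : Measure Ω} [IsProbabilityMeasure μ]
    {h : Ω → ℝ} (hm : Measurable h) (hb : ∀ x, |h x| ≤ 1) (h0 : ∫ x, h x ∂μ = 0) {v : ℝ}
    (hv : ∫ x, h x ^ 2 ∂μ ≤ v) (n : ℕ) :
    ∫⁻ X : Fin n → Ω, ENNReal.ofReal (Real.exp (∑ i, h (X i))) ∂(Measure.pi fun _ => μ) ≤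
      ENNReal.ofReal (Real.exp (n * v)) := by
  have hbd : ∀ X : Fin n → Ω, ‖Real.exp (∑ i, h (X i))‖ ≤ Real.exp n := fun X => by
    rw [Real.norm_eq_abs, Real.abs_exp]
    refine Real.exp_le_exp.2 ?_
    calc ∑ i, h (X i) ≤ ∑ _i : Fin n, (1 : ℝ) :=
          Finset.sum_le_sum fun i _ => (le_abs_self _).trans (hb _)
      _ = n := by simp
  have hmeas : Measurable fun X : Fin n → Ω => Real.exp (∑ i, h (X i)) := by fun_prop
  rw [← ofReal_integral_eq_lintegral_ofReal
    (Integrable.of_bound hmeas.aestronglyMeasurable _ (Filter.Eventually.of_forall hbd))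
    (Filter.Eventually.of_forall fun X => (Real.exp_pos _).le)]
  refine ENNReal.ofReal_le_ofReal ?_
  simp_rw [Real.exp_sum]
  rw [integral_fintype_prod_eq_pow (ι := Fin n) (fun x => Real.exp (h x)), Fintype.card_fin,
    Real.exp_nat_mul]
  exact pow_le_pow_left₀ (integral_nonneg fun x => (Real.exp_pos _).le)
    (integral_exp_le hm hb h0 hv) n

/-- The factor `2` comes from `e^{|x|} ≤ e^x + e^{-x}`, applied to `h` and `-h`. -/
lemma lintegral_exp_abs_sum_le {Ω : Type} [MeasurableSpace Ω] {μ : Measure Ω}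
    [IsProbabilityMeasure μ] {h : Ω → ℝ} (hm : Measurable h) (hb : ∀ x, |h x| ≤ 1)
    (h0 : ∫ x, h x ∂μ = 0) {v : ℝ} (hv : ∫ x, h x ^ 2 ∂μ ≤ v) (n : ℕ) :
    ∫⁻ X : Fin n → Ω, ENNReal.ofReal (Real.exp |∑ i, h (X i)|) ∂(Measure.pi fun _ => μ) ≤
      ENNReal.ofReal (2 * Real.exp (n * v)) := by
  have h1 := integral_exp_sum_le hm hb h0 hv n
  have h2 := integral_exp_sum_le (h := fun x => -h x) (μ := μ) hm.neg
    (fun x => by rw [abs_neg]; exact hb x)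
    (by rw [integral_neg, h0, neg_zero]) (v := v) (by simpa using hv) n
  calc ∫⁻ X : Fin n → Ω, ENNReal.ofReal (Real.exp |∑ i, h (X i)|) ∂(Measure.pi fun _ => μ)
      ≤ ∫⁻ X : Fin n → Ω, (ENNReal.ofReal (Real.exp (∑ i, h (X i))) +
          ENNReal.ofReal (Real.exp (∑ i, -h (X i)))) ∂(Measure.pi fun _ => μ) := by
        refine lintegral_mono fun X => ?_
        simp only
        rw [Finset.sum_neg_distrib, ← ENNReal.ofReal_add (Real.exp_pos _).le (Real.exp_pos _).le]
        refine ENNReal.ofReal_le_ofReal ?_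
        rcases abs_choice (∑ i, h (X i)) with h' | h' <;> rw [h']
        · linarith [Real.exp_pos (-∑ i, h (X i))]
        · linarith [Real.exp_pos (∑ i, h (X i))]
    _ ≤ ENNReal.ofReal (Real.exp (n * v)) + ENNReal.ofReal (Real.exp (n * v)) := by
        rw [lintegral_add_left (by fun_prop)]
        exact add_le_add h1 h2
    _ = ENNReal.ofReal (2 * Real.exp (n * v)) := by
        rw [two_mul, ENNReal.ofReal_add (Real.exp_pos _).le (Real.exp_pos _).le]

/-- A Bernstein type bound on the exponential moments of the deviation of an empirical mean. -/
lemma lintegral_exp_deviation_le (hpm : Measurable p) (hp0 : ∀ x, 0 ≤ p x) (hp1 : ∫ x, p x = 1)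
    (hg : Measurable g) {M v t : ℝ} (hM : ∀ x, |g x| ≤ M) (hv : ∫ x, p x * g x ^ 2 ≤ v)
    (ht : 0 ≤ t) (htM : 2 * t * M ≤ 1) (hn : 1 ≤ n) :
    ∫⁻ X, ENNReal.ofReal (Real.exp (t * n * |empiricalMean X g - ∫ x, p x * g x|))
      ∂(sampleLaw p n) ≤ ENNReal.ofReal (2 * Real.exp (n * (t ^ 2 * v))) := by
  have : IsProbabilityMeasure (densityLaw p) := isProbabilityMeasure_densityLaw hp0 hp1
  set m := ∫ x, p x * g x with hm
  have hmg : ∫ x, g x ∂(densityLaw p) = m := integral_densityLaw hpm hp0 g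
  have hM0 : 0 ≤ M := (abs_nonneg _).trans (hM 0)
  have hgi : Integrable g (densityLaw p) := Integrable.of_bound hg.aestronglyMeasurable M
    (Filter.Eventually.of_forall hM)
  have hg2i : Integrable (fun x => g x ^ 2) (densityLaw p) :=
    Integrable.of_bound (hg.pow_const 2).aestronglyMeasurable (M ^ 2)
      (Filter.Eventually.of_forall fun x => by
        rw [Real.norm_eq_abs, abs_pow]
        exact pow_le_pow_left₀ (abs_nonneg _) (hM x) 2)
  have hmM : |m| ≤ M := by
    rw [← hmg]
    have h := norm_integral_le_of_norm_le_const (μ := densityLaw p) (f := g) (C := M)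
      (Filter.Eventually.of_forall hM)
    simpa using h
  have hsum : ∀ X : Fin n → Space D,
      t * n * |empiricalMean X g - m| = |∑ i, t * (g (X i) - m)| := fun X => by
    have hn0 : (0 : ℝ) < n := by exact_mod_cast hn
    rw [← Finset.mul_sum, Finset.sum_sub_distrib, abs_mul, abs_of_nonneg ht, mul_assoc]
    congr 1
    rw [← abs_of_pos hn0, ← abs_mul, empiricalMean, mul_sub, mul_inv_cancel_left₀ hn0.ne']
    simp
  simp_rw [hsum]
  -- The centred function satisfies `|g - m| ≤ 2 * M`, which is why `2 * t * M ≤ 1` is required; its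
  -- variance is at most its second moment.
  refine lintegral_exp_abs_sum_le (μ := densityLaw p) (h := fun x => t * (g x - m)) (by fun_prop)
    (fun x => ?_) ?_ ?_ n
  · rw [abs_mul, abs_of_nonneg ht]
    have h1 : |g x - m| ≤ 2 * M := (abs_sub _ _).trans (by linarith [hM x])
    nlinarith
  · rw [integral_const_mul, integral_sub hgi (integrable_const m), hmg]
    simp
  · have h1 : ∀ x, (t * (g x - m)) ^ 2 = t ^ 2 * (g x ^ 2 - (2 * m) * g x + m ^ 2) :=
      fun x => by ring
    simp_rw [h1]
    have h2 : Integrable (fun x => (2 * m) * g x) (densityLaw p) := hgi.const_mul _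
    rw [integral_const_mul, integral_add (f := fun x => g x ^ 2 - (2 * m) * g x) (hg2i.sub h2)
      (integrable_const _), integral_sub hg2i h2, integral_const_mul, hmg,
      integral_densityLaw hpm hp0 fun x => g x ^ 2]
    refine mul_le_mul_of_nonneg_left ?_ (sq_nonneg t)
    simp
    nlinarith [sq_nonneg m]

end ExponentialMoments

/-! ### Sums over levels and rates -/

/-- The largest index dominates. The set `s` is arbitrary, so only the powers that occur in it need
the bound `Y`. -/
lemma sum_pow_le_of_one_lt {ρ Y : ℝ} (hρ : 1 < ρ) (s : Finset ℕ) (hY : 0 ≤ Y)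
    (h : ∀ j ∈ s, ρ ^ j ≤ Y) : ∑ j ∈ s, ρ ^ j ≤ Y * (ρ / (ρ - 1)) := by
  have hρ1 : 0 < ρ - 1 := by linarith
  rcases s.eq_empty_or_nonempty with rfl | hs
  · simp
    positivity
  · calc ∑ j ∈ s, ρ ^ j ≤ ∑ j ∈ Finset.range (s.max' hs + 1), ρ ^ j :=
          Finset.sum_le_sum_of_subset_of_nonneg (fun j hj => Finset.mem_range.2
            (Nat.lt_succ_of_le (s.le_max' j hj))) fun _ _ _ => by positivity
      _ = (ρ ^ (s.max' hs + 1) - 1) / (ρ - 1) := geom_sum_eq hρ.ne' _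
      _ ≤ (ρ ^ s.max' hs * ρ) / (ρ - 1) := by
          rw [pow_succ]
          gcongr
          linarith
      _ ≤ (Y * ρ) / (ρ - 1) := by
          gcongr
          exact h _ (s.max'_mem hs)
      _ = Y * (ρ / (ρ - 1)) := mul_div_assoc _ _ _

lemma sum_pow_le_of_lt_one {ρ Y : ℝ} (hρ0 : 0 < ρ) (hρ : ρ < 1) (s : Finset ℕ) (hY : 0 ≤ Y)
    (h : ∀ j ∈ s, ρ ^ j ≤ Y) : ∑ j ∈ s, ρ ^ j ≤ Y * (1 - ρ)⁻¹ := by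
  have hρ1 : 0 < 1 - ρ := by linarith
  rcases s.eq_empty_or_nonempty with rfl | hs
  · simp
    positivity
  · calc ∑ j ∈ s, ρ ^ j ≤ ∑ j ∈ Finset.Ico (s.min' hs) (s.max' hs + 1), ρ ^ j :=
          Finset.sum_le_sum_of_subset_of_nonneg (fun j hj => Finset.mem_Ico.2
            ⟨s.min'_le j hj, Nat.lt_succ_of_le (s.le_max' j hj)⟩) fun _ _ _ => by positivity
      _ = ρ ^ s.min' hs * ∑ i ∈ Finset.range (s.max' hs + 1 - s.min' hs), ρ ^ i := by
          rw [Finset.sum_Ico_eq_sum_range, Finset.mul_sum]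
          simp_rw [pow_add]
      _ ≤ Y * (1 - ρ)⁻¹ := by
          rw [← tsum_geometric_of_lt_one hρ0.le hρ]
          refine mul_le_mul (h _ (s.min'_mem hs)) ?_ (by positivity) hY
          exact (summable_geometric_of_lt_one hρ0.le hρ).sum_le_tsum _ fun _ _ => by positivity

lemma two_rpow_natCast_mul (j : ℕ) (x : ℝ) : (2 : ℝ) ^ ((j : ℝ) * x) = ((2 : ℝ) ^ x) ^ j := by
  rw [mul_comm, Real.rpow_mul_natCast (by norm_num)]

/-- The level cutoffs compare `2^{jN}` with `n`; in this form they turn `2^{jx}` into the power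
`n^{x/N}`. -/
lemma two_rpow_mul_eq (j : ℕ) {N : ℝ} (hN : N ≠ 0) (x : ℝ) :
    (2 : ℝ) ^ ((j : ℝ) * x) = ((2 : ℝ) ^ ((j : ℝ) * N)) ^ (x / N) := by
  rw [← Real.rpow_mul (by norm_num)]
  congr 1
  field_simp

section Rates

/-- An upper bound for the number of levels used by the thresholding estimator. -/
def levelCount (N : ℝ) (n : ℕ) : ℝ := 1 + Real.logb 2 n / N

lemma add_one_le_levelCount {N : ℝ} (hN : 0 < N) {n j : ℕ} (hn : 1 ≤ n)
    (h : (2 : ℝ) ^ ((j : ℝ) * N) ≤ n) : (j : ℝ) + 1 ≤ levelCount N n := by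
  have hn0 : (0 : ℝ) < n := by exact_mod_cast hn
  have h1 : (j : ℝ) * N ≤ Real.logb 2 n := (Real.le_logb_iff_rpow_le (by norm_num) hn0).2 h
  rw [levelCount, add_comm]
  gcongr
  rwa [le_div_iff₀ hN]

lemma one_le_levelCount {N : ℝ} (hN : 0 < N) {n : ℕ} (hn : 1 ≤ n) : 1 ≤ levelCount N n := by
  have h : 0 ≤ Real.logb 2 (n : ℝ) := Real.logb_nonneg (by norm_num) (by exact_mod_cast hn)
  rw [levelCount]
  have := div_nonneg h hN.le
  linarith

lemma card_le_levelCount {N : ℝ} (hN : 0 < N) {n : ℕ} (hn : 1 ≤ n) {s : Finset ℕ}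
    (h : ∀ j ∈ s, (2 : ℝ) ^ ((j : ℝ) * N) ≤ n) : (s.card : ℝ) ≤ levelCount N n := by
  have h0 : 0 ≤ levelCount N n := zero_le_one.trans (one_le_levelCount hN hn)
  have h1 : s ⊆ Finset.range ⌊levelCount N n⌋₊ := fun j hj => by
    rw [Finset.mem_range, ← Nat.succ_le_iff, Nat.le_floor_iff h0]
    push_cast
    exact add_one_le_levelCount hN hn (h j hj)
  have h2 := Finset.card_le_card h1
  rw [Finset.card_range] at h2
  exact (Nat.cast_le.2 h2).trans (Nat.floor_le h0)

/-- The case `n = 1` is excluded because `log 1 = 0` whereas `levelCount` is at least `1`. -/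
lemma levelCount_le_log {N : ℝ} (hN : 0 < N) :
    ∃ c : ℝ, 1 ≤ c ∧ ∀ n : ℕ, 2 ≤ n → levelCount N n ≤ c * Real.log n := by
  have h2 : 0 < Real.log 2 := Real.log_pos (by norm_num)
  refine ⟨1 + 1 / Real.log 2 + 1 / (Real.log 2 * N), by
    have : 0 < 1 / Real.log 2 + 1 / (Real.log 2 * N) := by positivity
    linarith, fun n hn => ?_⟩
  have hl : Real.log 2 ≤ Real.log n := Real.log_le_log (by norm_num) (by exact_mod_cast hn)
  have h1 : 1 ≤ 1 / Real.log 2 * Real.log n := by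
    rw [one_div, inv_mul_eq_div, le_div_iff₀ h2]
    linarith
  have h3 : Real.logb 2 n / N = 1 / (Real.log 2 * N) * Real.log n := by
    rw [Real.logb]
    field_simp
  rw [levelCount, h3]
  nlinarith

/-- The exponent of the rate in the dense regime. -/
def denseExponent (D : ℕ) (σg σd : ℝ) : ℝ := (σg + σd) / (2 * σg + D)

/-- The exponent of the rate in the sparse regime, `b = 1 / p_g`, `c = 1 / p_d'`. -/
def sparseExponent (D : ℕ) (σg σd b c : ℝ) : ℝ :=
  (σg + σd - D * b + D * c) / (2 * σg + D - 2 * D * b)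

lemma rpow_half_le_upperRate (D : ℕ) (σg σd : ℝ) (pg pd' qd : ℝ≥0∞) {n : ℕ} (hn : 1 ≤ n) :
    (n : ℝ) ^ (-(1 / 2 : ℝ)) ≤ upperRate D σg σd pg pd' qd n := by
  have h0 : 0 ≤ Real.log n := Real.log_nonneg (by exact_mod_cast hn)
  have h1 : 0 ≤ boundaryFactor D σg σd pg pd' qd n := by
    unfold boundaryFactor
    split_ifs
    · positivity
    · exact zero_le_one
  unfold upperRate
  have : 0 ≤ √(Real.log n) * boundaryFactor D σg σd pg pd' qd n *
      ((n : ℝ) ^ (-((σg + σd) / (2 * σg + D))) +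
        (n : ℝ) ^ (-((σg + σd - D * pg⁻¹.toReal + D * pd'⁻¹.toReal) /
          (2 * σg + D - 2 * D * pg⁻¹.toReal)))) := by positivity
  linarith

lemma one_sub_inv_toReal_mem {q : ℝ≥0∞} (hq : 1 ≤ q) :
    0 ≤ 1 - q⁻¹.toReal ∧ 1 - q⁻¹.toReal ≤ 1 := by
  have h : q⁻¹.toReal ≤ 1 := by
    rw [← ENNReal.toReal_one]
    exact ENNReal.toReal_mono ENNReal.one_ne_top (ENNReal.inv_le_one.2 hq)
  constructor <;> linarith [ENNReal.toReal_nonneg (a := q⁻¹)]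

/-- The rates in which `levelCount` replaces the logarithms are dominated by `upperRate`. -/
lemma exists_sqrt_levelCount_mul_le {N : ℝ} (hN : 0 < N) (D : ℕ) (σg σd : ℝ) (pg pd' : ℝ≥0∞) :
    ∃ C : ℝ, 0 < C ∧ ∀ qd : ℝ≥0∞, 1 ≤ qd → ∀ n : ℕ, 1 ≤ n →
      √(levelCount N n) * ((n : ℝ) ^ (-denseExponent D σg σd) +
        (n : ℝ) ^ (-sparseExponent D σg σd pg⁻¹.toReal pd'⁻¹.toReal)) ≤
          C * upperRate D σg σd pg pd' qd n ∧
      (IsCritical D σg σd pg pd' →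
        √(levelCount N n) * levelCount N n ^ (1 - qd⁻¹.toReal) *
          (n : ℝ) ^ (-denseExponent D σg σd) ≤ C * upperRate D σg σd pg pd' qd n) := by
  obtain ⟨c, hc1, hc⟩ := levelCount_le_log hN
  have hl2 : 0 < Real.log 2 := Real.log_pos (by norm_num)
  have hl2' : Real.log 2 ≤ 1 := by
    have := Real.log_two_lt_d9
    linarith
  have hc0 : 0 < c := by linarith
  refine ⟨2 + √c * c / Real.log 2, by positivity, fun qd hqd n hn => ?_⟩
  obtain ⟨he0, he1⟩ := one_sub_inv_toReal_mem hqd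
  set e := 1 - qd⁻¹.toReal with he
  have hn0 : (0 : ℝ) < n := by exact_mod_cast hn
  -- For `n = 1` the logarithms vanish and only the parametric term, equal to `1`, is available; the
  -- summand `2` of the constant covers this case.
  rcases Nat.eq_or_lt_of_le hn with rfl | hn2
  · have hR := rpow_half_le_upperRate D σg σd pg pd' qd le_rfl
    simp only [Nat.cast_one, Real.one_rpow] at hR ⊢
    have hG : levelCount N 1 = 1 := by simp [levelCount]
    have hpos : 0 ≤ √c * c / Real.log 2 := by positivity
    rw [hG]
    simp only [Real.sqrt_one, Real.one_rpow]
    constructor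
    · nlinarith
    · intro _
      nlinarith
  · have hG := hc n hn2
    have hG1 := one_le_levelCount hN hn
    set G := levelCount N n with hGdef
    have hl : Real.log 2 ≤ Real.log n := Real.log_le_log (by norm_num) (by exact_mod_cast hn2)
    set Λ := Real.log n with hΛ
    have hΛ0 : 0 < Λ := hl2.trans_le hl
    have hsq : √G ≤ √c * √Λ := by
      rw [← Real.sqrt_mul hc0.le]
      exact Real.sqrt_le_sqrt hG
    -- At `n = 2` the logarithm is below `1`, so `Λ ^ e` may be too. Since `e ≤ 1` it is still at
    -- least `log 2`, which explains the division by `log 2` in the constant and its independence of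
    -- `qd`.
    have hΛe : Real.log 2 ≤ Λ ^ e := by
      rcases le_total 1 Λ with h | h
      · exact hl2'.trans (Real.one_le_rpow h he0)
      · exact hl.trans (by simpa using Real.rpow_le_rpow_of_exponent_ge hΛ0 h he1)
    have hbf : Real.log 2 ≤ boundaryFactor D σg σd pg pd' qd n := by
      unfold boundaryFactor
      split_ifs
      · exact hΛe
      · exact hl2'
    set bf := boundaryFactor D σg σd pg pd' qd n with hbfdef
    set r1 := (n : ℝ) ^ (-denseExponent D σg σd) with hr1
    set r2 := (n : ℝ) ^ (-sparseExponent D σg σd pg⁻¹.toReal pd'⁻¹.toReal) with hr2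
    have hr10 : 0 < r1 := by positivity
    have hr20 : 0 < r2 := by positivity
    have hR : √Λ * bf * (r1 + r2) ≤ upperRate D σg σd pg pd' qd n := by
      have : 0 ≤ (n : ℝ) ^ (-(1 / 2 : ℝ)) := by positivity
      unfold upperRate
      simp only [hΛ, hbfdef, hr1, hr2, denseExponent, sparseExponent]
      linarith
    have hR0 : 0 ≤ upperRate D σg σd pg pd' qd n :=
      le_trans (by have := hl2.le.trans hbf; positivity) hR
    have hbf0 : 0 < bf := hl2.trans_le hbf
    have key : ∀ y, 0 ≤ y → y ≤ √c * c / Real.log 2 * (√Λ * bf * (r1 + r2)) →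
        y ≤ (2 + √c * c / Real.log 2) * upperRate D σg σd pg pd' qd n := fun y hy h => by
      refine h.trans ?_
      have h1 : 0 ≤ √c * c / Real.log 2 := by positivity
      nlinarith [mul_le_mul_of_nonneg_left hR h1]
    constructor
    · refine key _ (by positivity) ?_
      calc √G * (r1 + r2) ≤ √c * √Λ * (r1 + r2) := by gcongr
        _ = √c * 1 / Real.log 2 * (√Λ * Real.log 2 * (r1 + r2)) := by field_simp
        _ ≤ √c * c / Real.log 2 * (√Λ * bf * (r1 + r2)) := by gcongr
    · intro hcr
      have hbe : bf = Λ ^ e := by rw [hbfdef, boundaryFactor, if_pos hcr]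
      refine key _ (by positivity) ?_
      have hGe : G ^ e ≤ c * bf := by
        rw [hbe]
        calc G ^ e ≤ (c * Λ) ^ e := by gcongr
          _ = c ^ e * Λ ^ e := Real.mul_rpow hc0.le hΛ0.le
          _ ≤ c * Λ ^ e := by
              gcongr
              simpa using Real.rpow_le_rpow_of_exponent_le hc1 he1
      calc √G * G ^ e * r1 ≤ √c * √Λ * (c * bf) * (r1 + r2) := by
            gcongr
            linarith
        _ = √c * c / 1 * (√Λ * bf * (r1 + r2)) := by ring
        _ ≤ √c * c / Real.log 2 * (√Λ * bf * (r1 + r2)) := by gcongr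

end Rates

/-! ### Contributions of the linear, thresholded and omitted levels to the rate. -/

section LevelSums

variable {D : ℕ} {σg σd : ℝ} {pg pd' : ℝ≥0∞}

lemma sum_mul_le_mul_sum {s : Finset ℕ} {ℓ x : ℕ → ℝ} {L y : ℝ} (hℓ : ∀ j, ℓ j ≤ L)
    (hx : ∀ j ∈ s, 0 ≤ x j) (hy : ∑ j ∈ s, x j ≤ y) (hL : 0 ≤ L) :
    ∑ j ∈ s, ℓ j * x j ≤ L * y := by
  calc ∑ j ∈ s, ℓ j * x j ≤ ∑ j ∈ s, L * x j :=
        Finset.sum_le_sum fun j hj => mul_le_mul_of_nonneg_right (hℓ j) (hx j hj)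
    _ ≤ L * y := by rw [← Finset.mul_sum]; gcongr

lemma sqrt_div_natCast {n : ℕ} {x : ℝ} (hx : 0 ≤ x) :
    √(x / n) = √x * (n : ℝ) ^ (-(1 / 2 : ℝ)) := by
  rw [Real.sqrt_div hx, Real.rpow_neg (Nat.cast_nonneg n), ← Real.sqrt_eq_rpow, div_eq_mul_inv]

/-- The sign of `u = D/2 - σd` decides. For `u < 0` the series converges, leaving `n^{-1/2}`; for `u
> 0` the top level, where `2^{j(2σg+D)}` is at most `n`, gives the dense rate. For `u = 0` no level
dominates, and the bound on `∑ ℓ j` must be used instead of `ℓ j ≤ L`. -/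
lemma exists_sum_linear_levels_le (hσ : (D : ℝ) * pg⁻¹.toReal < σg) (hD : 1 ≤ D) :
    ∃ C : ℝ, 0 < C ∧ ∀ qd : ℝ≥0∞, 1 ≤ qd → ∀ n : ℕ, 1 ≤ n → ∀ (s : Finset ℕ) (ℓ : ℕ → ℝ) (L : ℝ),
      (∀ j, 0 ≤ ℓ j) → (∀ j, ℓ j ≤ L) →
      ∑ j ∈ s, ℓ j ≤ L * (s.card : ℝ) ^ (1 - qd⁻¹.toReal) →
      (∀ j ∈ s, (2 : ℝ) ^ ((j : ℝ) * (2 * σg + D)) ≤ n) →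
      ∑ j ∈ s, ℓ j * (√(((j : ℝ) + 1) / n) * (2 : ℝ) ^ ((j : ℝ) * (D / 2 - σd))) ≤
        C * L * upperRate D σg σd pg pd' qd n := by
  have hD0 : (1 : ℝ) ≤ D := by exact_mod_cast hD
  have hb0 : 0 ≤ (D : ℝ) * pg⁻¹.toReal := by positivity
  set b := pg⁻¹.toReal with hb
  set N₁ : ℝ := 2 * σg + D with hN₁
  set N₂ : ℝ := 2 * σg + D - 2 * D * b with hN₂
  have hN₁0 : 0 < N₁ := by linarith
  have hN₂0 : 0 < N₂ := by linarith
  have hN₂₁ : N₂ ≤ N₁ := by linarith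
  obtain ⟨C, hC0, hC⟩ := exists_sqrt_levelCount_mul_le hN₂0 D σg σd pg pd'
  set u : ℝ := D / 2 - σd with hu
  -- Since `N₂ ≤ N₁`, the linear levels lie below `j₁` too, so `levelCount N₂` counts them as well.
  have hfacts : ∀ {n : ℕ}, 1 ≤ n → ∀ {s : Finset ℕ},
      (∀ j ∈ s, (2 : ℝ) ^ ((j : ℝ) * N₁) ≤ n) → ∀ j ∈ s, (2 : ℝ) ^ ((j : ℝ) * N₂) ≤ n :=
    fun hn s hs j hj => (Real.rpow_le_rpow_of_exponent_le (by norm_num) (by gcongr)).trans (hs j hj)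
  rcases lt_trichotomy u 0 with hu0 | hu0 | hu0
  · have hρ1 : (2 : ℝ) ^ u < 1 := Real.rpow_lt_one_of_one_lt_of_neg (by norm_num) hu0
    have hsum : Summable fun j : ℕ => ((j : ℝ) + 1) * ((2 : ℝ) ^ u) ^ j := by
      have hnorm : ‖(2 : ℝ) ^ u‖ < 1 := by rwa [Real.norm_of_nonneg (by positivity)]
      have h1 := summable_pow_mul_geometric_of_norm_lt_one 1 hnorm
      have h2 := summable_geometric_of_norm_lt_one hnorm
      refine (h1.add h2).congr fun j => ?_
      ring
    set K := ∑' j : ℕ, ((j : ℝ) + 1) * ((2 : ℝ) ^ u) ^ j with hK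
    have hK0 : 0 ≤ K := tsum_nonneg fun j => by positivity
    refine ⟨K + 1, by positivity, fun qd hqd n hn s ℓ L hℓ0 hℓ1 hℓs hs => ?_⟩
    have hL0 : 0 ≤ L := (hℓ0 0).trans (hℓ1 0)
    have h1 := rpow_half_le_upperRate D σg σd pg pd' qd hn
    have h3 : ∑ j ∈ s, (√(((j : ℝ) + 1) / n) * (2 : ℝ) ^ ((j : ℝ) * u)) ≤
        (n : ℝ) ^ (-(1 / 2 : ℝ)) * K := by
      calc ∑ j ∈ s, (√(((j : ℝ) + 1) / n) * (2 : ℝ) ^ ((j : ℝ) * u))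
          ≤ ∑ j ∈ s, (n : ℝ) ^ (-(1 / 2 : ℝ)) * (((j : ℝ) + 1) * ((2 : ℝ) ^ u) ^ j) := by
            refine Finset.sum_le_sum fun j _ => ?_
            rw [sqrt_div_natCast (by positivity), two_rpow_natCast_mul,
              mul_comm (√_) ((n : ℝ) ^ _), mul_assoc]
            have h4 : √((j : ℝ) + 1) ≤ (j : ℝ) + 1 := by
              rw [Real.sqrt_le_left (by positivity)]
              have : (0 : ℝ) ≤ j := Nat.cast_nonneg j
              nlinarith
            gcongr
        _ ≤ _ := by
            rw [← Finset.mul_sum]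
            gcongr
            exact hsum.sum_le_tsum _ fun j _ => by positivity
    refine (sum_mul_le_mul_sum hℓ1 (fun j _ => by positivity) h3 hL0).trans ?_
    have h5 : 0 ≤ (n : ℝ) ^ (-(1 / 2 : ℝ)) := by positivity
    calc L * ((n : ℝ) ^ (-(1 / 2 : ℝ)) * K) ≤ L * ((n : ℝ) ^ (-(1 / 2 : ℝ)) * (K + 1)) := by
          gcongr
          linarith
      _ = (K + 1) * L * (n : ℝ) ^ (-(1 / 2 : ℝ)) := by ring
      _ ≤ _ := by gcongr
  · refine ⟨C, hC0, fun qd hqd n hn s ℓ L hℓ0 hℓ1 hℓs hs => ?_⟩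
    have hL0 : 0 ≤ L := (hℓ0 0).trans (hℓ1 0)
    have hs2 := hfacts hn hs
    have h1 := (hC qd hqd n hn).2 (Or.inl (by linarith))
    have hdense : denseExponent D σg σd = 1 / 2 := by
      rw [denseExponent, ← hN₁, div_eq_iff hN₁0.ne']
      linarith
    obtain ⟨he0, -⟩ := one_sub_inv_toReal_mem hqd
    calc ∑ j ∈ s, ℓ j * (√(((j : ℝ) + 1) / n) * (2 : ℝ) ^ ((j : ℝ) * u))
        ≤ ∑ j ∈ s, ℓ j * (√(levelCount N₂ n) * (n : ℝ) ^ (-(1 / 2 : ℝ))) := by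
          refine Finset.sum_le_sum fun j hj => mul_le_mul_of_nonneg_left ?_ (hℓ0 j)
          rw [sqrt_div_natCast (by positivity), hu0, mul_zero, Real.rpow_zero, mul_one]
          gcongr
          exact add_one_le_levelCount hN₂0 hn (hs2 j hj)
      _ = (∑ j ∈ s, ℓ j) * (√(levelCount N₂ n) * (n : ℝ) ^ (-(1 / 2 : ℝ))) := by
          rw [Finset.sum_mul]
      _ ≤ (L * levelCount N₂ n ^ (1 - qd⁻¹.toReal)) *
            (√(levelCount N₂ n) * (n : ℝ) ^ (-(1 / 2 : ℝ))) := by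
          refine mul_le_mul_of_nonneg_right (hℓs.trans ?_) (by positivity)
          gcongr
          exact card_le_levelCount hN₂0 hn hs2
      _ = L * (√(levelCount N₂ n) * levelCount N₂ n ^ (1 - qd⁻¹.toReal) *
            (n : ℝ) ^ (-denseExponent D σg σd)) := by rw [hdense]; ring
      _ ≤ L * (C * upperRate D σg σd pg pd' qd n) := by gcongr
      _ = _ := by ring
  · have hρ1 : 1 < (2 : ℝ) ^ u := Real.one_lt_rpow (by norm_num) hu0
    set K := (2 : ℝ) ^ u / ((2 : ℝ) ^ u - 1) with hK
    have hK0 : 0 < K := div_pos (by positivity) (by linarith)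
    refine ⟨K * C, by positivity, fun qd hqd n hn s ℓ L hℓ0 hℓ1 hℓs hs => ?_⟩
    have hn0 : (0 : ℝ) < n := by exact_mod_cast hn
    have hL0 : 0 ≤ L := (hℓ0 0).trans (hℓ1 0)
    have hs2 := hfacts hn hs
    have h1 := (hC qd hqd n hn).1
    have h3 : ∑ j ∈ s, (√(((j : ℝ) + 1) / n) * (2 : ℝ) ^ ((j : ℝ) * u)) ≤
        √(levelCount N₂ n) * (n : ℝ) ^ (-(1 / 2 : ℝ)) * ((n : ℝ) ^ (u / N₁) * K) := by
      calc ∑ j ∈ s, (√(((j : ℝ) + 1) / n) * (2 : ℝ) ^ ((j : ℝ) * u))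
          ≤ ∑ j ∈ s, √(levelCount N₂ n) * (n : ℝ) ^ (-(1 / 2 : ℝ)) * ((2 : ℝ) ^ u) ^ j := by
            refine Finset.sum_le_sum fun j hj => ?_
            rw [sqrt_div_natCast (by positivity), two_rpow_natCast_mul]
            gcongr
            exact add_one_le_levelCount hN₂0 hn (hs2 j hj)
        _ ≤ _ := by
            rw [← Finset.mul_sum]
            gcongr
            refine sum_pow_le_of_one_lt hρ1 s (by positivity) fun j hj => ?_
            rw [← two_rpow_natCast_mul, two_rpow_mul_eq j hN₁0.ne']
            exact Real.rpow_le_rpow (by positivity) (hs j hj) (by positivity)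
    refine (sum_mul_le_mul_sum hℓ1 (fun j _ => by positivity) h3 hL0).trans ?_
    have hexp : (n : ℝ) ^ (-(1 / 2 : ℝ)) * (n : ℝ) ^ (u / N₁) =
        (n : ℝ) ^ (-denseExponent D σg σd) := by
      rw [← Real.rpow_add hn0, denseExponent, ← hN₁]
      congr 1
      rw [hu]
      field_simp
      rw [hN₁]
      ring
    have h6 : 0 ≤ (n : ℝ) ^ (-sparseExponent D σg σd b pd'⁻¹.toReal) := by positivity
    calc L * (√(levelCount N₂ n) * (n : ℝ) ^ (-(1 / 2 : ℝ)) * ((n : ℝ) ^ (u / N₁) * K))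
        = K * L * (√(levelCount N₂ n) *
            ((n : ℝ) ^ (-(1 / 2 : ℝ)) * (n : ℝ) ^ (u / N₁))) := by ring
      _ ≤ K * L * (√(levelCount N₂ n) * ((n : ℝ) ^ (-denseExponent D σg σd) +
            (n : ℝ) ^ (-sparseExponent D σg σd b pd'⁻¹.toReal))) := by
          rw [hexp]
          gcongr
          linarith
      _ ≤ K * L * (C * upperRate D σg σd pg pd' qd n) := by gcongr
      _ = _ := by ring

/-- With `θ = pg / pd'`, interpolation puts the power `1 - θ` on the threshold and `θ` on the
`ℓ^{pg}` norm of the density coefficients. The remaining growth `2^{ju}` makes the first thresholded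
level (dense rate) dominate for `u < 0` and the last one (sparse rate) for `u > 0`; `u = 0` is the
boundary between them. -/
lemma exists_sum_threshold_levels_le (hσ : (D : ℝ) * pg⁻¹.toReal < σg) (hD : 1 ≤ D)
    (hb0 : 0 < pg⁻¹.toReal) (hcb : pd'⁻¹.toReal ≤ pg⁻¹.toReal) :
    ∃ C : ℝ, 0 < C ∧ ∀ qd : ℝ≥0∞, 1 ≤ qd → ∀ n : ℕ, 1 ≤ n → ∀ (s : Finset ℕ) (ℓ : ℕ → ℝ) (L : ℝ),
      (∀ j, 0 ≤ ℓ j) → (∀ j, ℓ j ≤ L) →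
      ∑ j ∈ s, ℓ j ≤ L * (s.card : ℝ) ^ (1 - qd⁻¹.toReal) →
      (∀ j ∈ s, (n : ℝ) < (2 : ℝ) ^ ((j : ℝ) * (2 * σg + D))) →
      (∀ j ∈ s, (2 : ℝ) ^ ((j : ℝ) * (2 * σg + D - 2 * D * pg⁻¹.toReal)) ≤ n) →
      ∑ j ∈ s, ℓ j * (((j : ℝ) / n) ^ ((1 - pd'⁻¹.toReal / pg⁻¹.toReal) / 2) *
        (2 : ℝ) ^ ((j : ℝ) * (D / 2 - σd - (σg + D / 2) * (pd'⁻¹.toReal / pg⁻¹.toReal)))) ≤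
        C * L * upperRate D σg σd pg pd' qd n := by
  have hD0 : (1 : ℝ) ≤ D := by exact_mod_cast hD
  have hDb0 : 0 ≤ (D : ℝ) * pg⁻¹.toReal := by positivity
  have hc0 : 0 ≤ pd'⁻¹.toReal := ENNReal.toReal_nonneg
  set b := pg⁻¹.toReal with hb
  set c := pd'⁻¹.toReal with hc
  set N₁ : ℝ := 2 * σg + D with hN₁
  set N₂ : ℝ := 2 * σg + D - 2 * D * b with hN₂
  have hN₁0 : 0 < N₁ := by linarith
  have hN₂0 : 0 < N₂ := by linarith
  obtain ⟨C, hC0, hC⟩ := exists_sqrt_levelCount_mul_le hN₂0 D σg σd pg pd'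
  set h : ℝ := (1 - c / b) / 2 with hh
  have hθ1 : c / b ≤ 1 := by rwa [div_le_one hb0]
  have hθ0 : 0 ≤ c / b := by positivity
  have hh0 : 0 ≤ h := by rw [hh]; linarith
  have hh1 : h ≤ 1 / 2 := by rw [hh]; linarith
  set u : ℝ := D / 2 - σd - (σg + D / 2) * (c / b) with hu
  have hub : u * b = (D / 2 - σd) * b - (σg + D / 2) * c := by
    rw [hu]
    field_simp
  -- Replacing `2^j` by `n^{1/N₁}` or by `n^{1/N₂}` in `n^{-h} 2^{ju}` produces exactly the dense
  -- and the sparse exponent.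
  have hdense : u / N₁ - h = -denseExponent D σg σd := by
    rw [denseExponent, ← hN₁, hu, hh]
    field_simp
    rw [hN₁]
    ring
  have hsparse : u / N₂ - h = -sparseExponent D σg σd b c := by
    rw [sparseExponent, ← hN₂, hu, hh]
    field_simp
    rw [hN₂]
    ring
  have hfac : ∀ n : ℕ, 1 ≤ n → ∀ s : Finset ℕ, (∀ j ∈ s, (2 : ℝ) ^ ((j : ℝ) * N₂) ≤ n) →
      ∀ j ∈ s, ((j : ℝ) / n) ^ h ≤ √(levelCount N₂ n) * (n : ℝ) ^ (-h) := fun n hn s hs j hj => by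
    have hn0 : (0 : ℝ) < n := by exact_mod_cast hn
    have hG := one_le_levelCount hN₂0 hn
    rw [Real.div_rpow (by positivity) hn0.le, Real.rpow_neg hn0.le, div_eq_mul_inv]
    gcongr
    calc (j : ℝ) ^ h ≤ levelCount N₂ n ^ h := by
          gcongr
          linarith [add_one_le_levelCount hN₂0 hn (hs j hj)]
      _ ≤ levelCount N₂ n ^ (1 / 2 : ℝ) := Real.rpow_le_rpow_of_exponent_le hG hh1
      _ = √(levelCount N₂ n) := (Real.sqrt_eq_rpow _).symm
  -- Common part of the two geometric cases; `N` is the denominator of the dominating end of the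
  -- range.
  have hgeom : ∀ K : ℝ, 0 < K → ∀ N, (∀ n : ℕ, 1 ≤ n → ∀ s : Finset ℕ,
      (∀ j ∈ s, (n : ℝ) < (2 : ℝ) ^ ((j : ℝ) * N₁)) →
      (∀ j ∈ s, (2 : ℝ) ^ ((j : ℝ) * N₂) ≤ n) →
      ∑ j ∈ s, ((2 : ℝ) ^ u) ^ j ≤ (n : ℝ) ^ (u / N) * K) →
      (u / N - h = -denseExponent D σg σd ∨ u / N - h = -sparseExponent D σg σd b c) →
      ∃ C : ℝ, 0 < C ∧ ∀ qd : ℝ≥0∞, 1 ≤ qd → ∀ n : ℕ, 1 ≤ n →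
      ∀ (s : Finset ℕ) (ℓ : ℕ → ℝ) (L : ℝ), (∀ j, 0 ≤ ℓ j) → (∀ j, ℓ j ≤ L) →
      ∑ j ∈ s, ℓ j ≤ L * (s.card : ℝ) ^ (1 - qd⁻¹.toReal) →
      (∀ j ∈ s, (n : ℝ) < (2 : ℝ) ^ ((j : ℝ) * N₁)) →
      (∀ j ∈ s, (2 : ℝ) ^ ((j : ℝ) * N₂) ≤ n) →
      ∑ j ∈ s, ℓ j * (((j : ℝ) / n) ^ h * (2 : ℝ) ^ ((j : ℝ) * u)) ≤
        C * L * upperRate D σg σd pg pd' qd n := by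
    intro K hK0 N hN hexp
    refine ⟨K * C, by positivity, fun qd hqd n hn s ℓ L hℓ0 hℓ1 hℓs hs1 hs2 => ?_⟩
    have hn0 : (0 : ℝ) < n := by exact_mod_cast hn
    have hL0 : 0 ≤ L := (hℓ0 0).trans (hℓ1 0)
    have h1 := (hC qd hqd n hn).1
    have h3 : ∑ j ∈ s, (((j : ℝ) / n) ^ h * (2 : ℝ) ^ ((j : ℝ) * u)) ≤
        √(levelCount N₂ n) * (n : ℝ) ^ (-h) * ((n : ℝ) ^ (u / N) * K) := by
      calc ∑ j ∈ s, (((j : ℝ) / n) ^ h * (2 : ℝ) ^ ((j : ℝ) * u))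
          ≤ ∑ j ∈ s, √(levelCount N₂ n) * (n : ℝ) ^ (-h) * ((2 : ℝ) ^ u) ^ j := by
            refine Finset.sum_le_sum fun j hj => ?_
            rw [two_rpow_natCast_mul]
            gcongr
            exact hfac n hn s hs2 j hj
        _ ≤ _ := by
            rw [← Finset.mul_sum]
            gcongr
            exact hN n hn s hs1 hs2
    refine (sum_mul_le_mul_sum hℓ1 (fun j _ => by positivity) h3 hL0).trans ?_
    have h7 : (n : ℝ) ^ (u / N - h) ≤ (n : ℝ) ^ (-denseExponent D σg σd) +
        (n : ℝ) ^ (-sparseExponent D σg σd b c) := by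
      have h5 : 0 ≤ (n : ℝ) ^ (-denseExponent D σg σd) := by positivity
      have h6 : 0 ≤ (n : ℝ) ^ (-sparseExponent D σg σd b c) := by positivity
      rcases hexp with h | h <;> rw [h] <;> linarith
    calc L * (√(levelCount N₂ n) * (n : ℝ) ^ (-h) * ((n : ℝ) ^ (u / N) * K))
        = K * L * (√(levelCount N₂ n) * ((n : ℝ) ^ (u / N) * (n : ℝ) ^ (-h))) := by ring
      _ = K * L * (√(levelCount N₂ n) * (n : ℝ) ^ (u / N - h)) := by
          rw [← Real.rpow_add hn0, sub_eq_add_neg]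
      _ ≤ K * L * (√(levelCount N₂ n) * ((n : ℝ) ^ (-denseExponent D σg σd) +
            (n : ℝ) ^ (-sparseExponent D σg σd b c))) := by gcongr
      _ ≤ K * L * (C * upperRate D σg σd pg pd' qd n) := by gcongr
      _ = _ := by ring
  rcases lt_trichotomy u 0 with hu0 | hu0 | hu0
  · have hρ1 : (2 : ℝ) ^ u < 1 := Real.rpow_lt_one_of_one_lt_of_neg (by norm_num) hu0
    refine hgeom (1 - (2 : ℝ) ^ u)⁻¹ (inv_pos.2 (by linarith)) N₁ (fun n hn s hs1 hs2 => ?_)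
      (Or.inl hdense)
    refine sum_pow_le_of_lt_one (by positivity) hρ1 s (by positivity) fun j hj => ?_
    rw [← two_rpow_natCast_mul, two_rpow_mul_eq j hN₁0.ne']
    exact Real.rpow_le_rpow_of_nonpos (by exact_mod_cast hn) (hs1 j hj).le
      (div_nonpos_of_nonpos_of_nonneg hu0.le hN₁0.le)
  · refine ⟨C, hC0, fun qd hqd n hn s ℓ L hℓ0 hℓ1 hℓs hs1 hs2 => ?_⟩
    have hL0 : 0 ≤ L := (hℓ0 0).trans (hℓ1 0)
    have h1 := (hC qd hqd n hn).2 (Or.inr (by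
      rw [hu0, zero_mul] at hub
      change (2 * σg + D) * c = (D - 2 * σd) * b
      linarith))
    rw [hu0, zero_div, zero_sub, neg_inj] at hdense
    obtain ⟨he0, -⟩ := one_sub_inv_toReal_mem hqd
    calc ∑ j ∈ s, ℓ j * (((j : ℝ) / n) ^ h * (2 : ℝ) ^ ((j : ℝ) * u))
        ≤ ∑ j ∈ s, ℓ j * (√(levelCount N₂ n) * (n : ℝ) ^ (-h)) := by
          refine Finset.sum_le_sum fun j hj => mul_le_mul_of_nonneg_left ?_ (hℓ0 j)
          rw [hu0, mul_zero, Real.rpow_zero, mul_one]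
          exact hfac n hn s hs2 j hj
      _ = (∑ j ∈ s, ℓ j) * (√(levelCount N₂ n) * (n : ℝ) ^ (-h)) := by
          rw [Finset.sum_mul]
      _ ≤ (L * levelCount N₂ n ^ (1 - qd⁻¹.toReal)) *
            (√(levelCount N₂ n) * (n : ℝ) ^ (-h)) := by
          refine mul_le_mul_of_nonneg_right (hℓs.trans ?_) (by positivity)
          gcongr
          exact card_le_levelCount hN₂0 hn hs2
      _ = L * (√(levelCount N₂ n) * levelCount N₂ n ^ (1 - qd⁻¹.toReal) *
            (n : ℝ) ^ (-denseExponent D σg σd)) := by rw [hdense]; ring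
      _ ≤ L * (C * upperRate D σg σd pg pd' qd n) := by gcongr
      _ = _ := by ring
  · have hρ1 : 1 < (2 : ℝ) ^ u := Real.one_lt_rpow (by norm_num) hu0
    refine hgeom ((2 : ℝ) ^ u / ((2 : ℝ) ^ u - 1)) (div_pos (by positivity) (by linarith)) N₂
      (fun n hn s hs1 hs2 => ?_) (Or.inr hsparse)
    refine sum_pow_le_of_one_lt hρ1 s (by positivity) fun j hj => ?_
    rw [← two_rpow_natCast_mul, two_rpow_mul_eq j hN₂0.ne']
    exact Real.rpow_le_rpow (by positivity) (hs2 j hj) (by positivity)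

/-- The bias decays geometrically because `σg > D / pg`, so the first omitted level dominates; there
`2^{jN₂} > n` yields the sparse exponent. -/
lemma exists_sum_bias_levels_le (hσ : (D : ℝ) * pg⁻¹.toReal < σg) (hD : 1 ≤ D) (hσd : 0 ≤ σd) :
    ∃ C : ℝ, 0 < C ∧ ∀ qd : ℝ≥0∞, 1 ≤ qd → ∀ n : ℕ, 1 ≤ n → ∀ s : Finset ℕ,
      (∀ j ∈ s, (n : ℝ) < (2 : ℝ) ^ ((j : ℝ) * (2 * σg + D - 2 * D * pg⁻¹.toReal))) →
      ∑ j ∈ s, (2 : ℝ) ^ (-((j : ℝ) * (σg + σd - D * pg⁻¹.toReal + D * pd'⁻¹.toReal))) ≤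
        C * upperRate D σg σd pg pd' qd n := by
  have hD0 : (1 : ℝ) ≤ D := by exact_mod_cast hD
  have hc0 : 0 ≤ (D : ℝ) * pd'⁻¹.toReal := by positivity
  have hb0 : 0 ≤ (D : ℝ) * pg⁻¹.toReal := by positivity
  set b := pg⁻¹.toReal with hb
  set c := pd'⁻¹.toReal with hc
  set N₂ : ℝ := 2 * σg + D - 2 * D * b with hN₂
  have hN₂0 : 0 < N₂ := by linarith
  obtain ⟨C, hC0, hC⟩ := exists_sqrt_levelCount_mul_le hN₂0 D σg σd pg pd'
  set η : ℝ := σg + σd - D * b + D * c with hη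
  have hη0 : 0 < η := by linarith
  have hρ1 : (2 : ℝ) ^ (-η) < 1 := two_rpow_neg_lt_one hη0
  have hK0 : 0 < (1 - (2 : ℝ) ^ (-η))⁻¹ := inv_pos.2 (by linarith)
  refine ⟨C * (1 - (2 : ℝ) ^ (-η))⁻¹, by positivity, fun qd hqd n hn s hs => ?_⟩
  have hn0 : (0 : ℝ) < n := by exact_mod_cast hn
  have h1 := (hC qd hqd n hn).1
  have hG : 1 ≤ √(levelCount N₂ n) := Real.one_le_sqrt.2 (one_le_levelCount hN₂0 hn)
  have h2 : ∑ j ∈ s, (2 : ℝ) ^ (-((j : ℝ) * η)) ≤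
      (n : ℝ) ^ (-sparseExponent D σg σd b c) * (1 - (2 : ℝ) ^ (-η))⁻¹ := by
    simp_rw [← mul_neg, two_rpow_natCast_mul]
    refine sum_pow_le_of_lt_one (by positivity) hρ1 s (by positivity) fun j hj => ?_
    rw [← two_rpow_natCast_mul, two_rpow_mul_eq j hN₂0.ne', sparseExponent, ← hη, ← hN₂, neg_div]
    exact Real.rpow_le_rpow_of_nonpos hn0 (hs j hj).le
      (neg_nonpos.2 (div_nonneg hη0.le hN₂0.le))
  refine h2.trans ?_
  have h5 : 0 ≤ (n : ℝ) ^ (-denseExponent D σg σd) := by positivity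
  have h6 : 0 ≤ (n : ℝ) ^ (-sparseExponent D σg σd b c) := by positivity
  have h3 : (n : ℝ) ^ (-sparseExponent D σg σd b c) ≤ C * upperRate D σg σd pg pd' qd n := by
    refine le_trans ?_ h1
    nlinarith
  calc _ ≤ C * upperRate D σg σd pg pd' qd n * (1 - (2 : ℝ) ^ (-η))⁻¹ := by gcongr
    _ = _ := by ring

end LevelSums

/-! ### Pairing functions of a Besov ball with errors of wavelet coefficients -/

/-- The case `b = 1` of the interpolated Hölder inequality: errors known only to be uniformly small,
paid for by the number of wavelets. -/
lemma sum_abs_mul_le_card {ι : Type} {p : ℝ≥0∞} (hp : 1 ≤ p) {a e : ι → ℝ} {M t : ℝ}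
    (hM : 0 ≤ M) (h : seqNorm p (fun i => ‖a i‖ₑ) ≤ ENNReal.ofReal M) (s : Finset ι)
    (he0 : ∀ i ∈ s, 0 ≤ e i) (het : ∀ i ∈ s, e i ≤ t) (ht : 0 ≤ t) :
    ∑ i ∈ s, |a i| * e i ≤ M * (t * (s.card : ℝ) ^ (1 - p⁻¹.toReal)) := by
  obtain ⟨hα0, hα1⟩ := one_sub_inv_toReal_mem hp
  have h1 := sum_abs_mul_le_of_seqNorm_le hp hM h one_pos le_rfl hα1 s he0 het ht
    (N := t * s.card) (by positivity) (by
      simp only [inv_one, Real.rpow_one]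
      calc ∑ i ∈ s, e i ≤ ∑ _i ∈ s, t := Finset.sum_le_sum het
        _ = t * s.card := by rw [Finset.sum_const, nsmul_eq_mul, mul_comm])
  refine h1.trans (le_of_eq ?_)
  rw [div_one, Real.mul_rpow ht (Nat.cast_nonneg _), ← mul_assoc (t ^ _),
    ← Real.rpow_add_of_nonneg ht (by linarith) hα0, sub_add_cancel, Real.rpow_one]

/-- The number of wavelets of the level `j` that meet `[-T, T]^D` is at most this constant times
`2^{jD}`. -/
def boxConst (D : ℕ) (T A : ℝ) : ℝ := (2 ^ D + 1) * (2 * (T + A) + 1) ^ D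

lemma one_le_boxConst (D : ℕ) {T A : ℝ} (hT : 0 ≤ T) (hA : 0 ≤ A) : 1 ≤ boxConst D T A := by
  have h1 : (1 : ℝ) ≤ 2 ^ D + 1 := by linarith [pow_pos (two_pos : (0 : ℝ) < 2) D]
  have h2 : (1 : ℝ) ≤ (2 * (T + A) + 1) ^ D := one_le_pow₀ (by linarith)
  exact one_le_mul_of_one_le_of_one_le h1 h2

lemma card_levelBox_le_boxConst (D : ℕ) {T A : ℝ} (hT : 0 ≤ T) (hA : 0 ≤ A) (j : ℕ) :
    ((levelBox D (2 ^ j * T + A)).card : ℝ) ≤ boxConst D T A * (2 : ℝ) ^ ((j : ℝ) * D) := by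
  refine (card_levelBox_le D (by positivity)).trans ?_
  rw [boxConst, mul_assoc]
  gcongr
  rw [two_rpow_natCast_mul, Real.rpow_natCast, ← pow_mul, mul_comm D j, pow_mul, ← mul_pow]
  gcongr
  have h2 : (1 : ℝ) ≤ 2 ^ j := one_le_pow₀ (by norm_num)
  nlinarith

lemma card_motherBox_le (D : ℕ) {T A : ℝ} (hT : 0 ≤ T) (hA : 0 ≤ A) (j : ℕ) :
    ((motherBox D T A j).card : ℝ) ≤ boxConst D T A * (2 : ℝ) ^ ((j : ℝ) * D) := by
  refine le_trans ?_ (card_levelBox_le_boxConst D hT hA j)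
  rw [levelBox, Finset.card_disjSum, motherBox]
  push_cast
  linarith [Nat.cast_nonneg (α := ℝ) (latticeBox D (2 ^ j * T + A)).card]

lemma card_latticeBox_le_boxConst (D : ℕ) {T A : ℝ} (hT : 0 ≤ T) (hA : 0 ≤ A) :
    ((latticeBox D (T + A)).card : ℝ) ≤ boxConst D T A := by
  have h := card_levelBox_le_boxConst D hT hA 0
  rw [levelBox, Finset.card_disjSum] at h
  simp only [pow_zero, one_mul, Nat.cast_zero, zero_mul, Real.rpow_zero, mul_one] at h
  push_cast at h
  have h2 : (0 : ℝ) ≤ ((Finset.univ : Finset (MotherIndex D)) ×ˢ latticeBox D (T + A)).card :=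
    Nat.cast_nonneg _
  linarith

section Pairing

variable {D : ℕ} {A T σd Ld : ℝ} {pd qd : ℝ≥0∞} {φ f : Space D → ℝ}
  {ψ : MotherIndex D → Space D → ℝ}

/-- As `boxConst` is at least `1` and the exponent at most `1`, the constant can be pulled out
without depending on the exponent. -/
lemma boxConst_rpow_le (hT : 0 ≤ T) (hA : 0 ≤ A) {x y : ℝ} (hx0 : 0 ≤ x) (hx1 : x ≤ 1)
    (hy0 : 0 ≤ y) {m : ℝ} (hm0 : 0 ≤ m) (hm : m ≤ boxConst D T A * y) :
    m ^ x ≤ boxConst D T A * y ^ x := by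
  have h1 := one_le_boxConst D hT hA
  calc m ^ x ≤ (boxConst D T A * y) ^ x := by gcongr
    _ = boxConst D T A ^ x * y ^ x := Real.mul_rpow (by linarith) hy0
    _ ≤ boxConst D T A * y ^ x := by
        gcongr
        simpa using Real.rpow_le_rpow_of_exponent_le h1 hx1

lemma sum_abs_fatherCoeff_mul_le (hT : 0 ≤ T) (hA : 0 ≤ A) (hpd : 1 ≤ pd) (hLd : 0 ≤ Ld)
    (hf : f ∈ besovBall φ ψ σd pd qd Ld) {e : (Fin D → ℤ) → ℝ} {t : ℝ} (ht : 0 ≤ t)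
    (he0 : ∀ k ∈ latticeBox D (T + A), 0 ≤ e k) (het : ∀ k ∈ latticeBox D (T + A), e k ≤ t) :
    ∑ k ∈ latticeBox D (T + A), |fatherCoeff φ f k| * e k ≤ boxConst D T A * Ld * t := by
  obtain ⟨hα0, hα1⟩ := one_sub_inv_toReal_mem hpd
  refine (sum_abs_mul_le_card hpd hLd (seqNorm_fatherCoeff_le hf) _ he0 het ht).trans ?_
  have h := boxConst_rpow_le (D := D) hT hA hα0 hα1 zero_le_one (Nat.cast_nonneg _)
    (by simpa using card_latticeBox_le_boxConst D hT hA)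
  rw [Real.one_rpow, mul_one] at h
  calc _ ≤ Ld * (t * boxConst D T A) := by gcongr
    _ = _ := by ring

/-- The cardinality contributes `2^{jD(1 - 1/pd)}`, which cancels the `pd` in the Besov weight and
leaves `2^{j(D/2 - σd)}`. -/
lemma sum_abs_motherCoeff_mul_le (hT : 0 ≤ T) (hA : 0 ≤ A) (hpd : 1 ≤ pd) (hqd : 1 ≤ qd)
    (hf : f ∈ besovBall φ ψ σd pd qd Ld) (j : ℕ)
    {e : MotherIndex D × (Fin D → ℤ) → ℝ} {t : ℝ} (ht : 0 ≤ t)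
    (he0 : ∀ l ∈ motherBox D T A j, 0 ≤ e l) (het : ∀ l ∈ motherBox D T A j, e l ≤ t) :
    ∑ l ∈ motherBox D T A j, |motherCoeff ψ f j l| * e l ≤
      boxConst D T A * (levelNorm ψ σd pd f j * (t * (2 : ℝ) ^ ((j : ℝ) * (D / 2 - σd)))) := by
  obtain ⟨hα0, hα1⟩ := one_sub_inv_toReal_mem hpd
  have hℓ := levelNorm_nonneg (ψ := ψ) (σ := σd) (p := pd) (f := f) j
  refine (sum_abs_mul_le_card hpd (by positivity) (seqNorm_level_eq hqd hf j).le _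
    he0 het ht).trans ?_
  have h := boxConst_rpow_le (D := D) hT hA hα0 hα1 (by positivity) (Nat.cast_nonneg _)
    (card_motherBox_le D hT hA j)
  rw [← Real.rpow_mul (by norm_num)] at h
  calc _ ≤ (2 : ℝ) ^ (-((j : ℝ) * (σd + D * (1 / 2 - pd⁻¹.toReal)))) * levelNorm ψ σd pd f j *
        (t * (boxConst D T A * (2 : ℝ) ^ ((j : ℝ) * D * (1 - pd⁻¹.toReal)))) := by gcongr
    _ = boxConst D T A * (levelNorm ψ σd pd f j * (t *
        ((2 : ℝ) ^ (-((j : ℝ) * (σd + D * (1 / 2 - pd⁻¹.toReal)))) *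
          (2 : ℝ) ^ ((j : ℝ) * D * (1 - pd⁻¹.toReal))))) := by ring
    _ = _ := by
        rw [← Real.rpow_add (by norm_num)]
        congr 4
        ring

variable {σg Lg : ℝ} {pg qg : ℝ≥0∞} {p : Space D → ℝ}

/-- Errors dominated by the coefficients of `p` inherit their `ℓ^{pg}` bound, so Hölder applies with
`b = 1 / pg`. No cardinality enters, which is the gain from sparsity. -/
lemma sum_abs_motherCoeff_mul_sparse_le (hpd : 1 ≤ pd) (hqd : 1 ≤ qd) (hpg : 1 ≤ pg)
    (hpg' : pg ≠ ∞) (hqg : 1 ≤ qg) (hLg : 0 ≤ Lg) (hpp : 1 - pd⁻¹.toReal ≤ pg⁻¹.toReal)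
    (hf : f ∈ besovBall φ ψ σd pd qd Ld) (hp : p ∈ besovBall φ ψ σg pg qg Lg) (j : ℕ)
    (s : Finset (MotherIndex D × (Fin D → ℤ)))
    {e : MotherIndex D × (Fin D → ℤ) → ℝ} {t : ℝ} (ht : 0 ≤ t)
    (he0 : ∀ l ∈ s, 0 ≤ e l) (het : ∀ l ∈ s, e l ≤ t)
    (hep : ∀ l ∈ s, e l ≤ |motherCoeff ψ p j l|) :
    ∑ l ∈ s, |motherCoeff ψ f j l| * e l ≤
      (2 : ℝ) ^ (-((j : ℝ) * (σd + D * (1 / 2 - pd⁻¹.toReal)))) * levelNorm ψ σd pd f j *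
        (t ^ (1 - (1 - pd⁻¹.toReal) / pg⁻¹.toReal) *
          ((2 : ℝ) ^ (-((j : ℝ) * (σg + D * (1 / 2 - pg⁻¹.toReal)))) * Lg) ^
            ((1 - pd⁻¹.toReal) / pg⁻¹.toReal)) := by
  have hb0 : 0 < pg⁻¹.toReal :=
    ENNReal.toReal_pos (ENNReal.inv_ne_zero.2 hpg') (ENNReal.inv_ne_top.2 (one_pos.trans_le hpg).ne')
  have hb1 : pg⁻¹.toReal ≤ 1 := by linarith [(one_sub_inv_toReal_mem hpg).1]
  have hℓ := levelNorm_nonneg (ψ := ψ) (σ := σd) (p := pd) (f := f) j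
  refine sum_abs_mul_le_of_seqNorm_le hpd (by positivity) (seqNorm_level_eq hqd hf j).le hb0 hb1
    hpp s he0 het ht (by positivity) ?_
  rw [ENNReal.toReal_inv, inv_inv]
  have h1 := sum_rpow_le_of_seqNorm_le hpg hpg' (by positivity) (seqNorm_level_le hqg hLg hp j) s
  rw [ENNReal.toReal_inv] at h1
  refine le_trans (Finset.sum_le_sum fun l hl => ?_) h1
  exact Real.rpow_le_rpow (he0 l hl) (hep l hl) ENNReal.toReal_nonneg

lemma sum_abs_motherCoeff_mul_threshold_le (hpd : 1 ≤ pd) (hqd : 1 ≤ qd) (hpg : 1 ≤ pg)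
    (hpg' : pg ≠ ∞) (hqg : 1 ≤ qg) (hLg : 0 ≤ Lg) (hpp : 1 - pd⁻¹.toReal ≤ pg⁻¹.toReal)
    (hf : f ∈ besovBall φ ψ σd pd qd Ld) (hp : p ∈ besovBall φ ψ σg pg qg Lg) (j n : ℕ)
    (s : Finset (MotherIndex D × (Fin D → ℤ)))
    {e : MotherIndex D × (Fin D → ℤ) → ℝ} {τ : ℝ} (hτ : 0 ≤ τ)
    (he0 : ∀ l ∈ s, 0 ≤ e l) (het : ∀ l ∈ s, e l ≤ τ * √((j : ℝ) / n))
    (hep : ∀ l ∈ s, e l ≤ |motherCoeff ψ p j l|) :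
    ∑ l ∈ s, |motherCoeff ψ f j l| * e l ≤
      τ ^ (1 - (1 - pd⁻¹.toReal) / pg⁻¹.toReal) * Lg ^ ((1 - pd⁻¹.toReal) / pg⁻¹.toReal) *
        (levelNorm ψ σd pd f j *
          (((j : ℝ) / n) ^ ((1 - (1 - pd⁻¹.toReal) / pg⁻¹.toReal) / 2) *
        (2 : ℝ) ^ ((j : ℝ) *
          (D / 2 - σd - (σg + D / 2) * ((1 - pd⁻¹.toReal) / pg⁻¹.toReal))))) := by
  have hb0 : pg⁻¹.toReal ≠ 0 := (ENNReal.toReal_pos (ENNReal.inv_ne_zero.2 hpg')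
    (ENNReal.inv_ne_top.2 (one_pos.trans_le hpg).ne')).ne'
  refine (sum_abs_motherCoeff_mul_sparse_le hpd hqd hpg hpg' hqg hLg hpp hf hp j s
    (by positivity) he0 het hep).trans (le_of_eq ?_)
  rw [Real.mul_rpow hτ (Real.sqrt_nonneg _), Real.mul_rpow (by positivity) hLg,
    Real.sqrt_eq_rpow, ← Real.rpow_mul (by positivity), ← Real.rpow_mul (by norm_num)]
  have h : (2 : ℝ) ^ ((j : ℝ) *
      (D / 2 - σd - (σg + D / 2) * ((1 - pd⁻¹.toReal) / pg⁻¹.toReal))) =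
      (2 : ℝ) ^ (-((j : ℝ) * (σd + D * (1 / 2 - pd⁻¹.toReal)))) *
        (2 : ℝ) ^ (-((j : ℝ) * (σg + D * (1 / 2 - pg⁻¹.toReal))) *
          ((1 - pd⁻¹.toReal) / pg⁻¹.toReal)) := by
    rw [← Real.rpow_add (by norm_num)]
    congr 1
    field_simp
    ring
  rw [h, one_div_mul_eq_div]
  ring

/-- Here `t` is the `ℓ^{pg}` bound itself, so the two interpolated powers recombine into its first
power. -/
lemma sum_abs_motherCoeff_mul_bias_le (hpd : 1 ≤ pd) (hqd : 1 ≤ qd) (hpg : 1 ≤ pg)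
    (hpg' : pg ≠ ∞) (hqg : 1 ≤ qg) (hLg : 0 ≤ Lg) (hLd : 0 ≤ Ld)
    (hpp : 1 - pd⁻¹.toReal ≤ pg⁻¹.toReal)
    (hf : f ∈ besovBall φ ψ σd pd qd Ld) (hp : p ∈ besovBall φ ψ σg pg qg Lg) (j : ℕ)
    (s : Finset (MotherIndex D × (Fin D → ℤ))) :
    ∑ l ∈ s, |motherCoeff ψ f j l| * |motherCoeff ψ p j l| ≤ Ld * Lg *
      (2 : ℝ) ^ (-((j : ℝ) * (σg + σd - D * pg⁻¹.toReal + D * (1 - pd⁻¹.toReal)))) := by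
  have hb0 : 0 < pg⁻¹.toReal :=
    ENNReal.toReal_pos (ENNReal.inv_ne_zero.2 hpg') (ENNReal.inv_ne_top.2 (one_pos.trans_le hpg).ne')
  have hθ1 : (1 - pd⁻¹.toReal) / pg⁻¹.toReal ≤ 1 := by rwa [div_le_one hb0]
  have hθ0 : 0 ≤ (1 - pd⁻¹.toReal) / pg⁻¹.toReal :=
    div_nonneg (one_sub_inv_toReal_mem hpd).1 hb0.le
  refine (sum_abs_motherCoeff_mul_sparse_le hpd hqd hpg hpg' hqg hLg hpp hf hp j s
    (t := (2 : ℝ) ^ (-((j : ℝ) * (σg + D * (1 / 2 - pg⁻¹.toReal)))) * Lg)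
    (by positivity) (fun _ _ => abs_nonneg _)
    (fun l _ => abs_motherCoeff_le hpg hqg hLg hp j l) fun _ _ => le_rfl).trans ?_
  rw [← Real.rpow_add_of_nonneg (by positivity) (by linarith) hθ0, sub_add_cancel, Real.rpow_one]
  have hℓ := levelNorm_le hqd hLd hf j
  calc _ ≤ (2 : ℝ) ^ (-((j : ℝ) * (σd + D * (1 / 2 - pd⁻¹.toReal)))) * Ld *
        ((2 : ℝ) ^ (-((j : ℝ) * (σg + D * (1 / 2 - pg⁻¹.toReal)))) * Lg) := by gcongr
    _ = Ld * Lg * ((2 : ℝ) ^ (-((j : ℝ) * (σd + D * (1 / 2 - pd⁻¹.toReal)))) *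
        (2 : ℝ) ^ (-((j : ℝ) * (σg + D * (1 / 2 - pg⁻¹.toReal))))) := by ring
    _ = _ := by
        rw [← Real.rpow_add (by norm_num)]
        congr 2
        ring

end Pairing

/-! ### The pathwise bound -/

section Pathwise

variable {D n r : ℕ} {A B T σg σd Lg Ld : ℝ} {pg qg pd qd : ℝ≥0∞}
  {V : ℤ → Submodule ℝ (L2 D)} {φ p f : Space D → ℝ} {ψ : MotherIndex D → Space D → ℝ}

open Classical in
/-- The levels at which all empirical coefficients are kept. -/
def linearLevels (D : ℕ) (σ : ℝ) (p : ℝ≥0∞) (n : ℕ) : Finset ℕ :=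
  {j ∈ Finset.range (⌊highLevel D σ p n⌋₊ + 1) | ((j : ℕ) : ℝ) ≤ lowLevel D σ n}

open Classical in
/-- The levels at which the empirical coefficients are thresholded. -/
def thresholdedLevels (D : ℕ) (σ : ℝ) (p : ℝ≥0∞) (n : ℕ) : Finset ℕ :=
  {j ∈ Finset.range (⌊highLevel D σ p n⌋₊ + 1) | ¬ ((j : ℕ) : ℝ) ≤ lowLevel D σ n}

/-- The deviation of an empirical wavelet coefficient from its mean. -/
def levelDeviation (φ : Space D → ℝ) (ψ : MotherIndex D → Space D → ℝ) (p : Space D → ℝ)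
    (X : Fin n → Space D) (j : ℕ) (i : (Fin D → ℤ) ⊕ (MotherIndex D × (Fin D → ℤ))) : ℝ :=
  |empiricalMean X (levelFamily φ ψ j i) - ∫ x, p x * levelFamily φ ψ j i x|

/-- The sum over the relevant wavelets of the level `j` of the exponentials of the normalized
deviations, shifted by `κ`. -/
def expDeviation (φ : Space D → ℝ) (ψ : MotherIndex D → Space D → ℝ) (p : Space D → ℝ)
    (T A a κ : ℝ) (X : Fin n → Space D) (j : ℕ) : ℝ :=
  ∑ i ∈ levelBox D (2 ^ j * T + A),
    Real.exp (-(a * ((j : ℝ) + 1) * κ)) *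
      Real.exp (a * √(((j : ℝ) + 1) / n) * n * levelDeviation φ ψ p X j i)

lemma expDeviation_nonneg (a κ : ℝ) (X : Fin n → Space D) (j : ℕ) :
    0 ≤ expDeviation φ ψ p T A a κ X j :=
  Finset.sum_nonneg fun _ _ => by positivity

lemma exp_le_expDeviation (a κ : ℝ) (X : Fin n → Space D) (j : ℕ)
    {i : (Fin D → ℤ) ⊕ (MotherIndex D × (Fin D → ℤ))} (hi : i ∈ levelBox D (2 ^ j * T + A)) :
    Real.exp (a * √(((j : ℝ) + 1) / n) * n * levelDeviation φ ψ p X j i -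
      a * ((j : ℝ) + 1) * κ) ≤ expDeviation φ ψ p T A a κ X j := by
  rw [sub_eq_neg_add, Real.exp_add]
  exact Finset.single_le_sum (f := fun i => Real.exp (-(a * ((j : ℝ) + 1) * κ)) *
      Real.exp (a * √(((j : ℝ) + 1) / n) * n * levelDeviation φ ψ p X j i))
    (fun _ _ => by positivity) hi

/-- With `ρ = √((j+1)/n)` one has `ρ² n = j + 1 ≥ 1`, so `z` may be multiplied by `ρ² n` before
dividing by `a ρ n`. -/
lemma levelDeviation_le {a κ z : ℝ} (ha : 0 < a) (hn : 1 ≤ n) {X : Fin n → Space D} {j : ℕ}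
    {i : (Fin D → ℤ) ⊕ (MotherIndex D × (Fin D → ℤ))} (hz : 0 ≤ z)
    (h : a * √(((j : ℝ) + 1) / n) * n * levelDeviation φ ψ p X j i -
      a * ((j : ℝ) + 1) * κ ≤ z) :
    levelDeviation φ ψ p X j i ≤ (κ + z / a) * √(((j : ℝ) + 1) / n) := by
  have hn0 : (0 : ℝ) < n := by exact_mod_cast hn
  set ρ := √(((j : ℝ) + 1) / n) with hρ
  have hρ0 : 0 < ρ := Real.sqrt_pos.2 (by positivity)
  have hρ2 : (j : ℝ) + 1 = ρ * ρ * n := by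
    rw [hρ, Real.mul_self_sqrt (by positivity), div_mul_cancel₀ _ hn0.ne']
  have h1 : 1 ≤ ρ * ρ * n := by
    rw [← hρ2]
    linarith [Nat.cast_nonneg (α := ℝ) j]
  rw [hρ2] at h
  have h2 : a * ρ * n * levelDeviation φ ψ p X j i ≤ a * ρ * n * ((κ + z / a) * ρ) := by
    have h3 : a * ρ * n * ((κ + z / a) * ρ) = a * (ρ * ρ * n) * κ + z * (ρ * ρ * n) := by
      field_simp
    rw [h3]
    nlinarith
  exact le_of_mul_le_mul_left h2 (by positivity)

/-- By `1 + x ≤ e^x` the exponent is at most `z`. The bound is linear in `z`, so that a first moment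
of `expDeviation` suffices later. -/
lemma levelDeviation_le_of_expDeviation_le {a κ z : ℝ} (ha : 0 < a) (hn : 1 ≤ n)
    {X : Fin n → Space D} {j : ℕ} {i : (Fin D → ℤ) ⊕ (MotherIndex D × (Fin D → ℤ))}
    (hi : i ∈ levelBox D (2 ^ j * T + A)) (hz : expDeviation φ ψ p T A a κ X j ≤ z) :
    levelDeviation φ ψ p X j i ≤ (κ + z / a) * √(((j : ℝ) + 1) / n) := by
  refine levelDeviation_le ha hn ((expDeviation_nonneg a κ X j).trans hz) ?_
  have h1 := (exp_le_expDeviation a κ X j hi).trans hz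
  linarith [Real.add_one_le_exp (a * √(((j : ℝ) + 1) / n) * n * levelDeviation φ ψ p X j i -
      a * ((j : ℝ) + 1) * κ)]

/-- A sum of exponentials below `1` has only negative exponents. This is the event on which
thresholding works at a level, for all its wavelets at once. -/
lemma levelDeviation_le_of_expDeviation_lt_one {a κ : ℝ} (ha : 0 < a) (hn : 1 ≤ n)
    {X : Fin n → Space D} {j : ℕ} {i : (Fin D → ℤ) ⊕ (MotherIndex D × (Fin D → ℤ))}
    (hi : i ∈ levelBox D (2 ^ j * T + A)) (hz : expDeviation φ ψ p T A a κ X j < 1) :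
    levelDeviation φ ψ p X j i ≤ κ * √(((j : ℝ) + 1) / n) := by
  have h1 := (exp_le_expDeviation a κ X j hi).trans_lt hz
  rw [Real.exp_lt_one_iff] at h1
  have h2 := levelDeviation_le ha hn le_rfl h1.le
  rwa [zero_div, add_zero] at h2

lemma thresholdCoeff_eq_of_le {K : ℝ} {X : Fin n → Space D} {j : ℕ}
    (hj : (j : ℝ) ≤ lowLevel D σg n) (l : MotherIndex D × (Fin D → ℤ)) :
    thresholdCoeff ψ σg K X j l = empiricalMean X (dilate (ψ l.1) j l.2) := by
  rw [thresholdCoeff, if_pos (Or.inl hj)]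

lemma abs_thresholdCoeff_le {K : ℝ} (hB : 0 ≤ B) (hψ : ∀ ε x, |ψ ε x| ≤ B)
    (X : Fin n → Space D) (j : ℕ) (l : MotherIndex D × (Fin D → ℤ)) :
    |thresholdCoeff ψ σg K X j l| ≤ (2 : ℝ) ^ ((D : ℝ) * (j : ℝ) / 2) * B := by
  have h := abs_empiricalMean_le (X := X) (by positivity) (abs_dilate_le (hψ l.1) j l.2)
  rw [Int.cast_natCast] at h
  unfold thresholdCoeff
  split_ifs
  · exact h
  · rw [abs_zero]
    positivity

/-- The error of hard thresholding when the deviation is at most half of the threshold. -/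
lemma abs_sub_thresholdCoeff_le {κ : ℝ} {X : Fin n → Space D} {j : ℕ}
    (hj : ¬ (j : ℝ) ≤ lowLevel D σg n) (l : MotherIndex D × (Fin D → ℤ)) {β : ℝ}
    (h : |empiricalMean X (dilate (ψ l.1) j l.2) - β| ≤ 2 * κ * √((j : ℝ) / n)) :
    |β - thresholdCoeff ψ σg (4 * κ) X j l| ≤ 6 * κ * √((j : ℝ) / n) ∧
      |β - thresholdCoeff ψ σg (4 * κ) X j l| ≤ |β| := by
  set δ := 2 * κ * √((j : ℝ) / n) with hδ
  have h4 : 4 * κ * √((j : ℝ) / n) = 2 * δ := by rw [hδ]; ring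
  have h6 : 6 * κ * √((j : ℝ) / n) = 3 * δ := by rw [hδ]; ring
  have hδ0 : 0 ≤ δ := (abs_nonneg _).trans h
  rw [h6, thresholdCoeff, h4]
  have h1 := abs_sub_abs_le_abs_sub (empiricalMean X (dilate (ψ l.1) j l.2)) β
  split_ifs with hc
  -- A kept coefficient exceeds `2δ` while its deviation is at most `δ`, hence `|β| ≥ δ` dominates
  -- the error. For a discarded one the error is `|β|`, at most `3δ`.
  · have hc' := hc.resolve_left hj
    have h2 := h
    rw [abs_sub_comm] at h2
    constructor <;> linarith
  · have hc' : |empiricalMean X (dilate (ψ l.1) j l.2)| ≤ 2 * δ :=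
      not_lt.1 fun hlt => hc (Or.inr hlt)
    rw [sub_zero]
    refine ⟨?_, le_rfl⟩
    have h2 := abs_sub_abs_le_abs_sub β (empiricalMean X (dilate (ψ l.1) j l.2))
    rw [abs_sub_comm] at h2
    linarith

lemma abs_sub_le_of_tendsto {F F' I x y z : ℝ} {G G' : ℕ → ℝ} {m : ℕ}
    (hI : Filter.Tendsto (fun J => F + ∑ j ∈ Finset.range J, G j) Filter.atTop (nhds I))
    (hx : |F - F'| ≤ x) (hy : ∑ j ∈ Finset.range m, |G j - G' j| ≤ y)
    (hz : ∀ s : Finset ℕ, (∀ j ∈ s, m ≤ j) → ∑ j ∈ s, |G j| ≤ z) :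
    |I - (F' + ∑ j ∈ Finset.range m, G' j)| ≤ x + y + z := by
  refine le_of_tendsto (hI.sub_const _).abs ?_
  filter_upwards [Filter.eventually_ge_atTop m] with J hJ
  have h1 : F + ∑ j ∈ Finset.range J, G j - (F' + ∑ j ∈ Finset.range m, G' j) =
      (F - F') + ∑ j ∈ Finset.range m, (G j - G' j) + ∑ j ∈ Finset.Ico m J, G j := by
    rw [← Finset.sum_range_add_sum_Ico _ hJ, Finset.sum_sub_distrib]
    ring
  rw [h1]
  refine (abs_add_three _ _ _).trans ?_
  have h2 := (Finset.abs_sum_le_sum_abs (fun j => G j - G' j) (Finset.range m)).trans hy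
  have h3 := (Finset.abs_sum_le_sum_abs G (Finset.Ico m J)).trans
    (hz _ fun j hj => (Finset.mem_Ico.1 hj).1)
  linarith

lemma le_lowLevel_iff (hσ : 0 ≤ σg) (hD : 1 ≤ D) (hn : 1 ≤ n) (j : ℕ) :
    (j : ℝ) ≤ lowLevel D σg n ↔ (2 : ℝ) ^ ((j : ℝ) * (2 * σg + D)) ≤ n := by
  have hD0 : (1 : ℝ) ≤ D := by exact_mod_cast hD
  have hn0 : (0 : ℝ) < n := by exact_mod_cast hn
  rw [lowLevel, le_div_iff₀ (by linarith), Real.le_logb_iff_rpow_le (by norm_num) hn0]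

lemma lt_highLevel_add_one_iff (hσ : (D : ℝ) * pg⁻¹.toReal < σg) (hD : 1 ≤ D) (hn : 1 ≤ n)
    (j : ℕ) : j < ⌊highLevel D σg pg n⌋₊ + 1 ↔
      (2 : ℝ) ^ ((j : ℝ) * (2 * σg + D - 2 * D * pg⁻¹.toReal)) ≤ n := by
  have hD0 : (1 : ℝ) ≤ D := by exact_mod_cast hD
  have hn0 : (0 : ℝ) < n := by exact_mod_cast hn
  have hN : 0 < 2 * σg + D - 2 * D * pg⁻¹.toReal := by linarith
  have hl : 0 ≤ Real.logb 2 (n : ℝ) := Real.logb_nonneg (by norm_num) (by exact_mod_cast hn)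
  rw [highLevel, Nat.lt_succ_iff, Nat.le_floor_iff (div_nonneg hl hN.le), le_div_iff₀ hN,
    Real.le_logb_iff_rpow_le (by norm_num) hn0]

lemma two_pow_level_le (hσ : (D : ℝ) * pg⁻¹.toReal < σg) {j : ℕ}
    (hj : (2 : ℝ) ^ ((j : ℝ) * (2 * σg + D - 2 * D * pg⁻¹.toReal)) ≤ n) :
    (2 : ℝ) ^ ((j : ℝ) * D) ≤ n :=
  (Real.rpow_le_rpow_of_exponent_le (by norm_num)
    (mul_le_mul_of_nonneg_left (by linarith) (Nat.cast_nonneg j))).trans hj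

/-- Deliberately crude: at most `n` levels, each with `2^{jD} ≤ n`. It multiplies only `Z'`, whose
expectation is of order `n^{-3}`. -/
lemma sum_high_levels_le (hσ : (D : ℝ) * pg⁻¹.toReal < σg) (hD : 1 ≤ D) (hn : 1 ≤ n)
    {s : Finset ℕ} (hs : s ⊆ Finset.range (⌊highLevel D σg pg n⌋₊ + 1)) :
    ∑ j ∈ s, (2 : ℝ) ^ ((j : ℝ) * D) ≤ (n : ℝ) ^ 2 := by
  have hlev := lt_highLevel_add_one_iff hσ hD hn
  have hD0 : (1 : ℝ) ≤ D := by exact_mod_cast hD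
  have h1 : ((⌊highLevel D σg pg n⌋₊ + 1 : ℕ) : ℝ) ≤ n := by
    set m := ⌊highLevel D σg pg n⌋₊ with hm
    have h2 := two_pow_level_le hσ ((hlev m).1 (Nat.lt_succ_self m))
    refine le_trans ?_ h2
    have h3 : m + 1 ≤ 2 ^ m := Nat.lt_two_pow_self
    calc ((m + 1 : ℕ) : ℝ) ≤ ((2 ^ m : ℕ) : ℝ) := by exact_mod_cast h3
      _ = (2 : ℝ) ^ (m : ℝ) := by rw [Real.rpow_natCast]; push_cast; rfl
      _ ≤ _ := Real.rpow_le_rpow_of_exponent_le (by norm_num)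
          (le_mul_of_one_le_right (Nat.cast_nonneg m) hD0)
  calc ∑ j ∈ s, (2 : ℝ) ^ ((j : ℝ) * D) ≤ ∑ _j ∈ s, (n : ℝ) :=
        Finset.sum_le_sum fun j hj =>
          two_pow_level_le hσ ((hlev j).1 (Finset.mem_range.1 (hs hj)))
    _ = s.card * (n : ℝ) := by rw [Finset.sum_const, nsmul_eq_mul]
    _ ≤ n * n := by
        gcongr
        have h4 := Finset.card_le_card hs
        rw [Finset.card_range] at h4
        exact h4.trans (by exact_mod_cast h1)
    _ = (n : ℝ) ^ 2 := (sq _).symm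

/-- The loss of the thresholding estimator in terms of the exponential deviations `Z` at all levels
and `Z'` at the thresholded levels, given bounds for the sums over levels. -/
lemma IsWaveletSystem.abs_integral_sub_thresholdEstimator_le (hw : IsWaveletSystem r A V φ ψ)
    (hA : 0 ≤ A) (hB : 0 ≤ B) (hT : 0 ≤ T) (hφ : ∀ x, |φ x| ≤ B) (hψ : ∀ ε x, |ψ ε x| ≤ B)
    (hD : 1 ≤ D) (hn : 1 ≤ n) (hpg : 1 ≤ pg) (hpg' : pg ≠ ∞) (hqg : 1 ≤ qg) (hpd : 1 ≤ pd)
    (hqd : 1 ≤ qd) (hσd : 0 ≤ σd) (hσ : (D : ℝ) * pg⁻¹.toReal < σg) (hLg : 0 ≤ Lg) (hLd : 0 ≤ Ld)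
    (hpp : 1 - pd⁻¹.toReal ≤ pg⁻¹.toReal)
    (hp : p ∈ densityClass φ ψ σg pg qg Lg T) (hf : f ∈ besovBall φ ψ σd pd qd Ld)
    {X : Fin n → Space D} (hX : ∀ i m, |X i m| ≤ T) {a κ R₁ R₂ R₃ : ℝ} (ha : 0 < a) (hκ : 0 ≤ κ)
    (h₁ : ∀ (s : Finset ℕ) (ℓ : ℕ → ℝ), (∀ j, 0 ≤ ℓ j) → (∀ j, ℓ j ≤ Ld) →
      ∑ j ∈ s, ℓ j ≤ Ld * (s.card : ℝ) ^ (1 - qd⁻¹.toReal) →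
      (∀ j ∈ s, (2 : ℝ) ^ ((j : ℝ) * (2 * σg + D)) ≤ n) →
      ∑ j ∈ s, ℓ j * (√(((j : ℝ) + 1) / n) * (2 : ℝ) ^ ((j : ℝ) * (D / 2 - σd))) ≤ R₁)
    (h₂ : ∀ (s : Finset ℕ) (ℓ : ℕ → ℝ), (∀ j, 0 ≤ ℓ j) → (∀ j, ℓ j ≤ Ld) →
      ∑ j ∈ s, ℓ j ≤ Ld * (s.card : ℝ) ^ (1 - qd⁻¹.toReal) →
      (∀ j ∈ s, (n : ℝ) < (2 : ℝ) ^ ((j : ℝ) * (2 * σg + D))) →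
      (∀ j ∈ s, (2 : ℝ) ^ ((j : ℝ) * (2 * σg + D - 2 * D * pg⁻¹.toReal)) ≤ n) →
      ∑ j ∈ s, ℓ j * (((j : ℝ) / n) ^ ((1 - (1 - pd⁻¹.toReal) / pg⁻¹.toReal) / 2) *
        (2 : ℝ) ^ ((j : ℝ) *
          (D / 2 - σd - (σg + D / 2) * ((1 - pd⁻¹.toReal) / pg⁻¹.toReal)))) ≤ R₂)
    (h₃ : ∀ s : Finset ℕ,
      (∀ j ∈ s, (n : ℝ) < (2 : ℝ) ^ ((j : ℝ) * (2 * σg + D - 2 * D * pg⁻¹.toReal))) →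
      ∑ j ∈ s, (2 : ℝ) ^ (-((j : ℝ) * (σg + σd - D * pg⁻¹.toReal + D * (1 - pd⁻¹.toReal)))) ≤ R₃)
    {Z Z' : ℝ}
    (hZ : ∑ j ∈ Finset.range (⌊highLevel D σg pg n⌋₊ + 1), expDeviation φ ψ p T A a κ X j = Z)
    (hZ' : ∑ j ∈ thresholdedLevels D σg pg n,
      expDeviation φ ψ p T A a κ X j = Z') :
    Integrable (fun x => f x * p x) volume ∧
    Integrable (fun x => f x * thresholdEstimator φ ψ σg pg (4 * κ) n X x) volume ∧
    |(∫ x, f x * p x) - ∫ x, f x * thresholdEstimator φ ψ σg pg (4 * κ) n X x| ≤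
      (κ + Z / a) * (boxConst D T A * (Ld * √(1 / n) + R₁)) +
        (6 * κ) ^ (1 - (1 - pd⁻¹.toReal) / pg⁻¹.toReal) *
          Lg ^ ((1 - pd⁻¹.toReal) / pg⁻¹.toReal) * R₂ +
        Z' * (boxConst D T A * Ld * (B + Lg) * (n : ℝ) ^ 2) + Ld * Lg * R₃ := by
  classical
  have hn0 : (0 : ℝ) < n := by exact_mod_cast hn
  have hD0 : (1 : ℝ) ≤ D := by exact_mod_cast hD
  have hσ0 : 0 ≤ σg := by
    have : 0 ≤ (D : ℝ) * pg⁻¹.toReal := by positivity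
    linarith
  set m := ⌊highLevel D σg pg n⌋₊ + 1 with hm
  have hlev := lt_highLevel_add_one_iff hσ hD hn
  rw [← hm] at hlev
  have hpB := hp.1
  obtain ⟨-, hexp⟩ := hw.density_expansion hA hB hφ hψ hLg hpg hqg hσ hp
  obtain ⟨hint, hlim⟩ := hexp f hf.1
  have hC0 : 0 ≤ boxConst D T A := zero_le_one.trans (one_le_boxConst D hT hA)
  simp_rw [hw.thresholdEstimator_eq_expansion hX]
  obtain ⟨hint', hval'⟩ := hw.integral_mul_expansion hf.1 T
    (fun k => empiricalMean X (fun y => φ (y - latticePoint k))) (thresholdCoeff ψ σg (4 * κ) X) m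
  refine ⟨hint, hint', ?_⟩
  rw [hval']
  have hZ0 : ∀ j, 0 ≤ expDeviation φ ψ p T A a κ X j := fun j => expDeviation_nonneg a κ X j
  have hZn : 0 ≤ Z := hZ ▸ Finset.sum_nonneg fun j _ => hZ0 j
  have hZn' : 0 ≤ Z' := hZ' ▸ Finset.sum_nonneg fun j _ => hZ0 j
  have hjZ : ∀ j < m, expDeviation φ ψ p T A a κ X j ≤ Z := fun j hj =>
    hZ ▸ Finset.single_le_sum (fun j _ => hZ0 j) (Finset.mem_range.2 hj)
  set w := κ + Z / a with hwdef
  have hw0 : 0 ≤ w := by positivity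
  have hdev : ∀ j < m, ∀ i ∈ levelBox D (2 ^ j * T + A),
      levelDeviation φ ψ p X j i ≤ w * √(((j : ℝ) + 1) / n) := fun j hj i hi =>
    levelDeviation_le_of_expDeviation_le ha hn hi (hjZ j hj)
  set ℓ := levelNorm ψ σd pd f with hℓ
  have hℓ0 : ∀ j, 0 ≤ ℓ j := fun j => levelNorm_nonneg j
  have hℓ1 : ∀ j, ℓ j ≤ Ld := fun j => levelNorm_le hqd hLd hf j
  have hℓs : ∀ s : Finset ℕ, ∑ j ∈ s, ℓ j ≤ Ld * (s.card : ℝ) ^ (1 - qd⁻¹.toReal) :=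
    fun s => sum_levelNorm_le hqd hLd hf s
  have hmem : ∀ (j : ℕ) l, l ∈ motherBox D T A j → Sum.inr l ∈ levelBox D (2 ^ j * T + A) :=
    fun j l hl => by simpa [levelBox, motherBox] using hl
  have hfather : |∑ k ∈ latticeBox D (T + A), fatherCoeff φ p k * fatherCoeff φ f k -
      ∑ k ∈ latticeBox D (T + A), empiricalMean X (fun y => φ (y - latticePoint k)) *
        fatherCoeff φ f k| ≤ w * (boxConst D T A * (Ld * √(1 / n))) := by
    rw [← Finset.sum_sub_distrib]
    refine (Finset.abs_sum_le_sum_abs _ _).trans ?_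
    have h := sum_abs_fatherCoeff_mul_le hT hA hpd hLd hf
      (e := fun k => |fatherCoeff φ p k - empiricalMean X (fun y => φ (y - latticePoint k))|)
      (t := w * √(1 / n)) (by positivity) (fun _ _ => abs_nonneg _) fun k hk => by
        have h4 := hdev 0 (Nat.succ_pos _) (Sum.inl k) (by simpa [levelBox] using hk)
        simp only [levelDeviation, levelFamily, Sum.elim_inl, Nat.cast_zero, dilate_zero,
          zero_add] at h4
        rw [abs_sub_comm]
        exact h4
    calc _ = ∑ k ∈ latticeBox D (T + A), |fatherCoeff φ f k| *
          |fatherCoeff φ p k - empiricalMean X (fun y => φ (y - latticePoint k))| := by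
          refine Finset.sum_congr rfl fun k _ => ?_
          rw [← sub_mul, abs_mul, mul_comm]
      _ ≤ _ := h
      _ = _ := by ring
  have hlevel : ∀ j, |∑ l ∈ motherBox D T A j, motherCoeff ψ p j l * motherCoeff ψ f j l -
      ∑ l ∈ motherBox D T A j, thresholdCoeff ψ σg (4 * κ) X j l * motherCoeff ψ f j l| ≤
      ∑ l ∈ motherBox D T A j, |motherCoeff ψ f j l| *
        |motherCoeff ψ p j l - thresholdCoeff ψ σg (4 * κ) X j l| := fun j => by
    rw [← Finset.sum_sub_distrib]
    refine (Finset.abs_sum_le_sum_abs _ _).trans (le_of_eq ?_)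
    refine Finset.sum_congr rfl fun l _ => ?_
    rw [← sub_mul, abs_mul, mul_comm]
  have hlow : ∑ j ∈ linearLevels D σg pg n,
      ∑ l ∈ motherBox D T A j, |motherCoeff ψ f j l| *
        |motherCoeff ψ p j l - thresholdCoeff ψ σg (4 * κ) X j l| ≤
      w * (boxConst D T A * R₁) := by
    calc _ ≤ ∑ j ∈ linearLevels D σg pg n, boxConst D T A *
          (ℓ j * (w * √(((j : ℝ) + 1) / n) * (2 : ℝ) ^ ((j : ℝ) * (D / 2 - σd)))) := by
          refine Finset.sum_le_sum fun j hj => ?_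
          rw [linearLevels, Finset.mem_filter, Finset.mem_range] at hj
          refine sum_abs_motherCoeff_mul_le hT hA hpd hqd hf j (by positivity)
            (fun _ _ => abs_nonneg _) fun l hl => ?_
          rw [thresholdCoeff_eq_of_le hj.2, abs_sub_comm]
          exact hdev j hj.1 _ (hmem j l hl)
      _ = w * (boxConst D T A * ∑ j ∈ linearLevels D σg pg n,
          ℓ j * (√(((j : ℝ) + 1) / n) * (2 : ℝ) ^ ((j : ℝ) * (D / 2 - σd)))) := by
          rw [Finset.mul_sum, Finset.mul_sum]
          exact Finset.sum_congr rfl fun j _ => by ring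
      _ ≤ _ := by
          gcongr
          refine h₁ _ ℓ hℓ0 hℓ1 (hℓs _) fun j hj => ?_
          exact (le_lowLevel_iff hσ0 hD hn j).1 (Finset.mem_filter.1 hj).2
  -- Nonnegativity is read off from the empty set of levels.
  have hR₂ : 0 ≤ R₂ := by
    have h := h₂ ∅ ℓ hℓ0 hℓ1 (hℓs _) (by simp) (by simp)
    simpa using h
  have hmid : ∑ j ∈ thresholdedLevels D σg pg n,
      ∑ l ∈ motherBox D T A j, |motherCoeff ψ f j l| *
        |motherCoeff ψ p j l - thresholdCoeff ψ σg (4 * κ) X j l| ≤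
      (6 * κ) ^ (1 - (1 - pd⁻¹.toReal) / pg⁻¹.toReal) *
          Lg ^ ((1 - pd⁻¹.toReal) / pg⁻¹.toReal) * R₂ +
        Z' * (boxConst D T A * Ld * (B + Lg) * (n : ℝ) ^ 2) := by
    -- If `Z' < 1`, every deviation at these levels is at most half the threshold `4κ √(j/n)`. If
    -- `Z' ≥ 1`, the factor `Z'` can be inserted in front of a trivial bound, Markov's inequality in
    -- disguise.
    rcases lt_or_ge Z' 1 with hz | hz
    · refine le_trans ?_ (le_add_of_nonneg_right (by positivity))
      calc _ ≤ ∑ j ∈ thresholdedLevels D σg pg n,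
            (6 * κ) ^ (1 - (1 - pd⁻¹.toReal) / pg⁻¹.toReal) *
              Lg ^ ((1 - pd⁻¹.toReal) / pg⁻¹.toReal) * (ℓ j *
              (((j : ℝ) / n) ^ ((1 - (1 - pd⁻¹.toReal) / pg⁻¹.toReal) / 2) * (2 : ℝ) ^ ((j : ℝ) *
              (D / 2 - σd - (σg + D / 2) * ((1 - pd⁻¹.toReal) / pg⁻¹.toReal))))) := by
            refine Finset.sum_le_sum fun j hj => ?_
            have hjlow := (Finset.mem_filter.1 hj).2
            -- Level `0` is never thresholded. For `j ≥ 1`, `j + 1 ≤ 4 j` replaces `j + 1` in the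
            -- deviation bound by the `j` of the threshold.
            have hj1 : 1 ≤ j := by
              by_contra hj0
              refine hjlow ((le_lowLevel_iff hσ0 hD hn j).2 ?_)
              have : j = 0 := by omega
              rw [this]
              simpa using hn
            have hjz : expDeviation φ ψ p T A a κ X j < 1 :=
              lt_of_le_of_lt (hZ' ▸ Finset.single_le_sum (fun j _ => hZ0 j) hj) hz
            have hsq : √(((j : ℝ) + 1) / n) ≤ 2 * √((j : ℝ) / n) := by
              have h5 : (2 : ℝ) = √4 := by
                rw [show (4 : ℝ) = 2 ^ 2 by norm_num, Real.sqrt_sq (by norm_num)]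
              rw [h5, ← Real.sqrt_mul (by norm_num), ← mul_div_assoc]
              apply Real.sqrt_le_sqrt
              gcongr
              have : (1 : ℝ) ≤ j := by exact_mod_cast hj1
              linarith
            have herr : ∀ l ∈ motherBox D T A j, _ := fun l hl =>
              abs_sub_thresholdCoeff_le (κ := κ) (X := X) hjlow l (β := motherCoeff ψ p j l) (by
                refine (levelDeviation_le_of_expDeviation_lt_one ha hn (hmem j l hl) hjz).trans ?_
                calc κ * √(((j : ℝ) + 1) / n) ≤ κ * (2 * √((j : ℝ) / n)) := by gcongr
                  _ = _ := by ring)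
            exact sum_abs_motherCoeff_mul_threshold_le hpd hqd hpg hpg' hqg hLg hpp hf hpB j n _
              (by positivity) (fun _ _ => abs_nonneg _) (fun l hl => (herr l hl).1)
              fun l hl => (herr l hl).2
        _ ≤ _ := by
            rw [← Finset.mul_sum]
            gcongr
            refine h₂ _ ℓ hℓ0 hℓ1 (hℓs _) (fun j hj => ?_) fun j hj => ?_
            · exact not_le.1 fun h => (Finset.mem_filter.1 hj).2
                ((le_lowLevel_iff hσ0 hD hn j).2 h)
            · exact (hlev j).1 (Finset.mem_range.1 (Finset.mem_filter.1 hj).1)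
    · refine le_trans ?_ (le_add_of_nonneg_left (by positivity))
      refine le_trans ?_ (le_mul_of_one_le_left (by positivity) hz)
      calc _ ≤ ∑ j ∈ thresholdedLevels D σg pg n,
            boxConst D T A * Ld * (B + Lg) * (2 : ℝ) ^ ((j : ℝ) * D) := by
            refine Finset.sum_le_sum fun j hj => ?_
            refine (sum_abs_motherCoeff_mul_le hT hA hpd hqd hf j
              (t := (B + Lg) * (2 : ℝ) ^ ((D : ℝ) * (j : ℝ) / 2)) (by positivity)
              (fun _ _ => abs_nonneg _) fun l hl => ?_).trans ?_
            · have h6 := abs_thresholdCoeff_le (σg := σg) (K := 4 * κ) hB hψ X j l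
              have h7 := abs_motherCoeff_le hpg hqg hLg hpB j l
              -- Only a common crude size is needed: the empirical coefficients grow at most like
              -- `2^{Dj/2}`, and those of `p` are smaller still.
              have h8 : (2 : ℝ) ^ (-((j : ℝ) * (σg + D * (1 / 2 - pg⁻¹.toReal)))) ≤
                  (2 : ℝ) ^ ((D : ℝ) * (j : ℝ) / 2) := by
                refine Real.rpow_le_rpow_of_exponent_le (by norm_num) ?_
                have h9 : 0 ≤ (j : ℝ) * (σg + D * (1 / 2 - pg⁻¹.toReal)) :=
                  mul_nonneg (Nat.cast_nonneg j) (by linarith)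
                have h10 : 0 ≤ (D : ℝ) * (j : ℝ) / 2 := by positivity
                linarith
              have h11 := mul_le_mul_of_nonneg_right h8 hLg
              refine (abs_sub _ _).trans ?_
              linarith
            · calc _ ≤ boxConst D T A * (Ld * ((B + Lg) * (2 : ℝ) ^ ((D : ℝ) * (j : ℝ) / 2) *
                    (2 : ℝ) ^ ((j : ℝ) * (D / 2 - σd)))) := by
                    gcongr
                    exact hℓ1 j
                _ = boxConst D T A * Ld * (B + Lg) * ((2 : ℝ) ^ ((D : ℝ) * (j : ℝ) / 2) *
                    (2 : ℝ) ^ ((j : ℝ) * (D / 2 - σd))) := by ring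
                _ ≤ _ := by
                    rw [← Real.rpow_add (by norm_num)]
                    gcongr
                    · norm_num
                    · have := mul_nonneg (Nat.cast_nonneg (α := ℝ) j) hσd
                      linarith
        _ ≤ _ := by
            rw [← Finset.mul_sum]
            gcongr
            exact sum_high_levels_le hσ hD hn (Finset.filter_subset _ _)
  have hbias : ∀ s : Finset ℕ, (∀ j ∈ s, m ≤ j) →
      ∑ j ∈ s, |∑ l ∈ motherBox D T A j, motherCoeff ψ p j l * motherCoeff ψ f j l| ≤
        Ld * Lg * R₃ := fun s hs => by
    calc _ ≤ ∑ j ∈ s, Ld * Lg * (2 : ℝ) ^ (-((j : ℝ) *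
          (σg + σd - D * pg⁻¹.toReal + D * (1 - pd⁻¹.toReal)))) := by
          refine Finset.sum_le_sum fun j _ => ?_
          refine le_trans ?_ (sum_abs_motherCoeff_mul_bias_le hpd hqd hpg hpg' hqg hLg hLd hpp hf
            hpB j (motherBox D T A j))
          refine (Finset.abs_sum_le_sum_abs _ _).trans (le_of_eq ?_)
          exact Finset.sum_congr rfl fun l _ => by rw [abs_mul, mul_comm]
      _ ≤ _ := by
          rw [← Finset.mul_sum]
          gcongr
          refine h₃ s fun j hj => not_le.1 fun h => ?_
          exact absurd ((hlev j).2 h) (not_lt.2 (hs j hj))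
  -- The levels below `m` split into linear and thresholded ones; the tail is the bias, bounded
  -- uniformly over finite sets of levels and hence in the limit.
  have hmain := abs_sub_le_of_tendsto hlim hfather (m := m)
    (G' := fun j => ∑ l ∈ motherBox D T A j,
      thresholdCoeff ψ σg (4 * κ) X j l * motherCoeff ψ f j l)
    ((Finset.sum_le_sum fun j _ => hlevel j).trans
      ((Finset.sum_filter_add_sum_filter_not _ (fun j : ℕ => (j : ℝ) ≤ lowLevel D σg n) _).symm.le.trans
        (add_le_add hlow hmid))) hbias
  refine hmain.trans (le_of_eq ?_)
  ring

end Pathwise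

/-! ### The risk of the thresholding estimator -/

section Risk

variable {D n r : ℕ} {A B T σg σd Lg Ld : ℝ} {pg qg pd qd : ℝ≥0∞}
  {V : ℤ → Submodule ℝ (L2 D)} {φ p : Space D → ℝ} {ψ : MotherIndex D → Space D → ℝ}

lemma toReal_inv_conjExponent {p : ℝ≥0∞} (hp : 1 ≤ p) :
    (ENNReal.conjExponent p)⁻¹.toReal = 1 - p⁻¹.toReal := by
  have h := (ENNReal.HolderConjugate.conjExponent hp).inv_add_inv_eq_one
  have h1 : p⁻¹ ≠ ∞ := ENNReal.inv_ne_top.2 (one_pos.trans_le hp).ne'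
  have h2 : (ENNReal.conjExponent p)⁻¹ ≠ ∞ := fun h' => by
    rw [h', add_top] at h
    exact ENNReal.top_ne_one h
  have h3 := congrArg ENNReal.toReal h
  rw [ENNReal.toReal_add h1 h2, ENNReal.toReal_one] at h3
  linarith

lemma ipm_le {F : Set (Space D → ℝ)} {p q : Space D → ℝ} {y : ℝ}
    (h : ∀ f ∈ F, Integrable (fun x => f x * p x) volume ∧
      Integrable (fun x => f x * q x) volume ∧
      |(∫ x, f x * p x) - ∫ x, f x * q x| ≤ y) : ipm F p q ≤ ENNReal.ofReal y := by
  refine iSup₂_le fun f hf => ?_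
  obtain ⟨h1, h2, h3⟩ := h f hf
  rw [if_pos ⟨h1, h2⟩]
  exact ENNReal.ofReal_le_ofReal h3

/-- A measurable majorant is needed only on a set of full measure: it may be set to `∞` elsewhere.
Measurability of the supremum over `f` is thereby never required. -/
lemma outerExpectation_le {Ω : Type} [MeasurableSpace Ω] {μ : Measure Ω} {g h : Ω → ℝ≥0∞}
    {S : Set Ω} (hS : MeasurableSet S) (hμ : ∀ᵐ ω ∂μ, ω ∈ S) (hh : Measurable h)
    (hgh : ∀ ω ∈ S, g ω ≤ h ω) : outerExpectation μ g ≤ ∫⁻ ω, h ω ∂μ := by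
  classical
  refine iInf_le_of_le (S.piecewise h fun _ => ∞) (iInf₂_le_of_le
    (hh.piecewise hS measurable_const) (fun ω => ?_) (le_of_eq (lintegral_congr_ae ?_)))
  · by_cases hω : ω ∈ S
    · simpa [hω] using hgh ω hω
    · simp [hω]
  · filter_upwards [hμ] with ω hω
    simp [hω]

lemma ae_sampleLaw_mem_cube (hpm : Measurable p) (hp0 : ∀ x, 0 ≤ p x) (hp1 : ∫ x, p x = 1)
    (hpT : SupportedInCube T p) : ∀ᵐ X ∂(sampleLaw p n), ∀ i m, |X i m| ≤ T := by
  have : IsProbabilityMeasure (densityLaw p) := isProbabilityMeasure_densityLaw hp0 hp1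
  have h1 : ∀ᵐ x ∂(densityLaw p), ∀ m, |x m| ≤ T := by
    rw [densityLaw, ae_withDensity_iff hpm.ennreal_ofReal]
    refine Filter.Eventually.of_forall fun x hx => ?_
    by_contra hm
    push Not at hm
    exact hx (by rw [hpT x hm, ENNReal.ofReal_zero])
  rw [ae_all_iff]
  intro i
  exact (Measure.quasiMeasurePreserving_eval (fun _ : Fin n => densityLaw p) i).ae h1

lemma IsWaveletSystem.measurable_levelDeviation (hw : IsWaveletSystem r A V φ ψ) (j : ℕ)
    (i : (Fin D → ℤ) ⊕ (MotherIndex D × (Fin D → ℤ))) :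
    Measurable fun X : Fin n → Space D => levelDeviation φ ψ p X j i := by
  have h := measurable_empiricalMean (n := n) (hw.continuous_level j i).measurable
  unfold levelDeviation
  simp_rw [← Real.norm_eq_abs]
  fun_prop

lemma IsWaveletSystem.measurable_expDeviation (hw : IsWaveletSystem r A V φ ψ) (a κ : ℝ)
    (j : ℕ) : Measurable fun X : Fin n → Space D => expDeviation φ ψ p T A a κ X j := by
  unfold expDeviation
  refine Finset.measurable_fun_sum _ fun i _ => ?_
  have := hw.measurable_levelDeviation (n := n) (p := p) j i
  fun_prop

/-- The wavelets have unit `L²` norm, so the sup bound on the density bounds the variances at all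
levels uniformly. -/
lemma IsWaveletSystem.integral_mul_level_sq_le (hw : IsWaveletSystem r A V φ ψ)
    (hp0 : ∀ x, 0 ≤ p x) {v : ℝ} (hv : ∀ᵐ x, p x ≤ v) (j : ℤ)
    (i : (Fin D → ℤ) ⊕ (MotherIndex D × (Fin D → ℤ))) :
    ∫ x, p x * levelFamily φ ψ j i x ^ 2 ≤ v := by
  have h2 : Integrable (fun x => levelFamily φ ψ j i x ^ 2) volume :=
    Integrable.of_integral_ne_zero (by rw [hw.integral_level_sq]; exact one_ne_zero)
  calc ∫ x, p x * levelFamily φ ψ j i x ^ 2 ≤ ∫ x, v * levelFamily φ ψ j i x ^ 2 := by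
        refine integral_mono_of_nonneg
          (Filter.Eventually.of_forall fun x => mul_nonneg (hp0 x) (sq_nonneg _))
          (h2.const_mul v) ?_
        filter_upwards [hv] with x hx
        exact mul_le_mul_of_nonneg_right hx (sq_nonneg _)
    _ = v := by rw [integral_const_mul, hw.integral_level_sq, mul_one]

/-- With `t = a √((j+1)/n)` the variance term `n t² v` is `(j+1) a² v`, on the same scale as the
shift; one moment is then multiplied by the number of wavelets. -/
lemma IsWaveletSystem.lintegral_expDeviation_le (hw : IsWaveletSystem r A V φ ψ) (hA : 0 ≤ A)
    (hT : 0 ≤ T) (hφ : ∀ x, |φ x| ≤ B) (hψ : ∀ ε x, |ψ ε x| ≤ B) (hn : 1 ≤ n)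
    (hpm : Measurable p) (hp0 : ∀ x, 0 ≤ p x) (hp1 : ∫ x, p x = 1) {v : ℝ}
    (hv : ∀ᵐ x, p x ≤ v) {a κ : ℝ} (ha : 0 ≤ a) (j : ℕ)
    (haB : 2 * (a * √(((j : ℝ) + 1) / n)) * ((2 : ℝ) ^ ((D : ℝ) * (j : ℝ) / 2) * B) ≤ 1) :
    ∫⁻ X, ENNReal.ofReal (expDeviation φ ψ p T A a κ X j) ∂(sampleLaw p n) ≤
      ENNReal.ofReal (boxConst D T A * (2 : ℝ) ^ ((j : ℝ) * D) *
        (2 * Real.exp (((j : ℝ) + 1) * (a ^ 2 * v - a * κ)))) := by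
  have hn0 : (0 : ℝ) < n := by exact_mod_cast hn
  have hterm : ∀ i, ∫⁻ X : Fin n → Space D, ENNReal.ofReal (Real.exp (-(a * ((j : ℝ) + 1) * κ)) *
      Real.exp (a * √(((j : ℝ) + 1) / n) * n * levelDeviation φ ψ p X j i)) ∂(sampleLaw p n) ≤
      ENNReal.ofReal (2 * Real.exp (((j : ℝ) + 1) * (a ^ 2 * v - a * κ))) := fun i => by
    have h1 := lintegral_exp_deviation_le hpm hp0 hp1 (hw.continuous_level j i).measurable
      (M := (2 : ℝ) ^ ((D : ℝ) * (j : ℝ) / 2) * B) (v := v)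
      (fun x => by simpa using abs_level_le hφ hψ j i x)
      (hw.integral_mul_level_sq_le hp0 hv j i) (t := a * √(((j : ℝ) + 1) / n)) (by positivity)
      haB hn
    simp_rw [ENNReal.ofReal_mul (Real.exp_pos (-(a * ((j : ℝ) + 1) * κ))).le]
    rw [lintegral_const_mul' _ _ ENNReal.ofReal_ne_top]
    refine (mul_le_mul_right h1 _).trans (le_of_eq ?_)
    rw [← ENNReal.ofReal_mul (Real.exp_pos _).le]
    congr 1
    rw [mul_left_comm, ← Real.exp_add, mul_pow, Real.sq_sqrt (by positivity)]
    congr 2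
    field_simp
    ring
  have hmeas : ∀ i, Measurable fun X : Fin n → Space D =>
      ENNReal.ofReal (Real.exp (-(a * ((j : ℝ) + 1) * κ)) *
      Real.exp (a * √(((j : ℝ) + 1) / n) * n * levelDeviation φ ψ p X j i)) := fun i => by
    have := hw.measurable_levelDeviation (n := n) (p := p) j i
    fun_prop
  unfold expDeviation
  simp_rw [ENNReal.ofReal_sum_of_nonneg fun i _ => (mul_pos (Real.exp_pos _) (Real.exp_pos _)).le]
  rw [lintegral_finsetSum _ fun i _ => hmeas i]
  refine (Finset.sum_le_sum fun i _ => hterm i).trans ?_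
  rw [Finset.sum_const, nsmul_eq_mul, ← ENNReal.ofReal_natCast,
    ← ENNReal.ofReal_mul (Nat.cast_nonneg _)]
  gcongr
  exact card_levelBox_le_boxConst D hT hA j

lemma exists_add_one_le_mul_two_rpow {δ : ℝ} (hδ : 0 < δ) :
    ∃ c : ℝ, 0 < c ∧ ∀ j : ℕ, (j : ℝ) + 1 ≤ c * (2 : ℝ) ^ ((j : ℝ) * δ) := by
  have hl : 0 < Real.log 2 := Real.log_pos (by norm_num)
  refine ⟨1 / (δ * Real.log 2) + 1, by positivity, fun j => ?_⟩
  have h1 : (1 : ℝ) ≤ (2 : ℝ) ^ ((j : ℝ) * δ) :=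
    Real.one_le_rpow (by norm_num) (by positivity)
  have h2 : (j : ℝ) * (δ * Real.log 2) ≤ (2 : ℝ) ^ ((j : ℝ) * δ) := by
    rw [Real.rpow_def_of_pos (by norm_num)]
    have := Real.add_one_le_exp (Real.log 2 * ((j : ℝ) * δ))
    linarith
  have h3 : (j : ℝ) ≤ 1 / (δ * Real.log 2) * (2 : ℝ) ^ ((j : ℝ) * δ) := by
    rw [one_div, inv_mul_eq_div, le_div_iff₀ (by positivity)]
    exact h2
  linarith

/-- The normalization of the deviations: small enough for the exponential moment bound. -/
lemma exists_deviation_scale (hσ : (D : ℝ) * pg⁻¹.toReal < σg) (hD : 1 ≤ D) (hB : 0 < B) :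
    ∃ a : ℝ, 0 < a ∧ ∀ n : ℕ, 1 ≤ n → ∀ j < ⌊highLevel D σg pg n⌋₊ + 1,
      2 * (a * √(((j : ℝ) + 1) / n)) * ((2 : ℝ) ^ ((D : ℝ) * (j : ℝ) / 2) * B) ≤ 1 := by
  -- This is the gap between the exponents of `2^{jD}` and of the cutoff `2^{j(2σg + D - 2D/pg)} ≤
  -- n`; it absorbs the factor `j + 1`.
  have hδ : 0 < 2 * (σg - D * pg⁻¹.toReal) := by linarith
  obtain ⟨c, hc0, hc⟩ := exists_add_one_le_mul_two_rpow hδ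
  have hsc : 0 < √c := Real.sqrt_pos.2 hc0
  refine ⟨1 / (2 * √c * B), by positivity, fun n hn j hj => ?_⟩
  have hn0 : (0 : ℝ) < n := by exact_mod_cast hn
  have h1 := (lt_highLevel_add_one_iff hσ hD hn j).1 hj
  have h2 : √(((j : ℝ) + 1) / n) * (2 : ℝ) ^ ((D : ℝ) * (j : ℝ) / 2) ≤ √c := by
    have h3 : (2 : ℝ) ^ ((D : ℝ) * (j : ℝ) / 2) = √((2 : ℝ) ^ ((D : ℝ) * (j : ℝ))) := by
      rw [Real.sqrt_eq_rpow, ← Real.rpow_mul (by norm_num)]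
      congr 1
      ring
    rw [h3, ← Real.sqrt_mul (by positivity)]
    apply Real.sqrt_le_sqrt
    rw [div_mul_eq_mul_div, div_le_iff₀ hn0]
    calc ((j : ℝ) + 1) * (2 : ℝ) ^ ((D : ℝ) * (j : ℝ))
        ≤ c * (2 : ℝ) ^ ((j : ℝ) * (2 * (σg - D * pg⁻¹.toReal))) *
          (2 : ℝ) ^ ((D : ℝ) * (j : ℝ)) := by
          gcongr
          exact hc j
      _ = c * (2 : ℝ) ^ ((j : ℝ) * (2 * σg + D - 2 * D * pg⁻¹.toReal)) := by
          rw [mul_assoc, ← Real.rpow_add (by norm_num)]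
          congr 2
          ring
      _ ≤ c * n := by gcongr
  calc _ = (1 / √c) * (√(((j : ℝ) + 1) / n) * (2 : ℝ) ^ ((D : ℝ) * (j : ℝ) / 2)) := by
        field_simp
    _ ≤ (1 / √c) * √c := by gcongr
    _ = 1 := by field_simp

lemma lintegral_affine_le {Ω : Type} [MeasurableSpace Ω] {μ : Measure Ω} [IsProbabilityMeasure μ]
    {Z Z' : Ω → ℝ} (hZ : Measurable Z) (hZ0 : ∀ ω, 0 ≤ Z ω) (hZ0' : ∀ ω, 0 ≤ Z' ω)
    {c x x' y y' : ℝ} (hc : 0 ≤ c) (hx : 0 ≤ x) (hx' : 0 ≤ x') (hy : 0 ≤ y) (hy' : 0 ≤ y')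
    (h : ∫⁻ ω, ENNReal.ofReal (Z ω) ∂μ ≤ ENNReal.ofReal y)
    (h' : ∫⁻ ω, ENNReal.ofReal (Z' ω) ∂μ ≤ ENNReal.ofReal y') :
    ∫⁻ ω, ENNReal.ofReal (c + x * Z ω + x' * Z' ω) ∂μ ≤ ENNReal.ofReal (c + x * y + x' * y') := by
  have h1 : ∀ ω, ENNReal.ofReal (c + x * Z ω + x' * Z' ω) = ENNReal.ofReal c +
      ENNReal.ofReal x * ENNReal.ofReal (Z ω) + ENNReal.ofReal x' * ENNReal.ofReal (Z' ω) :=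
    fun ω => by
      rw [ENNReal.ofReal_add (add_nonneg hc (mul_nonneg hx (hZ0 ω))) (mul_nonneg hx' (hZ0' ω)),
        ENNReal.ofReal_add hc (mul_nonneg hx (hZ0 ω)), ENNReal.ofReal_mul hx,
        ENNReal.ofReal_mul hx']
  simp_rw [h1]
  rw [lintegral_add_left (by fun_prop), lintegral_add_left (by fun_prop), lintegral_const,
    measure_univ, mul_one, lintegral_const_mul' _ _ ENNReal.ofReal_ne_top,
    lintegral_const_mul' _ _ ENNReal.ofReal_ne_top,
    ENNReal.ofReal_add (by positivity) (by positivity), ENNReal.ofReal_add hc (by positivity),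
    ENNReal.ofReal_mul hx, ENNReal.ofReal_mul hx']
  gcongr

/-- Moments of the exponential deviations: `κ` is chosen such that they decay over the levels. -/
lemma IsWaveletSystem.lintegral_sum_expDeviation_le (hw : IsWaveletSystem r A V φ ψ) (hA : 0 ≤ A)
    (hT : 0 ≤ T) (hφ : ∀ x, |φ x| ≤ B) (hψ : ∀ ε x, |ψ ε x| ≤ B) (hn : 1 ≤ n)
    (hpm : Measurable p) (hp0 : ∀ x, 0 ≤ p x) (hp1 : ∫ x, p x = 1) {v : ℝ}
    (hv : ∀ᵐ x, p x ≤ v) {a κ N y : ℝ} (ha : 0 ≤ a) (hN : 0 ≤ N) (hy : 0 ≤ y)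
    (haκ : a * κ = a ^ 2 * v + (D + 1 + N) * Real.log 2) (s : Finset ℕ)
    (hs : ∀ j ∈ s, 2 * (a * √(((j : ℝ) + 1) / n)) * ((2 : ℝ) ^ ((D : ℝ) * (j : ℝ) / 2) * B) ≤ 1)
    (hsy : ∀ j ∈ s, (2 : ℝ) ^ (-((j : ℝ) * N)) ≤ y) :
    ∫⁻ X, ENNReal.ofReal (∑ j ∈ s, expDeviation φ ψ p T A a κ X j) ∂(sampleLaw p n) ≤
      ENNReal.ofReal (4 * boxConst D T A * y) := by
  have hC := one_le_boxConst D hT hA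
  have hC0 : 0 ≤ boxConst D T A := by linarith
  simp_rw [ENNReal.ofReal_sum_of_nonneg fun j _ => expDeviation_nonneg a κ _ j]
  rw [lintegral_finsetSum _ fun j _ => (hw.measurable_expDeviation a κ j).ennreal_ofReal]
  calc _ ≤ ∑ j ∈ s, ENNReal.ofReal (2 * boxConst D T A * y * (1 / 2) ^ j) := by
        refine Finset.sum_le_sum fun j hj => (hw.lintegral_expDeviation_le hA hT hφ hψ hn hpm hp0
          hp1 hv ha j (hs j hj)).trans (ENNReal.ofReal_le_ofReal ?_)
        -- In the exponent `D + 1 + N`, `D` pays for the number of wavelets, `1` makes the levels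
        -- summable, and `N` gives the decay recorded in `y`.
        have h1 : Real.exp (((j : ℝ) + 1) * (a ^ 2 * v - a * κ)) ≤
            (2 : ℝ) ^ (-((j : ℝ) * (D + 1 + N))) := by
          rw [Real.rpow_def_of_pos (by norm_num)]
          apply Real.exp_le_exp.2
          rw [haκ]
          have h2 : 0 ≤ (D + 1 + N) * Real.log 2 :=
            mul_nonneg (by positivity) (Real.log_pos (by norm_num)).le
          nlinarith
        calc _ ≤ boxConst D T A * (2 : ℝ) ^ ((j : ℝ) * D) *
              (2 * (2 : ℝ) ^ (-((j : ℝ) * (D + 1 + N)))) := by gcongr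
          _ = 2 * boxConst D T A * ((2 : ℝ) ^ ((j : ℝ) * D) *
              (2 : ℝ) ^ (-((j : ℝ) * (D + 1 + N)))) := by ring
          _ = 2 * boxConst D T A * ((2 : ℝ) ^ (-((j : ℝ) * N)) * (2 : ℝ) ^ (-(j : ℝ))) := by
              rw [← Real.rpow_add (by norm_num), ← Real.rpow_add (by norm_num)]
              congr 2
              ring
          _ = 2 * boxConst D T A * ((2 : ℝ) ^ (-((j : ℝ) * N)) * (1 / 2) ^ j) := by
              rw [Real.rpow_neg (by norm_num), Real.rpow_neg (by norm_num), Real.rpow_natCast,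
                one_div, inv_pow]
          _ ≤ 2 * boxConst D T A * (y * (1 / 2) ^ j) := by
              gcongr
              exact hsy j hj
          _ = _ := by ring
    _ = ENNReal.ofReal (2 * boxConst D T A * y * ∑ j ∈ s, (1 / 2 : ℝ) ^ j) := by
        rw [Finset.mul_sum, ENNReal.ofReal_sum_of_nonneg fun j _ => by positivity]
    _ ≤ _ := by
        apply ENNReal.ofReal_le_ofReal
        have h3 := sum_pow_le_of_lt_one (ρ := 1 / 2) (Y := 1) (by norm_num) (by norm_num) s
          zero_le_one fun j _ => pow_le_one₀ (by norm_num) (by norm_num)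
        norm_num at h3 ⊢
        calc 2 * boxConst D T A * y * ∑ j ∈ s, (1 / 2 : ℝ) ^ j
            ≤ 2 * boxConst D T A * y * 2 := by gcongr
          _ = _ := by ring

/-- The worst-case risk of the thresholding estimator. -/
lemma exists_risk_thresholdEstimator_le (hD : 1 ≤ D) (hpg : 1 ≤ pg) (hqg : 1 ≤ qg) (hpd : 1 ≤ pd)
    (hσd : 0 ≤ σd) (hσ : (D : ℝ) * pg⁻¹.toReal < σg) (hp : pg < ENNReal.conjExponent pd)
    (hLg : 0 < Lg) (hLd : 0 < Ld) (hT : 0 < T) (hA : 0 < A) (hB : 0 < B) :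
    ∃ K C : ℝ, 0 < K ∧ 0 < C ∧
      ∀ (r : ℕ) (V : ℤ → Submodule ℝ (L2 D)) (φ : Space D → ℝ)
        (ψ : MotherIndex D → Space D → ℝ), IsWaveletSystem r A V φ ψ →
      (∀ x, |φ x| ≤ B) → (∀ ε x, |ψ ε x| ≤ B) →
      ∀ qd : ℝ≥0∞, 1 ≤ qd → ∀ n : ℕ, 1 ≤ n → ∀ p ∈ densityClass φ ψ σg pg qg Lg T,
        risk (besovBall φ ψ σd pd qd Ld) n (thresholdEstimator φ ψ σg pg K n) p ≤
          ENNReal.ofReal (C * upperRate D σg σd pg (ENNReal.conjExponent pd) qd n) := by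
  have hpg' : pg ≠ ∞ := (hp.trans_le le_top).ne
  have hconj := toReal_inv_conjExponent hpd
  have hb0 : 0 < pg⁻¹.toReal := ENNReal.toReal_pos (ENNReal.inv_ne_zero.2 hpg')
    (ENNReal.inv_ne_top.2 (one_pos.trans_le hpg).ne')
  have hpp' : (ENNReal.conjExponent pd)⁻¹.toReal ≤ pg⁻¹.toReal :=
    ENNReal.toReal_mono (ENNReal.inv_ne_top.2 (one_pos.trans_le hpg).ne')
      (ENNReal.inv_le_inv.2 hp.le)
  have hpp : 1 - pd⁻¹.toReal ≤ pg⁻¹.toReal := hconj ▸ hpp'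
  obtain ⟨C₁, hC₁, h₁⟩ := exists_sum_linear_levels_le (D := D) (σd := σd)
    (pd' := ENNReal.conjExponent pd) hσ hD
  obtain ⟨C₂, hC₂, h₂⟩ := exists_sum_threshold_levels_le (D := D) (σd := σd)
    (pd' := ENNReal.conjExponent pd) hσ hD hb0 hpp'
  obtain ⟨C₃, hC₃, h₃⟩ := exists_sum_bias_levels_le (D := D) (σd := σd)
    (pd' := ENNReal.conjExponent pd) hσ hD hσd
  rw [hconj] at h₂ h₃
  obtain ⟨a, ha, haB⟩ := exists_deviation_scale hσ hD hB
  have hD0 : (1 : ℝ) ≤ D := by exact_mod_cast hD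
  have hσ0 : 0 < σg := lt_of_le_of_lt (by positivity) hσ
  have hl2 : 0 < Real.log 2 := Real.log_pos (by norm_num)
  set v := expansionBound D A B Lg (σg - D * pg⁻¹.toReal) with hv
  have hv0 : 0 ≤ v := by
    have h1 := two_rpow_neg_lt_one (sub_pos.2 hσ)
    have h2 : 0 ≤ (1 - (2 : ℝ) ^ (-(σg - D * pg⁻¹.toReal)))⁻¹ := inv_nonneg.2 (by linarith)
    rw [hv, expansionBound]
    positivity
  -- At a thresholded level `2^{j(2σg+D)} > n`, so `2^{-jN} ≤ n^{-3}`: enough to beat the crude `n²`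
  -- and leave `1/n`.
  set N : ℝ := 3 * (2 * σg + D) with hN
  have hN0 : 0 < N := by positivity
  set κ := (a ^ 2 * v + (D + 1 + N) * Real.log 2) / a with hκ
  have hκ0 : 0 < κ := by positivity
  have haκ : a * κ = a ^ 2 * v + (D + 1 + N) * Real.log 2 := by
    rw [hκ]
    field_simp
  set Cb := boxConst D T A with hCb
  have hCb1 : 1 ≤ Cb := one_le_boxConst D hT.le hA.le
  set Ct := (6 * κ) ^ (1 - (1 - pd⁻¹.toReal) / pg⁻¹.toReal) *
    Lg ^ ((1 - pd⁻¹.toReal) / pg⁻¹.toReal) with hCt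
  have hCt0 : 0 < Ct := by positivity
  refine ⟨4 * κ, (κ + 4 * Cb / a) * (Cb * (Ld + C₁ * Ld)) + Ct * (C₂ * Ld) +
    4 * Cb * (Cb * Ld * (B + Lg)) + Ld * Lg * C₃, by positivity, by positivity, ?_⟩
  intro r V φ ψ hw hφ hψ qd hqd n hn p hpc
  have hpm : Measurable p := hpc.2.1
  have hp0 : ∀ x, 0 ≤ p x := hpc.2.2.1
  have hp1 : ∫ x, p x = 1 := hpc.2.2.2.1
  have hpT : SupportedInCube T p := hpc.2.2.2.2
  have hn0 : (0 : ℝ) < n := by exact_mod_cast hn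
  have hpv := (hw.density_expansion hA.le hB.le hφ hψ hLg.le hpg hqg hσ hpc).1
  have : IsProbabilityMeasure (densityLaw p) := isProbabilityMeasure_densityLaw hp0 hp1
  have : IsProbabilityMeasure (sampleLaw p n) := by
    change IsProbabilityMeasure (Measure.pi fun _ => densityLaw p)
    infer_instance
  set R := upperRate D σg σd pg (ENNReal.conjExponent pd) qd n with hR
  have hRn : (n : ℝ) ^ (-(1 / 2 : ℝ)) ≤ R := rpow_half_le_upperRate D σg σd pg _ qd hn
  have hR0 : 0 < R := lt_of_lt_of_le (by positivity) hRn
  -- Neither `Z` nor `Z'` involves `f`, so the pathwise bound holds for the supremum over the ball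
  -- before expectations are taken.
  let Z : (Fin n → Space D) → ℝ := fun X =>
    ∑ j ∈ Finset.range (⌊highLevel D σg pg n⌋₊ + 1), expDeviation φ ψ p T A a κ X j
  let Z' : (Fin n → Space D) → ℝ := fun X =>
    ∑ j ∈ thresholdedLevels D σg pg n, expDeviation φ ψ p T A a κ X j
  have hZm : Measurable Z := Finset.measurable_fun_sum _ fun j _ =>
    hw.measurable_expDeviation a κ j
  have hZm' : Measurable Z' := Finset.measurable_fun_sum _ fun j _ =>
    hw.measurable_expDeviation a κ j
  have hEZ : ∫⁻ X, ENNReal.ofReal (Z X) ∂(sampleLaw p n) ≤ ENNReal.ofReal (4 * Cb * 1) :=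
    hw.lintegral_sum_expDeviation_le hA.le hT.le hφ hψ hn hpm hp0 hp1 hpv ha.le hN0.le
      zero_le_one haκ _ (fun j hj => haB n hn j (Finset.mem_range.1 hj)) fun j _ =>
        Real.rpow_le_one_of_one_le_of_nonpos (by norm_num) (by
          have : 0 ≤ (j : ℝ) * N := by positivity
          linarith)
  have hEZ' : ∫⁻ X, ENNReal.ofReal (Z' X) ∂(sampleLaw p n) ≤
      ENNReal.ofReal (4 * Cb * ((n : ℝ) ^ 3)⁻¹) := by
    refine hw.lintegral_sum_expDeviation_le hA.le hT.le hφ hψ hn hpm hp0 hp1 hpv ha.le hN0.le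
      (by positivity) haκ _ (fun j hj => haB n hn j ?_) fun j hj => ?_
    · rw [thresholdedLevels, Finset.mem_filter, Finset.mem_range] at hj
      exact hj.1
    · rw [thresholdedLevels, Finset.mem_filter, le_lowLevel_iff hσ0.le hD hn, not_le] at hj
      have h5 : (2 : ℝ) ^ (-((j : ℝ) * N)) = (((2 : ℝ) ^ ((j : ℝ) * (2 * σg + D))) ^ 3)⁻¹ := by
        rw [Real.rpow_neg (by norm_num), hN, ← Real.rpow_mul_natCast (by norm_num)]
        congr 2
        push_cast
        ring
      rw [h5]
      gcongr
      exact hj.2.le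
  have hsq : √(1 / (n : ℝ)) = (n : ℝ) ^ (-(1 / 2 : ℝ)) := by
    rw [sqrt_div_natCast zero_le_one, Real.sqrt_one, one_mul]
  set P := Cb * (Ld * √(1 / n) + C₁ * Ld * R) with hP
  have hP0 : 0 ≤ P := by positivity
  set W := Cb * Ld * (B + Lg) * (n : ℝ) ^ 2 with hW
  have hW0 : 0 ≤ W := by positivity
  -- `c` collects the deterministic part of the pathwise bound; `P / a` and `W` are the coefficients
  -- of `Z` and `Z'`.
  set c := κ * P + Ct * (C₂ * Ld * R) + Ld * Lg * (C₃ * R) with hc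
  have hc0 : 0 ≤ c := by positivity
  calc risk (besovBall φ ψ σd pd qd Ld) n (thresholdEstimator φ ψ σg pg (4 * κ) n) p
      ≤ ∫⁻ X, ENNReal.ofReal (c + P / a * Z X + W * Z' X) ∂(sampleLaw p n) := by
        refine outerExpectation_le (S := {X | ∀ i m, |X i m| ≤ T}) ?_
          (ae_sampleLaw_mem_cube hpm hp0 hp1 hpT) (by fun_prop) fun X hX => ipm_le fun f hf => ?_
        · simp only [Set.ofPred_forall]
          refine MeasurableSet.iInter fun i => MeasurableSet.iInter fun m =>
            measurableSet_le ?_ measurable_const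
          simp_rw [← Real.norm_eq_abs]
          fun_prop
        · obtain ⟨hi, hi', h⟩ := hw.abs_integral_sub_thresholdEstimator_le hA.le hB.le hT.le hφ hψ
            hD hn hpg hpg' hqg hpd hqd hσd hσ hLg.le hLd.le hpp hpc hf hX ha hκ0.le
            (fun s ℓ hℓ0 hℓ1 hℓs hs => h₁ qd hqd n hn s ℓ Ld hℓ0 hℓ1 hℓs hs)
            (fun s ℓ hℓ0 hℓ1 hℓs hs hs' => h₂ qd hqd n hn s ℓ Ld hℓ0 hℓ1 hℓs hs hs')
            (fun s hs => h₃ qd hqd n hn s hs) (Z := Z X) (Z' := Z' X) rfl rfl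
          refine ⟨hi, hi', h.trans (le_of_eq ?_)⟩
          simp only [hc, hP, hW, hCt, hCb, hR]
          ring
    _ ≤ ENNReal.ofReal (c + P / a * (4 * Cb * 1) + W * (4 * Cb * ((n : ℝ) ^ 3)⁻¹)) :=
        lintegral_affine_le hZm (fun X => Finset.sum_nonneg fun j _ => expDeviation_nonneg a κ X j)
          (fun X => Finset.sum_nonneg fun j _ => expDeviation_nonneg a κ X j) hc0 (by positivity)
          hW0 (by positivity) (by positivity) hEZ hEZ'
    _ ≤ _ := by
        apply ENNReal.ofReal_le_ofReal
        have hPR : P ≤ Cb * (Ld + C₁ * Ld) * R := by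
          rw [hP, hsq]
          calc _ ≤ Cb * (Ld * R + C₁ * Ld * R) := by gcongr
            _ = _ := by ring
        have hWR : W * (4 * Cb * ((n : ℝ) ^ 3)⁻¹) ≤ 4 * Cb * (Cb * Ld * (B + Lg)) * R := by
          have h6 : (n : ℝ)⁻¹ ≤ R := by
            refine le_trans ?_ hRn
            rw [← Real.rpow_neg_one]
            exact Real.rpow_le_rpow_of_exponent_le (by exact_mod_cast hn) (by norm_num)
          calc W * (4 * Cb * ((n : ℝ) ^ 3)⁻¹) = 4 * Cb * (Cb * Ld * (B + Lg)) * (n : ℝ)⁻¹ := by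
                rw [hW]
                field_simp
            _ ≤ _ := by gcongr
        calc c + P / a * (4 * Cb * 1) + W * (4 * Cb * ((n : ℝ) ^ 3)⁻¹)
            = (κ + 4 * Cb / a) * P + Ct * (C₂ * Ld * R) + Ld * Lg * (C₃ * R) +
              W * (4 * Cb * ((n : ℝ) ^ 3)⁻¹) := by
              rw [hc]
              field_simp
              ring
          _ ≤ (κ + 4 * Cb / a) * (Cb * (Ld + C₁ * Ld) * R) + Ct * (C₂ * Ld * R) +
              Ld * Lg * (C₃ * R) + 4 * Cb * (Cb * Ld * (B + Lg)) * R := by gcongr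
          _ = _ := by ring

end Risk

end BesovIPM

end

theorem theorem2 (D : ℕ) (hD : 1 ≤ D) (σg σd : ℝ) (pg qg pd : ℝ≥0∞)
    (hpg : 1 ≤ pg) (hqg : 1 ≤ qg) (hpd : 1 ≤ pd) (hσd : 0 ≤ σd)
    (hσg : (D : ℝ) * pg⁻¹.toReal < σg) (hp : pg < ENNReal.conjExponent pd)
    (Lg Ld T A B : ℝ) (hLg : 0 < Lg) (hLd : 0 < Ld) (hT : 0 < T) (hA : 0 < A) (hB : 0 < B) :
    -- the constants depend on the wavelets only through `A` and the bound `B`, and not on `q_d`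
    ∃ K C : ℝ, 0 < K ∧ 0 < C ∧
      ∀ (r : ℕ), σg < r → σd < r →
      ∀ (V : ℤ → Submodule ℝ (BesovIPM.L2 D)) (φ : BesovIPM.Space D → ℝ)
        (ψ : BesovIPM.MotherIndex D → BesovIPM.Space D → ℝ),
      BesovIPM.IsWaveletSystem r A V φ ψ →
      (∀ x, |φ x| ≤ B) → (∀ ε x, |ψ ε x| ≤ B) →
      ∀ qd : ℝ≥0∞, 1 ≤ qd → ∀ n : ℕ, 1 ≤ n →
        -- the wavelet-thresholding estimator is an estimator and its worst-case risk is bounded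
        (BesovIPM.IsEstimator (BesovIPM.thresholdEstimator φ ψ σg pg K n) ∧
          ∀ p ∈ BesovIPM.densityClass φ ψ σg pg qg Lg T,
            BesovIPM.risk (BesovIPM.besovBall φ ψ σd pd qd Ld) n
              (BesovIPM.thresholdEstimator φ ψ σg pg K n) p
            ≤ ENNReal.ofReal
              (C * BesovIPM.upperRate D σg σd pg (ENNReal.conjExponent pd) qd n)) ∧
        -- hence so is the minimax risk
        BesovIPM.minimaxRisk (BesovIPM.besovBall φ ψ σd pd qd Ld)
            (BesovIPM.densityClass φ ψ σg pg qg Lg T) n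
          ≤ ENNReal.ofReal
            (C * BesovIPM.upperRate D σg σd pg (ENNReal.conjExponent pd) qd n) := by
  obtain ⟨K, C, hK, hC, h⟩ := BesovIPM.exists_risk_thresholdEstimator_le hD hpg hqg hpd hσd hσg hp
    hLg hLd hT hA hB
  refine ⟨K, C, hK, hC, fun r _ _ V φ ψ hw hφ hψ qd hqd n hn => ?_⟩
  have hest : BesovIPM.IsEstimator (BesovIPM.thresholdEstimator φ ψ σg pg K n) :=
    hw.isEstimator_thresholdEstimator
  have hrisk := h r V φ ψ hw hφ hψ qd hqd n hn
  exact ⟨⟨hest, hrisk⟩, iInf₂_le_of_le _ hest (iSup₂_le hrisk)⟩
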